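/- There is a polynomial-time algorithm that, given an instance of \textsc{Multicolored Clique}, i.e. an undirected simple graph $G$ together with a partition of $V(G)$ into $k \ge 1$ sets $V_1,\dots,V_k$ of equal size $N$ (the question being whether $G$ has a clique $C$ with $|C\cap V_i|=1$ for every $i\in\{1,\dots,k\}$), outputs an equivalent instance of \textsc{All-or-Nothing Flow}, i.e. a directed loopless multigraph $D$ with arc capacities $c\colon E(D)\to\mathbb{Z}_{>0}$, two distinct vertices $s,t$ and a positive integer $\mathcal F$ (the question being whether there is an integral $st$-flow of value exactly $\mathcal F$ that sends either $0$ or $c(e)$ units over every arc $e$), such that 1. $G$ has a clique as required if and only if $(D,c,s,t)$ has an all-or-nothing $st$-flow of value exactly $\mathcal F$; 2. the underlying undirected graph of $D$ is planar; 3. the underlying undirected graph of $D$ has pathwidth at most $\alpha k$, for an absolute constant $\alpha$; 4. every capacity satisfies $c(e)\le p(|V(G)|)$, for a fixed polynomial $p$. -/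

import Mathlib

/-! ### Flow networks and all-or-nothing flows -/

/-- A flow network on the vertex set `V` whose arcs are indexed by `E`: a directed multigraph
(parallel arcs allowed, loops forbidden) with positive integer capacities and two distinct
vertices `s` (source) and `t` (sink). -/
@[ext]
structure FlowNetwork (V E : Type) where
  src : E → V
  tgt : E → V
  cap : E → ℕ
  s : V
  t : V
  src_ne_tgt : ∀ e, src e ≠ tgt e
  cap_pos : ∀ e, 0 < cap e
  s_ne_t : s ≠ t

namespace FlowNetwork

variable {V E : Type}

/-- Total amount of `f` on the arcs leading out of `v`. -/
def outflow [DecidableEq V] [Fintype E] (D : FlowNetwork V E) (f : E → ℕ) (v : V) : ℕ :=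
  ∑ e with D.src e = v, f e

/-- Total amount of `f` on the arcs leading into `v`. -/
def inflow [DecidableEq V] [Fintype E] (D : FlowNetwork V E) (f : E → ℕ) (v : V) : ℕ :=
  ∑ e with D.tgt e = v, f e

/-- `f` is an (integral) `st`-flow: capacity constraints and flow conservation. -/
structure IsFlow [DecidableEq V] [Fintype E] (D : FlowNetwork V E) (f : E → ℕ) : Prop where
  le_cap : ∀ e, f e ≤ D.cap e
  conservation : ∀ v, v ≠ D.s → v ≠ D.t → D.inflow f v = D.outflow f v

/-- The value of a flow: what leaves the source minus what enters it. -/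
def value [DecidableEq V] [Fintype E] (D : FlowNetwork V E) (f : E → ℕ) : ℤ :=
  (D.outflow f D.s : ℤ) - (D.inflow f D.s : ℤ)

/-- There is an all-or-nothing `st`-flow of value exactly `F`. -/
def HasAllOrNothingFlow [DecidableEq V] [Fintype E] (D : FlowNetwork V E) (F : ℕ) : Prop :=
  ∃ f : E → ℕ, D.IsFlow f ∧ (∀ e, f e = 0 ∨ f e = D.cap e) ∧ D.value f = (F : ℤ)

/-- The underlying undirected simple graph. -/
def underlying (D : FlowNetwork V E) : SimpleGraph V :=
  SimpleGraph.fromRel fun u v => ∃ e, D.src e = u ∧ D.tgt e = v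

/-- A planar drawing of the underlying multigraph: vertices are distinct points of the plane, each
arc is a simple curve between its end-points, no curve passes through a vertex in its interior,
and two distinct curves meet only at common end-points. -/
structure PlanarDrawing (D : FlowNetwork V E) where
  point : V → ℝ × ℝ
  curve : E → unitInterval → ℝ × ℝ
  point_injective : Function.Injective point
  curve_continuous : ∀ e, Continuous (curve e)
  curve_injective : ∀ e, Function.Injective (curve e)
  curve_zero : ∀ e, curve e 0 = point (D.src e)
  curve_one : ∀ e, curve e 1 = point (D.tgt e)
  avoids_points : ∀ e x v, curve e x = point v → x = 0 ∨ x = 1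
  avoids_curves : ∀ e e', e ≠ e' → ∀ x y, curve e x = curve e' y →
    (x = 0 ∨ x = 1) ∧ (y = 0 ∨ y = 1)

/-- The underlying multigraph is planar. -/
def IsPlanar (D : FlowNetwork V E) : Prop := Nonempty D.PlanarDrawing

end FlowNetwork

/-! ### Pathwidth -/

/-- A path decomposition of `G`; the nodes of the path are `0, 1, …, length - 1`, in this order. -/
structure PathDecomposition {V : Type} (G : SimpleGraph V) where
  length : ℕ
  bag : Fin length → Finset V
  exists_mem_bag : ∀ v, ∃ i, v ∈ bag i
  exists_adj_bag : ∀ u v, G.Adj u v → ∃ i, u ∈ bag i ∧ v ∈ bag i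
  mem_bag_of_between : ∀ v i j l, i ≤ j → j ≤ l → v ∈ bag i → v ∈ bag l → v ∈ bag j

/-- The size of a largest bag minus one. -/
def PathDecomposition.width {V : Type} {G : SimpleGraph V} (P : PathDecomposition G) : ℕ :=
  (Finset.univ.sup fun i => (P.bag i).card) - 1

/-- The minimum width of a path decomposition. -/
noncomputable def pathwidth {V : Type} (G : SimpleGraph V) : ℕ :=
  sInf (Set.range fun P : PathDecomposition G => P.width)

/-- A finite graph has a path decomposition, so the minimum above is over a nonempty set. -/
instance {V : Type} [Fintype V] (G : SimpleGraph V) : Nonempty (PathDecomposition G) :=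
  ⟨{ length := 1
     bag := fun _ => Finset.univ
     exists_mem_bag := fun _ => ⟨0, Finset.mem_univ _⟩
     exists_adj_bag := fun _ _ _ => ⟨0, Finset.mem_univ _, Finset.mem_univ _⟩
     mem_bag_of_between := fun _ _ _ _ _ _ _ _ => Finset.mem_univ _ }⟩

/-! ### Instances of the two problems -/

/-- An instance of Multicolored Clique: a simple graph on `n` vertices together with a partition of
its vertex set into `k` classes of `N` vertices each, given by the map `part` that sends a vertex
to the index of its class. -/
structure MulticoloredClique where
  n : ℕ
  k : ℕ
  N : ℕ
  graph : SimpleGraph (Fin n)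
  part : Fin n → Fin k
  k_pos : 0 < k
  card_part : ∀ i, (Finset.univ.filter fun v => part v = i).card = N

/-- There is a clique with exactly one vertex in each class. -/
def MulticoloredClique.IsYes (I : MulticoloredClique) : Prop :=
  ∃ C : Finset (Fin I.n), I.graph.IsClique (C : Set (Fin I.n)) ∧
    ∀ i, (C.filter fun v => I.part v = i).card = 1

/-- An instance of All-or-Nothing Flow: a flow network with `n` vertices and `m` arcs and a positive
target value. -/
structure AllOrNothingFlow where
  n : ℕ
  m : ℕ
  network : FlowNetwork (Fin n) (Fin m)
  target : ℕ
  target_pos : 0 < target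

/-- The network has an all-or-nothing flow of value exactly the target value. -/
def AllOrNothingFlow.IsYes (J : AllOrNothingFlow) : Prop :=
  J.network.HasAllOrNothingFlow J.target

/-! ### Encodings as bit strings

All numbers are written in unary, each closed by a `false`. For the input this costs only a
polynomial factor over any other encoding by an adjacency matrix. For the output it makes a
polynomial time bound only stronger than with numbers in binary. -/

/-- The self-delimiting unary code of a number. -/
def unaryCode (a : ℕ) : List Bool := List.replicate a true ++ [false]

/-- The numbers `n`, `k`, `N`, the class of each vertex, and the rows of the adjacency matrix. -/
noncomputable def MulticoloredClique.encode (I : MulticoloredClique) : List Bool :=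
  open Classical in
  unaryCode I.n ++ unaryCode I.k ++ unaryCode I.N ++
    (List.finRange I.n).flatMap (fun v => unaryCode (I.part v)) ++
    (List.finRange I.n).flatMap (fun u =>
      (List.finRange I.n).map fun v => decide (I.graph.Adj u v))

/-- The numbers of vertices and of arcs, the source, the sink and the target value, followed by
the tail, the head and the capacity of each arc. -/
def AllOrNothingFlow.encode (J : AllOrNothingFlow) : List Bool :=
  unaryCode J.n ++ unaryCode J.m ++ unaryCode J.network.s ++ unaryCode J.network.t ++
    unaryCode J.target ++
    (List.finRange J.m).flatMap (fun e =>
      unaryCode (J.network.src e) ++ unaryCode (J.network.tgt e) ++ unaryCode (J.network.cap e))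

theorem unaryCode_append_inj {a b : ℕ} {l l' : List Bool}
    (h : unaryCode a ++ l = unaryCode b ++ l') : a = b ∧ l = l' := by
  induction a generalizing b with
  | zero => cases b <;> simp_all [unaryCode, List.replicate_succ]
  | succ a ih =>
    cases b with
    | zero => simp [unaryCode, List.replicate_succ] at h
    | succ b =>
      have h' : unaryCode a ++ l = unaryCode b ++ l' := by
        simpa [unaryCode, List.replicate_succ] using h
      exact ⟨congrArg (· + 1) (ih h').1, (ih h').2⟩

theorem flatMap_append_inj {α : Type} (f g : α → List Bool) (P : α → Prop)
    (hfg : ∀ a l l', f a ++ l = g a ++ l' → P a ∧ l = l') (L : List α) :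
    ∀ l l', L.flatMap f ++ l = L.flatMap g ++ l' → (∀ a ∈ L, P a) ∧ l = l' := by
  induction L with
  | nil => intro l l' h; simpa using h
  | cons a L ih =>
    intro l l' h
    simp only [List.flatMap_cons, List.append_assoc] at h
    obtain ⟨h1, h2⟩ := hfg a _ _ h
    obtain ⟨h3, h4⟩ := ih _ _ h2
    exact ⟨by simpa using ⟨h1, h3⟩, h4⟩

/-- Distinct instances have distinct codes. -/
theorem MulticoloredClique.encode_injective :
    Function.Injective MulticoloredClique.encode := by
  classical
  rintro ⟨n, k, N, G, p, hk, hp⟩ ⟨n', k', N', G', p', hk', hp'⟩ h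
  simp only [MulticoloredClique.encode, List.append_assoc] at h
  obtain ⟨rfl, h⟩ := unaryCode_append_inj h
  obtain ⟨rfl, h⟩ := unaryCode_append_inj h
  obtain ⟨rfl, h⟩ := unaryCode_append_inj h
  obtain ⟨h1, h⟩ := flatMap_append_inj _ _ (fun v => p v = p' v)
    (fun v l l' e => ⟨Fin.ext (unaryCode_append_inj e).1, (unaryCode_append_inj e).2⟩) _ _ _ h
  replace h := congrArg (· ++ []) h
  have h2 := (flatMap_append_inj
    (fun u => (List.finRange n).map fun v => decide (G.Adj u v))
    (fun u => (List.finRange n).map fun v => decide (G'.Adj u v))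
    (fun u => ∀ v, G.Adj u v ↔ G'.Adj u v)
    (fun u l l' e => by
      obtain ⟨e1, e2⟩ := List.append_inj e (by simp)
      refine ⟨fun v => ?_, e2⟩
      have := List.map_inj_left.1 e1 v (List.mem_finRange v)
      simpa using this) _ _ _ h).1
  obtain rfl : p = p' := funext fun v => h1 v (List.mem_finRange v)
  obtain rfl : G = G' := by
    ext u v
    exact h2 u (List.mem_finRange u) v
  rfl

/-- Distinct instances have distinct codes. -/
theorem AllOrNothingFlow.encode_injective :
    Function.Injective AllOrNothingFlow.encode := by
  rintro ⟨n, m, D, F, hF⟩ ⟨n', m', D', F', hF'⟩ h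
  simp only [AllOrNothingFlow.encode, List.append_assoc] at h
  obtain ⟨rfl, h⟩ := unaryCode_append_inj h
  obtain ⟨rfl, h⟩ := unaryCode_append_inj h
  obtain ⟨hs, h⟩ := unaryCode_append_inj h
  obtain ⟨ht, h⟩ := unaryCode_append_inj h
  obtain ⟨hT, h⟩ := unaryCode_append_inj h
  replace h := congrArg (· ++ []) h
  have h2 := (flatMap_append_inj
    (fun e => unaryCode (D.src e) ++ (unaryCode (D.tgt e) ++ unaryCode (D.cap e)))
    (fun e => unaryCode (D'.src e) ++ (unaryCode (D'.tgt e) ++ unaryCode (D'.cap e)))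
    (fun e => D.src e = D'.src e ∧ D.tgt e = D'.tgt e ∧ D.cap e = D'.cap e)
    (fun e l l' q => by
      simp only [List.append_assoc] at q
      obtain ⟨q1, q⟩ := unaryCode_append_inj q
      obtain ⟨q2, q⟩ := unaryCode_append_inj q
      obtain ⟨q3, q⟩ := unaryCode_append_inj q
      exact ⟨⟨Fin.ext q1, Fin.ext q2, q3⟩, q⟩) _ _ _ h).1
  obtain rfl : D = D' := by
    apply FlowNetwork.ext
    · exact funext fun e => (h2 e (List.mem_finRange e)).1
    · exact funext fun e => (h2 e (List.mem_finRange e)).2.1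
    · exact funext fun e => (h2 e (List.mem_finRange e)).2.2
    · exact Fin.ext hs
    · exact Fin.ext ht
  subst hT
  rfl

/-! The target value is the total capacity of the arcs out of the source, so a flow of this value
fills all of them and leaves the arcs into the source empty. The network is a strip of `k` rows, one
per class, crossed by columns. Row `i` starts with `A = 2 * n + 2` units, and the amount it carries
is its memory: `A` means that nothing is selected yet, `A + 2 * (x + 1)` that the vertex `x` is
selected. In a column the row passes through one of `n + 1` labelled middle vertices, by arcs with
capacities in `[A, 2 * A)`. Since arcs are full or empty, exactly one label is used, and the
capacity of its entering arc must be the amount of the row.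

In every column but the last the middle vertices of all rows lie on one vertical path to the sink
whose arcs have equal capacity `q < A`, so it carries `0` or `q`. This path is the only
communication between rows, and it needs no crossings. In an ordinary column it receives `q` units
from the source, and these reach the sink unless a row absorbs them, by leaving through an arc that
is larger by `q` than the arc through which it entered. Hence at most one row per column absorbs.

Column `x < n` selects: with `q = 2 * (x + 1)`, the row of the class of `x` may pass from `A` to `A
+ 2 * (x + 1)`. For each ordered pair `x`, `y` there follow two columns with `q = 1`. If `x` and `y`
are not adjacent, every row that selected one of them must absorb a unit in the first column, which
is impossible for two rows; in the second column the row releases its unit to the vertical path,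
which starts empty there. As the amounts of the states differ by even numbers, the extra unit does
not blur the memory. The last column has no label for the amount `A`, so every row must have
selected a vertex.

The equivalence rests on `StripData.hasAllOrNothingFlow_iff`, which turns flows into choices of
labels, and on `CliqueStrip.exists_clique_of_routing` and `CliqueStrip.exists_routing_of_clique`.
Planarity is shown by a straight-line drawing (`StripData.isPlanar_network`), and the pathwidth
bound by a sweep whose bags hold the source, the sink, the gates of two columns and two middle
vertices (`StripData.width_decomposition_le`). All capacities are at most `2 * A`.

For the running time, a language of unary counters is compiled to multi-stack machines
(`CounterProg.steps_code`). Its programs run in polynomial time when their counters stay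
polynomially bounded (`CounterProg.cost_le`). The columns follow the order in which the input lists
classes and adjacency bits, so the reduction reads its input once as a stream and never stores the
graph. -/

/-! ### Counter programs

A small imperative language with finitely many natural-number counters, an input stream of bits and
an output stream of bits. All programs terminate. -/

/-- Counter programs over the counters `K`. -/
inductive CounterProg (K : Type)
  | skip : CounterProg K
  | inc (r : K) : CounterProg K
  | dec (r : K) : CounterProg K
  | write (b : Bool) : CounterProg K
  | readNum (r : K) : CounterProg K
  | readBit (p q : CounterProg K) : CounterProg K
  | seq (p q : CounterProg K) : CounterProg K
  | rep (r : K) (p : CounterProg K) : CounterProg K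
  | ifZero (r : K) (p q : CounterProg K) : CounterProg K

/-- The state of a counter program: the values of the counters, the input that is left and the
output written so far. -/
@[ext]
structure CounterState (K : Type) where
  reg : K → ℕ
  inp : List Bool
  out : List Bool

/-- Split off a unary number. -/
def splitUnary : List Bool → ℕ × List Bool
  | [] => (0, [])
  | false :: l => (0, l)
  | true :: l => ((splitUnary l).1 + 1, (splitUnary l).2)

@[simp]
theorem splitUnary_unaryCode_append (a : ℕ) (l : List Bool) :
    splitUnary (unaryCode a ++ l) = (a, l) := by
  induction a with
  | zero => simp [unaryCode, splitUnary]
  | succ a ih =>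
    have : unaryCode (a + 1) ++ l = true :: (unaryCode a ++ l) := by
      simp [unaryCode, List.replicate_succ]
    rw [this, splitUnary, ih]

namespace CounterState

variable {K : Type} [DecidableEq K]

/-- Change the value of one counter. -/
@[simps]
def set (s : CounterState K) (r : K) (a : ℕ) : CounterState K :=
  { s with reg := Function.update s.reg r a }

end CounterState

/-- Total cost of iterating `f` with cost function `g`. -/
def iterateCost {α : Type} (f : α → α) (g : α → ℕ) : ℕ → α → ℕ
  | 0, _ => 0
  | m + 1, a => g a + iterateCost f g m (f a)

namespace CounterProg

open CounterState

variable {K : Type} [DecidableEq K]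

/-- The state after the run of a program. -/
def eval : CounterProg K → CounterState K → CounterState K
  | skip, s => s
  | inc r, s => s.set r (s.reg r + 1)
  | dec r, s => s.set r (s.reg r - 1)
  | write b, s => { s with out := s.out ++ [b] }
  | readNum r, s => { s.set r (s.reg r + (splitUnary s.inp).1) with inp := (splitUnary s.inp).2 }
  | readBit p q, s =>
    if s.inp.head? = some true then p.eval { s with inp := s.inp.tail }
    else q.eval { s with inp := s.inp.tail }
  | seq p q, s => q.eval (p.eval s)
  | rep r p, s => (p.eval)^[s.reg r] s
  | ifZero r p q, s => if s.reg r = 0 then p.eval s else q.eval s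

/-- The number of steps that the compiled machine takes. -/
def cost : CounterProg K → CounterState K → ℕ
  | skip, _ => 0
  | inc _, _ => 1
  | dec _, _ => 1
  | write _, _ => 1
  | readNum _, s => (splitUnary s.inp).1 + 1
  | readBit p q, s =>
    1 + if s.inp.head? = some true then p.cost { s with inp := s.inp.tail }
      else q.cost { s with inp := s.inp.tail }
  | seq p q, s => p.cost s + q.cost (p.eval s)
  | rep r p, s => 3 * (s.reg r + 1) + iterateCost p.eval p.cost (s.reg r) s
  | ifZero r p q, s => 1 + if s.reg r = 0 then p.cost s else q.cost s

/-! ### Compilation to multi-stack machines -/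

/-- The auxiliary stacks that a program needs: two for every loop. -/
@[reducible]
def Aux : CounterProg K → Type
  | readBit p q => p.Aux ⊕ q.Aux
  | seq p q => p.Aux ⊕ q.Aux
  | rep _ p => Bool ⊕ p.Aux
  | ifZero _ p q => p.Aux ⊕ q.Aux
  | _ => Empty

/-- The labels of the compiled program. -/
@[reducible]
def Label : CounterProg K → Type
  | skip => Empty
  | readBit p q => Unit ⊕ (p.Label ⊕ q.Label)
  | seq p q => p.Label ⊕ q.Label
  | rep _ p => Fin 3 ⊕ p.Label
  | ifZero _ p q => Unit ⊕ (p.Label ⊕ q.Label)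
  | _ => Unit

instance decidableEqAux : (p : CounterProg K) → DecidableEq p.Aux
  | readBit p q | seq p q | ifZero _ p q =>
    have := decidableEqAux p
    have := decidableEqAux q
    inferInstanceAs (DecidableEq (p.Aux ⊕ q.Aux))
  | rep _ p =>
    have := decidableEqAux p
    inferInstanceAs (DecidableEq (Bool ⊕ p.Aux))
  | skip | inc _ | dec _ | write _ | readNum _ => inferInstanceAs (DecidableEq Empty)

instance fintypeAux : (p : CounterProg K) → Fintype p.Aux
  | readBit p q | seq p q | ifZero _ p q =>
    have := fintypeAux p
    have := fintypeAux q
    inferInstanceAs (Fintype (p.Aux ⊕ q.Aux))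
  | rep _ p =>
    have := fintypeAux p
    inferInstanceAs (Fintype (Bool ⊕ p.Aux))
  | skip | inc _ | dec _ | write _ | readNum _ => inferInstanceAs (Fintype Empty)

instance fintypeLabel : (p : CounterProg K) → Fintype p.Label
  | seq p q =>
    have := fintypeLabel p
    have := fintypeLabel q
    inferInstanceAs (Fintype (p.Label ⊕ q.Label))
  | readBit p q | ifZero _ p q =>
    have := fintypeLabel p
    have := fintypeLabel q
    inferInstanceAs (Fintype (Unit ⊕ (p.Label ⊕ q.Label)))
  | rep _ p =>
    have := fintypeLabel p
    inferInstanceAs (Fintype (Fin 3 ⊕ p.Label))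
  | skip => inferInstanceAs (Fintype Empty)
  | inc _ | dec _ | write _ | readNum _ => inferInstanceAs (Fintype Unit)

/-- The stacks of a compiled program: the counters, the auxiliary stacks, and the stacks for the
input, the reversed output and the final output. -/
inductive Stack (K Ω : Type)
  | reg (r : K)
  | aux (w : Ω)
  | inp
  | rev
  | res
  deriving DecidableEq, Fintype

/-- Statements of the compiled machines. -/
abbrev MStmt (K Ω Λ : Type) := Turing.TM2.Stmt (fun _ : Stack K Ω => Bool) Λ (Option Bool)

section Compile

variable {Ω Λ : Type}

open Turing.TM2.Stmt

/-- Forget the internal state and jump. -/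
def jump (a : Λ) : MStmt K Ω Λ := load (fun _ => none) (goto fun _ => a)

/-- Pop a bit and run one of two statements depending on whether it was `true`. -/
def popCase (k : Stack K Ω) (p q : MStmt K Ω Λ) : MStmt K Ω Λ :=
  pop k (fun _ o => o) (branch (fun o => o == some true) p q)

/-- Push `true`. -/
def pushUnit (k : Stack K Ω) (p : MStmt K Ω Λ) : MStmt K Ω Λ := push k (fun _ => true) p

/-- The label at which a program starts. -/
def entry : (p : CounterProg K) → (p.Label → Λ) → Λ → Λ
  | skip, _, e => e
  | seq p q, f, e => p.entry (fun l => f (Sum.inl l)) (q.entry (fun l => f (Sum.inr l)) e)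
  | rep _ _, f, _ => f (Sum.inl 0)
  | readBit _ _, f, _ => f (Sum.inl ())
  | ifZero _ _ _, f, _ => f (Sum.inl ())
  | inc _, f, _ | dec _, f, _ | write _, f, _ | readNum _, f, _ => f ()

/-- The code of a program; `f` embeds its labels, `g` its auxiliary stacks and `e` is the label at
which it ends. -/
def code : (p : CounterProg K) → (p.Label → Λ) → (p.Aux → Ω) → Λ → p.Label → MStmt K Ω Λ
  | skip, _, _, _, l => nomatch l
  | inc r, _, _, e, _ => pushUnit (.reg r) (jump e)
  | dec r, _, _, e, _ => popCase (.reg r) (jump e) (jump e)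
  | write b, _, _, e, _ => push .rev (fun _ => b) (jump e)
  | readNum r, f, _, e, _ => popCase .inp (pushUnit (.reg r) (jump (f ()))) (jump e)
  | readBit p q, f, g, e, l =>
    match l with
    | Sum.inl _ => popCase .inp (jump (p.entry (fun l => f (Sum.inr (Sum.inl l))) e))
        (jump (q.entry (fun l => f (Sum.inr (Sum.inr l))) e))
    | Sum.inr (Sum.inl l) =>
      p.code (fun l => f (Sum.inr (Sum.inl l))) (fun w => g (Sum.inl w)) e l
    | Sum.inr (Sum.inr l) =>
      q.code (fun l => f (Sum.inr (Sum.inr l))) (fun w => g (Sum.inr w)) e l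
  | seq p q, f, g, e, l =>
    match l with
    | Sum.inl l => p.code (fun l => f (Sum.inl l)) (fun w => g (Sum.inl w))
        (q.entry (fun l => f (Sum.inr l)) e) l
    | Sum.inr l => q.code (fun l => f (Sum.inr l)) (fun w => g (Sum.inr w)) e l
  | rep r p, f, g, e, l =>
    match l with
    -- The three labels of a loop: copy the counter onto two auxiliary stacks, refill it from one,
    -- and run the body once per unit of the other. The number of iterations is thus fixed on entry,
    -- even if the body changes the counter.
    | Sum.inl 0 => popCase (.reg r)
        (pushUnit (.aux (g (Sum.inl false))) (pushUnit (.aux (g (Sum.inl true)))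
          (jump (f (Sum.inl 0))))) (jump (f (Sum.inl 1)))
    | Sum.inl 1 => popCase (.aux (g (Sum.inl false)))
        (pushUnit (.reg r) (jump (f (Sum.inl 1)))) (jump (f (Sum.inl 2)))
    | Sum.inl 2 => popCase (.aux (g (Sum.inl true)))
        (jump (p.entry (fun l => f (Sum.inr l)) (f (Sum.inl 2)))) (jump e)
    | Sum.inr l => p.code (fun l => f (Sum.inr l)) (fun w => g (Sum.inr w)) (f (Sum.inl 2)) l
  | ifZero r p q, f, g, e, l =>
    match l with
    -- A stack is tested by popping, so a unit that was found is pushed back.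
    | Sum.inl _ => popCase (.reg r)
        (pushUnit (.reg r) (jump (q.entry (fun l => f (Sum.inr (Sum.inr l))) e)))
        (jump (p.entry (fun l => f (Sum.inr (Sum.inl l))) e))
    | Sum.inr (Sum.inl l) =>
      p.code (fun l => f (Sum.inr (Sum.inl l))) (fun w => g (Sum.inl w)) e l
    | Sum.inr (Sum.inr l) =>
      q.code (fun l => f (Sum.inr (Sum.inr l))) (fun w => g (Sum.inr w)) e l

/-- The stacks that represent a state, given the contents of the auxiliary stacks. -/
def stk (s : CounterState K) (H : Ω → ℕ) : Stack K Ω → List Bool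
  | .reg r => List.replicate (s.reg r) true
  | .aux w => List.replicate (H w) true
  | .inp => s.inp
  | .rev => s.out.reverse
  | .res => []

variable [DecidableEq Ω]

/-- `m` steps lead from one configuration to another. -/
def Steps (M : Λ → MStmt K Ω Λ) (m : ℕ) (c c' : Turing.TM2.Cfg (fun _ : Stack K Ω => Bool) Λ
    (Option Bool)) : Prop :=
  (flip bind (Turing.TM2.step M))^[m] (some c) = some c'

variable {M : Λ → MStmt K Ω Λ}

theorem Steps.refl (c) : Steps M 0 c c := rfl

theorem Steps.trans {m m' : ℕ} {c c' c''} (h : Steps M m c c') (h' : Steps M m' c' c'') :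
    Steps M (m + m') c c'' := by
  unfold Steps at *
  rw [Nat.add_comm, Function.iterate_add_apply, h, h']

theorem Steps.single {l : Λ} {v S c} (h : Turing.TM2.stepAux (M l) v S = c) :
    Steps M 1 ⟨some l, v, S⟩ c := by
  simp [Steps, flip, h]

theorem Steps.cast {m m' : ℕ} {c c' c''} (h : Steps M m c c') (hm : m = m') (hc : c' = c'') :
    Steps M m' c c'' := hm ▸ hc ▸ h

@[simp]
theorem stepAux_jump (a : Λ) (v) (S : Stack K Ω → List Bool) :
    Turing.TM2.stepAux (jump a) v S = ⟨some a, none, S⟩ := rfl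

@[simp]
theorem stepAux_popCase (k) (p q : MStmt K Ω Λ) (v) (S : Stack K Ω → List Bool) :
    Turing.TM2.stepAux (popCase k p q) v S =
      if (S k).head? = some true
      then Turing.TM2.stepAux p (S k).head? (Function.update S k (S k).tail)
      else Turing.TM2.stepAux q (S k).head? (Function.update S k (S k).tail) := by
  simp only [popCase, Turing.TM2.stepAux]
  split_ifs with h
  · simp [h]
  · rw [beq_eq_false_iff_ne.2 h]; rfl

@[simp]
theorem stepAux_pushUnit (k) (p : MStmt K Ω Λ) (v) (S : Stack K Ω → List Bool) :
    Turing.TM2.stepAux (pushUnit k p) v S =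
      Turing.TM2.stepAux p v (Function.update S k (true :: S k)) := rfl

/-- This and the next three lemmas keep the stack contents in the form `stk s H`, so that a machine
step again leads to a program state. -/
theorem update_stk_reg (s : CounterState K) (H : Ω → ℕ) (r : K) (a : ℕ) :
    Function.update (stk s H) (.reg r) (List.replicate a true) = stk (s.set r a) H := by
  funext k
  cases k with
  | reg r' =>
    by_cases h : r' = r
    · subst h; simp [stk, CounterState.set]
    · rw [Function.update_of_ne (by simpa using h)]
      simp [stk, CounterState.set, h]
  | _ => simp [stk, CounterState.set]

theorem update_stk_aux (s : CounterState K) (H : Ω → ℕ) (w : Ω) (a : ℕ) :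
    Function.update (stk s H) (.aux w) (List.replicate a true) =
      stk s (Function.update H w a) := by
  funext k
  cases k with
  | aux w' =>
    by_cases h : w' = w
    · subst h; simp [stk]
    · rw [Function.update_of_ne (by simpa using h)]
      simp [stk, h]
  | _ => simp [stk]

theorem update_stk_inp (s : CounterState K) (H : Ω → ℕ) (l : List Bool) :
    Function.update (stk s H) .inp l = stk { s with inp := l } H := by
  funext k
  cases k <;> simp [stk]

theorem update_stk_rev (s : CounterState K) (H : Ω → ℕ) (l : List Bool) :
    Function.update (stk s H) .rev l = stk { s with out := l.reverse } H := by
  funext k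
  cases k <;> simp [stk]

theorem stk_reg {K Ω : Type} (s : CounterState K) (H : Ω → ℕ) (r : K) :
    stk s H (.reg r) = List.replicate (s.reg r) true := rfl

theorem stk_aux {K Ω : Type} (s : CounterState K) (H : Ω → ℕ) (w : Ω) :
    stk s H (.aux w) = List.replicate (H w) true := rfl

theorem stk_inp {K Ω : Type} (s : CounterState K) (H : Ω → ℕ) : stk s H .inp = s.inp := rfl

theorem stk_rev {K Ω : Type} (s : CounterState K) (H : Ω → ℕ) : stk s H .rev = s.out.reverse := rfl




theorem steps_readNum {r : K} {l₀ e : Λ}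
    (h : M l₀ = popCase .inp (pushUnit (.reg r) (jump l₀)) (jump e)) (s : CounterState K)
    (H : Ω → ℕ) :
    Steps M ((splitUnary s.inp).1 + 1) ⟨some l₀, none, stk s H⟩
      ⟨some e, none, stk ((readNum r).eval s) H⟩ := by
  obtain ⟨c, i, o⟩ := s
  induction i generalizing c with
  | nil =>
    refine (Steps.single rfl).cast rfl ?_
    simp [h, stk_inp, update_stk_inp, eval, splitUnary, CounterState.set]
  | cons b i ih =>
    cases b with
    | false =>
      refine (Steps.single rfl).cast rfl ?_
      simp [h, stk_inp, update_stk_inp, eval, splitUnary, CounterState.set]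
    | true =>
      have h1 : Steps M 1 ⟨some l₀, none, stk ⟨c, true :: i, o⟩ H⟩
          ⟨some l₀, none, stk ⟨Function.update c r (c r + 1), i, o⟩ H⟩ := by
        refine (Steps.single rfl).cast rfl ?_
        simp [h, stk_inp, update_stk_inp, stk_reg, ← List.replicate_succ,
          update_stk_reg, CounterState.set]
      refine (h1.trans (ih _)).cast ?_ ?_
      · simp [splitUnary]; omega
      · congr 2
        simp [eval, splitUnary, CounterState.set, Nat.add_assoc, Nat.add_comm 1]

/-- First phase of a loop. Reading a counter destroys it, hence the two copies: one to restore the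
counter, one to count iterations. -/
theorem steps_move {r : K} {w w' : Ω} (hw : w ≠ w') {l₀ e : Λ}
    (h : M l₀ = popCase (.reg r) (pushUnit (.aux w) (pushUnit (.aux w') (jump l₀))) (jump e))
    (s : CounterState K) (H : Ω → ℕ) (a : ℕ) :
    Steps M (a + 1) ⟨some l₀, none, stk (s.set r a) H⟩
      ⟨some e, none, stk (s.set r 0)
        (Function.update (Function.update H w (H w + a)) w' (H w' + a))⟩ := by
  induction a generalizing H with
  | zero =>
    refine (Steps.single rfl).cast rfl ?_
    have := update_stk_reg (s.set r 0) H r 0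
    simp [h, stk_reg, CounterState.set] at this ⊢
  | succ a ih =>
    have h1 : Steps M 1 ⟨some l₀, none, stk (s.set r (a + 1)) H⟩
        ⟨some l₀, none, stk (s.set r a)
          (Function.update (Function.update H w (H w + 1)) w' (H w' + 1))⟩ := by
      refine (Steps.single rfl).cast rfl ?_
      simp [h, stk_reg, stk_aux, CounterState.set, List.replicate_succ, update_stk_reg]
      simp [← List.replicate_succ, update_stk_aux, stk_aux, hw.symm]
    refine (h1.trans (ih _)).cast (by omega) ?_
    congr 2
    funext v
    by_cases h1 : v = w' <;> by_cases h2 : v = w <;> simp_all <;> omega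

theorem steps_restore {r : K} {w : Ω} {l₀ e : Λ}
    (h : M l₀ = popCase (.aux w) (pushUnit (.reg r) (jump l₀)) (jump e))
    (s : CounterState K) (H : Ω → ℕ) (a : ℕ) :
    Steps M (a + 1) ⟨some l₀, none, stk s (Function.update H w a)⟩
      ⟨some e, none, stk (s.set r (s.reg r + a)) (Function.update H w 0)⟩ := by
  induction a generalizing s with
  | zero =>
    refine (Steps.single rfl).cast rfl ?_
    have := update_stk_aux s H w 0
    have h2 := update_stk_aux s (Function.update H w 0) w 0
    simp [h, stk_aux, CounterState.set] at this h2 ⊢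
  | succ a ih =>
    have h1 : Steps M 1 ⟨some l₀, none, stk s (Function.update H w (a + 1))⟩
        ⟨some l₀, none, stk (s.set r (s.reg r + 1)) (Function.update H w a)⟩ := by
      refine (Steps.single rfl).cast rfl ?_
      simp [h, stk_aux, List.replicate_succ, update_stk_aux, stk_reg]
      simp [← List.replicate_succ, update_stk_reg]
    refine (h1.trans (ih _)).cast (by omega) ?_
    congr 2
    simp [CounterState.set, Nat.add_assoc, Nat.add_comm 1]

/-- Third phase of a loop. The body `hb` has to work for every content `a` of the counting stack
`w`, and to leave it alone. -/
theorem steps_repeat {w : Ω} {l₀ b e : Λ} (h : M l₀ = popCase (.aux w) (jump b) (jump e))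
    (F : CounterState K → CounterState K) (T : CounterState K → ℕ) (H : Ω → ℕ)
    (hb : ∀ s a, Steps M (T s) ⟨some b, none, stk s (Function.update H w a)⟩
      ⟨some l₀, none, stk (F s) (Function.update H w a)⟩) (s : CounterState K) (a : ℕ) :
    Steps M (a + 1 + iterateCost F T a s) ⟨some l₀, none, stk s (Function.update H w a)⟩
      ⟨some e, none, stk (F^[a] s) (Function.update H w 0)⟩ := by
  induction a generalizing s with
  | zero =>
    refine (Steps.single rfl).cast rfl ?_
    have h2 := update_stk_aux s (Function.update H w 0) w 0
    simp [h, stk_aux] at h2 ⊢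
  | succ a ih =>
    have h1 : Steps M 1 ⟨some l₀, none, stk s (Function.update H w (a + 1))⟩
        ⟨some b, none, stk s (Function.update H w a)⟩ := by
      refine (Steps.single rfl).cast rfl ?_
      simp [h, stk_aux, List.replicate_succ, update_stk_aux]
    refine (h1.trans ((hb s a).trans (ih _))).cast ?_ (by simp)
    simp [iterateCost]; omega

/-- The compiled program does what the program does. -/
theorem steps_code (p : CounterProg K) (f : p.Label → Λ) (g : p.Aux → Ω) (e : Λ)
    (hg : Function.Injective g) (hM : ∀ l, M (f l) = p.code f g e l) (H : Ω → ℕ)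
    (hH : ∀ w, H (g w) = 0) (s : CounterState K) :
    Steps M (p.cost s) ⟨some (p.entry f e), none, stk s H⟩ ⟨some e, none, stk (p.eval s) H⟩ := by
  induction p generalizing e H s with
  | skip => exact Steps.refl _
  | inc r =>
    refine (Steps.single rfl).cast rfl ?_
    rw [entry, hM]
    simp [code, stk_reg, ← List.replicate_succ, update_stk_reg, eval]
  | dec r =>
    refine (Steps.single rfl).cast rfl ?_
    rw [entry, hM]
    simp [code, stk_reg, update_stk_reg, eval]
  | write b =>
    refine (Steps.single rfl).cast rfl ?_
    rw [entry, hM]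
    simp [code, stk_rev, update_stk_rev, eval]
  | readNum r => exact steps_readNum (hM ()) s H
  | readBit p q ihp ihq =>
    have h0 := hM (Sum.inl ())
    by_cases hs : s.inp.head? = some true
    · have h1 : Steps M 1 ⟨some (f (Sum.inl ())), none, stk s H⟩
          ⟨some (p.entry (fun l => f (Sum.inr (Sum.inl l))) e), none,
            stk { s with inp := s.inp.tail } H⟩ := by
        refine (Steps.single rfl).cast rfl ?_
        simp [h0, code, stk_inp, hs, update_stk_inp]
      have := ihp (fun l => f (Sum.inr (Sum.inl l))) (fun w => g (Sum.inl w)) e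
        (fun a b h => Sum.inl_injective (hg h)) (fun l => hM (Sum.inr (Sum.inl l))) H
        (fun w => hH _) { s with inp := s.inp.tail }
      exact (h1.trans this).cast (by simp [cost, hs]) (by simp [eval, hs])
    · have h1 : Steps M 1 ⟨some (f (Sum.inl ())), none, stk s H⟩
          ⟨some (q.entry (fun l => f (Sum.inr (Sum.inr l))) e), none,
            stk { s with inp := s.inp.tail } H⟩ := by
        refine (Steps.single rfl).cast rfl ?_
        simp [h0, code, stk_inp, hs, update_stk_inp]
      have := ihq (fun l => f (Sum.inr (Sum.inr l))) (fun w => g (Sum.inr w)) e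
        (fun a b h => Sum.inr_injective (hg h)) (fun l => hM (Sum.inr (Sum.inr l))) H
        (fun w => hH _) { s with inp := s.inp.tail }
      exact (h1.trans this).cast (by simp [cost, hs]) (by simp [eval, hs])
  | seq p q ihp ihq =>
    exact (ihp (fun l => f (Sum.inl l)) (fun w => g (Sum.inl w)) _
      (fun a b h => Sum.inl_injective (hg h)) (fun l => hM (Sum.inl l)) H (fun w => hH _) s).trans
      (ihq (fun l => f (Sum.inr l)) (fun w => g (Sum.inr w)) e
      (fun a b h => Sum.inr_injective (hg h)) (fun l => hM (Sum.inr l)) H (fun w => hH _) _)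
  | rep r p ih =>
    have hw : g (Sum.inl false) ≠ g (Sum.inl true) := fun h => by simpa using hg h
    have h1 := steps_move hw (hM (Sum.inl 0)) s H (s.reg r)
    have e1 : s.set r (s.reg r) = s := by simp [CounterState.set]
    rw [e1, Function.update_comm hw, hH, hH, zero_add] at h1
    have h2 := steps_restore (hM (Sum.inl 1)) (s.set r 0)
      (Function.update H (g (Sum.inl true)) (s.reg r)) (s.reg r)
    have e2 : (s.set r 0).set r ((s.set r 0).reg r + s.reg r) = s := by simp [CounterState.set]
    have e3 : Function.update (Function.update H (g (Sum.inl true)) (s.reg r))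
        (g (Sum.inl false)) 0 = Function.update H (g (Sum.inl true)) (s.reg r) := by
      rw [Function.update_eq_self_iff, Function.update_of_ne hw, hH]
    rw [e2, e3] at h2
    -- The body runs while the counting stack is nonempty. The induction hypothesis only asks for
    -- empty auxiliary stacks of the body itself, and these are different stacks because `g` is
    -- injective.
    have h3 := steps_repeat (hM (Sum.inl 2)) p.eval p.cost H (fun s a =>
      ih (fun l => f (Sum.inr l)) (fun w => g (Sum.inr w)) (f (Sum.inl 2))
        (fun a b h => Sum.inr_injective (hg h)) (fun l => hM (Sum.inr l))
        (Function.update H (g (Sum.inl true)) a)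
        (fun w => by
          rw [Function.update_of_ne (fun h => by simpa using hg h), hH]) s) s (s.reg r)
    have e4 : Function.update H (g (Sum.inl true)) 0 = H := by
      rw [Function.update_eq_self_iff, hH]
    rw [e4] at h3
    exact (h1.trans (h2.trans h3)).cast (by simp [cost]; omega) rfl
  | ifZero r p q ihp ihq =>
    have h0 := hM (Sum.inl ())
    by_cases hs : s.reg r = 0
    · have h1 : Steps M 1 ⟨some (f (Sum.inl ())), none, stk s H⟩
          ⟨some (p.entry (fun l => f (Sum.inr (Sum.inl l))) e), none, stk s H⟩ := by
        refine (Steps.single rfl).cast rfl ?_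
        have := update_stk_reg s H r 0
        have e1 : s.set r 0 = s := by simp [CounterState.set, ← hs]
        simp [e1] at this
        simp [h0, code, this]
      have := ihp (fun l => f (Sum.inr (Sum.inl l))) (fun w => g (Sum.inl w)) e
        (fun a b h => Sum.inl_injective (hg h)) (fun l => hM (Sum.inr (Sum.inl l))) H
        (fun w => hH _) s
      exact (h1.trans this).cast (by simp [cost, hs]) (by simp [eval, hs])
    · have h1 : Steps M 1 ⟨some (f (Sum.inl ())), none, stk s H⟩
          ⟨some (q.entry (fun l => f (Sum.inr (Sum.inr l))) e), none, stk s H⟩ := by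
        refine (Steps.single rfl).cast rfl ?_
        have hh : stk s H (.reg r) = true :: (stk s H (.reg r)).tail := by
          obtain ⟨a, ha⟩ := Nat.exists_eq_succ_of_ne_zero hs
          simp [stk_reg, ha, List.replicate_succ]
        simp only [h0, code, stepAux_popCase, stepAux_pushUnit, stepAux_jump]
        rw [if_pos (by rw [hh]; rfl), Function.update_self, Function.update_idem, ← hh,
          Function.update_eq_self]
      have := ihq (fun l => f (Sum.inr (Sum.inr l))) (fun w => g (Sum.inr w)) e
        (fun a b h => Sum.inr_injective (hg h)) (fun l => hM (Sum.inr (Sum.inr l))) H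
        (fun w => hH _) s
      exact (h1.trans this).cast (by simp [cost, hs]) (by simp [eval, hs])

end Compile

/-- The code of the whole machine: the program, then the reversal of the output. -/
def machineCode (p : CounterProg K) : p.Label ⊕ Unit → MStmt K p.Aux (p.Label ⊕ Unit)
  | Sum.inl l => p.code Sum.inl id (Sum.inr ()) l
  | Sum.inr _ => .pop .rev (fun _ o => o) (.branch Option.isSome
      (.push .res (fun o => o.getD false) (jump (Sum.inr ()))) (.load (fun _ => none) .halt))

/-- The last bit written is on top of `rev`; moving the bits one by one to `res` brings the first
bit to the top. -/
theorem steps_reverse (p : CounterProg K) (l l' : List Bool) :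
    Steps p.machineCode (l.length + 1)
      ⟨some (Sum.inr ()), none, fun k => if k = .rev then l else if k = .res then l' else []⟩
      ⟨none, none, fun k => if k = .res then l.reverse ++ l' else []⟩ := by
  induction l generalizing l' with
  | nil =>
    refine (Steps.single rfl).cast rfl ?_
    simp only [machineCode, Turing.TM2.stepAux, if_true, List.head?_nil, Option.isSome_none,
      cond_false]
    congr 1
    funext k
    by_cases h : k = .rev
    · subst h; simp
    · simp [h]
  | cons b l ih =>
    have h1 : Steps p.machineCode 1
        ⟨some (Sum.inr ()), none,
          fun k => if k = .rev then b :: l else if k = .res then l' else []⟩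
        ⟨some (Sum.inr ()), none,
          fun k => if k = .rev then l else if k = .res then b :: l' else []⟩ := by
      refine (Steps.single rfl).cast rfl ?_
      simp only [machineCode, Turing.TM2.stepAux, if_true, List.head?_cons, Option.isSome_some,
        cond_true, stepAux_jump]
      congr 1
      funext k
      by_cases h : k = .rev
      · subst h; simp
      · by_cases h' : k = .res
        · subst h'; simp
        · simp [h, h']
    refine (h1.trans (ih _)).cast (by simp; omega) (by simp)

variable [Fintype K]

/-- The machine that runs a counter program. -/
def machine (p : CounterProg K) : Turing.FinTM2 where
  K := Stack K p.Aux
  k₀ := .inp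
  k₁ := .res
  Γ := fun _ => Bool
  Λ := p.Label ⊕ Unit
  main := p.entry Sum.inl (Sum.inr ())
  σ := Option Bool
  initialState := none
  m := p.machineCode

/-- A function that is computed by a counter program in polynomial time is computable in polynomial
time. -/
theorem nonempty_computableInPolyTime {α β : Type} {ea : α → List Bool} {eb : β → List Bool}
    {F : α → β} (p : CounterProg K)
    (hp : ∀ a, p.eval ⟨fun _ => 0, ea a, []⟩ = ⟨fun _ => 0, [], eb (F a)⟩)
    (P Q : Polynomial ℕ) (hP : ∀ a, p.cost ⟨fun _ => 0, ea a, []⟩ ≤ P.eval (ea a).length)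
    (hQ : ∀ a, (eb (F a)).length ≤ Q.eval (ea a).length) :
    Nonempty (Turing.TM2ComputableInPolyTime ea eb F) := by
  -- `P` bounds the program, `Q` the steps that reverse the output, and the last summand is the step
  -- that halts.
  refine ⟨⟨⟨p.machine, Equiv.refl _, Equiv.refl _⟩, P + Q + 1, fun a => ?_⟩⟩
  have h1 := steps_code (M := p.machineCode) p Sum.inl id (Sum.inr ()) Function.injective_id
    (fun l => rfl) (fun _ => 0) (fun _ => rfl) ⟨fun _ => 0, ea a, []⟩
  rw [hp] at h1
  have h2 := steps_reverse p (eb (F a)).reverse []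
  have e1 : (stk ⟨fun _ => 0, [], eb (F a)⟩ (fun _ => 0) : Stack K p.Aux → List Bool) =
      fun k => if k = .rev then (eb (F a)).reverse else if k = .res then [] else [] := by
    funext k; cases k <;> simp [stk]
  rw [e1] at h1
  have h3 := h1.trans h2
  refine ⟨⟨_, Eq.trans (congrArg _ (congrArg some ?_)) (Eq.trans h3 (congrArg some ?_))⟩, ?_⟩
  · simp only [Turing.initList]
    refine congrArg (Turing.TM2.Cfg.mk _ _) (funext fun k => ?_)
    cases k <;> simp [stk, machine] <;> rfl
  · simp only [Turing.haltList]
    refine congrArg (Turing.TM2.Cfg.mk _ _) (funext fun k => ?_)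
    cases k <;> simp [machine] <;> rfl
  · have := hP a
    have := hQ a
    simp
    omega

end CounterProg

/-! ### Strip networks

A strip network consists of `k` rows that run through the columns `0, …, C`. Inside a column every
row passes through one of `L` parallel middle vertices, and in the columns before the last one the
middle vertices of all rows are joined to one vertical path. -/

/-- The capacities in a column of a strip network: `vcap` on the vertical path, and `cin i l` and
`cout i l` on the arcs into and out of the middle vertex with label `l` in row `i`. The arc between
the source and the vertical path leads towards the source if `restore` holds. -/
structure StripColumn where
  vcap : ℕ
  restore : Bool
  cin : ℕ → ℕ → ℕ
  cout : ℕ → ℕ → ℕ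

/-- Vertices of a strip network. -/
inductive StripVertex (C k L : ℕ)
  | source
  | sink
  | gate (c : Fin (C + 1)) (i : Fin k)
  | mid (c : Fin (C + 1)) (p : Fin (k * L + 1))
  deriving DecidableEq, Fintype

/-- Arcs of a strip network. -/
inductive StripArc (C k L : ℕ)
  | start (i : Fin k)
  | top (c : Fin C)
  | bot (c : Fin C)
  | vert (c : Fin C) (p : Fin (k * L))
  | enter (c : Fin (C + 1)) (p : Fin (k * L))
  | leave (c : Fin (C + 1)) (p : Fin (k * L))
  deriving DecidableEq, Fintype

namespace StripArc

variable {C k L : ℕ}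

/-- The arcs as a sum of products. -/
def equivSum : StripArc C k L ≃ Fin k ⊕ Fin C ⊕ Fin C ⊕ (Fin C × Fin (k * L)) ⊕
    (Fin (C + 1) × Fin (k * L)) ⊕ (Fin (C + 1) × Fin (k * L)) where
  toFun
    | start i => .inl i
    | top c => .inr (.inl c)
    | bot c => .inr (.inr (.inl c))
    | vert c p => .inr (.inr (.inr (.inl (c, p))))
    | enter c p => .inr (.inr (.inr (.inr (.inl (c, p)))))
    | leave c p => .inr (.inr (.inr (.inr (.inr (c, p)))))
  invFun
    | .inl i => start i
    | .inr (.inl c) => top c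
    | .inr (.inr (.inl c)) => bot c
    | .inr (.inr (.inr (.inl (c, p)))) => vert c p
    | .inr (.inr (.inr (.inr (.inl (c, p))))) => enter c p
    | .inr (.inr (.inr (.inr (.inr (c, p))))) => leave c p
  left_inv e := by cases e <;> rfl
  right_inv e := by
    rcases e with i | c | c | ⟨c, p⟩ | ⟨c, p⟩ | ⟨c, p⟩ <;> rfl

theorem sum_eq {M : Type*} [AddCommMonoid M] (g : StripArc C k L → M) :
    ∑ e, g e = ∑ i, g (start i) + (∑ c, g (top c) + (∑ c, g (bot c) +
      (∑ c, ∑ p, g (vert c p) + (∑ c, ∑ p, g (enter c p) + ∑ c, ∑ p, g (leave c p))))) := by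
  rw [← equivSum.symm.sum_comp]
  simp only [Fintype.sum_sum_type, Fintype.sum_prod_type]
  rfl

end StripArc

namespace StripVertex

variable {C k L : ℕ}

/-- The vertices as a sum of products. -/
def equivSum : StripVertex C k L ≃
    Fin 2 ⊕ (Fin (C + 1) × (Fin k ⊕ Fin (k * L + 1))) where
  toFun
    | source => .inl 0
    | sink => .inl 1
    | gate c i => .inr (c, .inl i)
    | mid c p => .inr (c, .inr p)
  invFun
    | .inl 0 => source
    | .inl 1 => sink
    | .inr (c, .inl i) => gate c i
    | .inr (c, .inr p) => mid c p
  left_inv v := by cases v <;> rfl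
  right_inv v := by
    rcases v with b | ⟨c, i | p⟩
    · fin_cases b <;> rfl
    · rfl
    · rfl

/-- The position of a vertex in the output. -/
def equivFin : StripVertex C k L ≃ Fin (2 + (C + 1) * (k + (k * L + 1))) :=
  equivSum.trans <| (Equiv.sumCongr (Equiv.refl _) <|
    (Equiv.prodCongr (Equiv.refl _) finSumFinEquiv).trans finProdFinEquiv).trans finSumFinEquiv

@[simp] theorem equivFin_source : ((equivFin (source : StripVertex C k L) : Fin _) : ℕ) = 0 := rfl

@[simp] theorem equivFin_sink : ((equivFin (sink : StripVertex C k L) : Fin _) : ℕ) = 1 := rfl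

theorem equivFin_gate (c : Fin (C + 1)) (i : Fin k) :
    ((equivFin (gate c i : StripVertex C k L) : Fin _) : ℕ) =
      2 + c * (k + (k * L + 1)) + i := by
  simp [equivFin, equivSum, finSumFinEquiv, finProdFinEquiv]
  ring

theorem equivFin_mid (c : Fin (C + 1)) (p : Fin (k * L + 1)) :
    ((equivFin (mid c p : StripVertex C k L) : Fin _) : ℕ) =
      2 + c * (k + (k * L + 1)) + k + p := by
  simp [equivFin, equivSum, finSumFinEquiv, finProdFinEquiv]
  ring

end StripVertex

/-- The data of a strip network: the columns and the inflow `base` of the rows. All capacities of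
arcs along the rows are between `base` and `2 * base`, all vertical capacities are less than
`base`. -/
structure StripData where
  C : ℕ
  k : ℕ
  L : ℕ
  base : ℕ
  col : ℕ → StripColumn
  k_pos : 0 < k
  L_pos : 0 < L
  vcap_pos : ∀ c, 0 < (col c).vcap
  vcap_lt : ∀ c, (col c).vcap < base
  le_cin : ∀ c i l, base ≤ (col c).cin i l
  le_cout : ∀ c i l, base ≤ (col c).cout i l
  cin_lt : ∀ c i l, l < L → (col c).cin i l < 2 * base
  cout_lt : ∀ c i l, l < L → (col c).cout i l < 2 * base

namespace StripData

open StripArc StripVertex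

variable (S : StripData)

theorem base_pos : 0 < S.base := (S.vcap_pos 0).trans (S.vcap_lt 0)

/-- The capacity of the arc into the middle vertex at a position. -/
abbrev capIn (c : ℕ) (p : Fin (S.k * S.L)) : ℕ := (S.col c).cin p.divNat p.modNat

/-- The capacity of the arc out of the middle vertex at a position. -/
abbrev capOut (c : ℕ) (p : Fin (S.k * S.L)) : ℕ := (S.col c).cout p.divNat p.modNat

/-- The tail of an arc. -/
def src : StripArc S.C S.k S.L → StripVertex S.C S.k S.L
  | start _ => source
  | top c => if (S.col c).restore then mid c.castSucc 0 else source
  | bot c => mid c.castSucc (Fin.last _)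
  | vert c p => mid c.castSucc p.castSucc
  | enter c p => gate c p.divNat
  | leave c p => mid c p.castSucc

/-- The head of an arc. -/
def tgt : StripArc S.C S.k S.L → StripVertex S.C S.k S.L
  | start i => gate 0 i
  | top c => if (S.col c).restore then source else mid c.castSucc 0
  | bot _ => sink
  | vert c p => mid c.castSucc p.succ
  | enter c p => mid c p.castSucc
  | leave c p => if h : c.val < S.C then gate ⟨c + 1, by omega⟩ p.divNat else sink

/-- The capacity of an arc. -/
def cap : StripArc S.C S.k S.L → ℕ
  | start _ => S.base
  | top c => (S.col c).vcap
  | bot c => (S.col c).vcap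
  | vert c _ => (S.col c).vcap
  | enter c p => S.capIn c p
  | leave c p => S.capOut c p

/-- The strip network. -/
def network : FlowNetwork (StripVertex S.C S.k S.L) (StripArc S.C S.k S.L) where
  src := S.src
  tgt := S.tgt
  cap := S.cap
  s := source
  t := sink
  src_ne_tgt e := by
    cases e with
    | top c => simp only [src, tgt]; split_ifs <;> simp
    | leave c p => simp only [src, tgt]; split_ifs <;> simp
    | vert c p => simp [src, tgt, Fin.ext_iff]
    | _ => simp [src, tgt]
  cap_pos e := by
    have := S.base_pos
    cases e with
    | start => exact this
    | enter c p => exact this.trans_le (S.le_cin _ _ _)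
    | leave c p => exact this.trans_le (S.le_cout _ _ _)
    | _ => exact S.vcap_pos _
  s_ne_t := by simp

/-- The total capacity of the arcs out of the source. -/
def target : ℕ := S.k * S.base + ∑ c ∈ Finset.range S.C,
  if (S.col c).restore then 0 else (S.col c).vcap

end StripData

/-! ### Flow conservation at the vertices of a strip network -/

namespace StripData

open StripArc StripVertex

variable (S : StripData)

theorem outflow_eq (f : StripArc S.C S.k S.L → ℕ) (v) :
    S.network.outflow f v = ∑ e, if S.src e = v then f e else 0 := by
  rw [FlowNetwork.outflow, Finset.sum_filter]; rfl

theorem inflow_eq (f : StripArc S.C S.k S.L → ℕ) (v) :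
    S.network.inflow f v = ∑ e, if S.tgt e = v then f e else 0 := by
  rw [FlowNetwork.inflow, Finset.sum_filter]; rfl

theorem kL_pos : 0 < S.k * S.L := Nat.mul_pos S.k_pos S.L_pos

/-- The amount of flow on the arc of the vertical path that leads to position `j`. -/
def vflow (f : StripArc S.C S.k S.L → ℕ) (c : Fin S.C) : ℕ → ℕ
  -- In a restoring column `top` leads away from the path, so nothing arrives at position `0`; its
  -- flow appears as a separate term in `outflow_mid`.
  | 0 => if (S.col c).restore then 0 else f (top c)
  | j + 1 => if h : j < S.k * S.L then f (vert c ⟨j, h⟩) else 0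

theorem src_top_eq_source (c : Fin S.C) : S.src (top c) = source ↔ (S.col c).restore = false := by
  simp only [src]; split_ifs <;> simp_all

theorem src_top_eq_gate (c : Fin S.C) (c' i) : S.src (top c) = gate c' i ↔ False := by
  simp only [src]; split_ifs <;> simp

theorem src_top_eq_mid (c : Fin S.C) (c' p) :
    S.src (top c) = mid c' p ↔ (S.col c).restore = true ∧ c.castSucc = c' ∧ p = 0 := by
  simp only [src]
  split_ifs with h <;> simp [h, eq_comm (a := (0 : Fin (S.k * S.L + 1)))]

theorem tgt_top_eq_source (c : Fin S.C) : S.tgt (top c) = source ↔ (S.col c).restore = true := by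
  simp only [tgt]; split_ifs <;> simp_all

theorem tgt_top_eq_gate (c : Fin S.C) (c' i) : S.tgt (top c) = gate c' i ↔ False := by
  simp only [tgt]; split_ifs <;> simp

theorem tgt_top_eq_mid (c : Fin S.C) (c' p) :
    S.tgt (top c) = mid c' p ↔ (S.col c).restore = false ∧ c.castSucc = c' ∧ p = 0 := by
  simp only [tgt]
  split_ifs with h <;> simp [h, eq_comm (a := (0 : Fin (S.k * S.L + 1)))]

theorem tgt_leave_eq_source (c : Fin (S.C + 1)) (p) :
    S.tgt (leave c p) = source ↔ False := by
  simp only [tgt]; split_ifs <;> simp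

theorem tgt_leave_eq_mid (c : Fin (S.C + 1)) (p) (c' p') :
    S.tgt (leave c p) = mid c' p' ↔ False := by
  simp only [tgt]; split_ifs <;> simp

theorem tgt_leave_eq_gate (c : Fin (S.C + 1)) (p) (c' i) :
    S.tgt (leave c p) = gate c' i ↔ (c : ℕ) + 1 = c' ∧ p.divNat = i := by
  have := c'.isLt
  simp only [tgt]
  split_ifs <;> simp [Fin.ext_iff]
  omega

theorem src_start (i : Fin S.k) (v) : S.src (start i) = v ↔ source = v := Iff.rfl

theorem src_bot (c : Fin S.C) (v) : S.src (bot c) = v ↔ mid c.castSucc (Fin.last _) = v := Iff.rfl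

theorem src_vert (c : Fin S.C) (p v) : S.src (vert c p) = v ↔ mid c.castSucc p.castSucc = v :=
  Iff.rfl

theorem src_enter (c : Fin (S.C + 1)) (p v) : S.src (enter c p) = v ↔ gate c p.divNat = v :=
  Iff.rfl

theorem src_leave (c : Fin (S.C + 1)) (p v) : S.src (leave c p) = v ↔ mid c p.castSucc = v :=
  Iff.rfl

theorem tgt_start (i : Fin S.k) (v) : S.tgt (start i) = v ↔ gate 0 i = v := Iff.rfl

theorem tgt_bot (c : Fin S.C) (v) : S.tgt (bot c) = v ↔ sink = v := Iff.rfl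

theorem tgt_vert (c : Fin S.C) (p v) : S.tgt (vert c p) = v ↔ mid c.castSucc p.succ = v :=
  Iff.rfl

theorem tgt_enter (c : Fin (S.C + 1)) (p v) : S.tgt (enter c p) = v ↔ mid c p.castSucc = v :=
  Iff.rfl

/-- This and the next three lemmas evaluate the sum over one kind of arcs when exactly one of them,
or none, is incident with the given vertex. -/
theorem sum_ite_of_unique {α M : Type*} [Fintype α] [AddCommMonoid M] (P : α → Prop)
    [DecidablePred P] (g : α → M) (a : α) (ha : ∀ b, P b ↔ b = a) :
    (∑ b, if P b then g b else 0) = g a := by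
  rw [Finset.sum_eq_single a]
  · rw [if_pos ((ha a).2 rfl)]
  · intro b _ hb; rw [if_neg (fun h => hb ((ha b).1 h))]
  · simp

theorem sum_sum_ite_of_unique {α β M : Type*} [Fintype α] [Fintype β] [AddCommMonoid M]
    (P : α → β → Prop) [∀ a b, Decidable (P a b)] (g : α → β → M) (a : α) (b : β)
    (h : ∀ a' b', P a' b' ↔ a' = a ∧ b' = b) :
    (∑ a', ∑ b', if P a' b' then g a' b' else 0) = g a b := by
  rw [Finset.sum_eq_single a]
  · exact sum_ite_of_unique _ _ _ fun b' => by simp [h]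
  · intro a' _ ha; exact Finset.sum_eq_zero fun b' _ => by rw [if_neg]; simp [h, ha]
  · simp

theorem sum_ite_of_not {α M : Type*} [Fintype α] [AddCommMonoid M] (P : α → Prop)
    [DecidablePred P] (g : α → M) (h : ∀ b, ¬ P b) : (∑ b, if P b then g b else 0) = 0 :=
  Finset.sum_eq_zero fun b _ => if_neg (h b)

theorem sum_sum_ite_of_not {α β M : Type*} [Fintype α] [Fintype β] [AddCommMonoid M]
    (P : α → β → Prop) [∀ a b, Decidable (P a b)] (g : α → β → M) (h : ∀ a b, ¬ P a b) :
    (∑ a', ∑ b', if P a' b' then g a' b' else 0) = 0 :=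
  Finset.sum_eq_zero fun _ _ => sum_ite_of_not _ _ (h _)

variable {S} (f : StripArc S.C S.k S.L → ℕ)

theorem outflow_source : S.network.outflow f source =
    ∑ i, f (start i) + ∑ c : Fin S.C, if (S.col c).restore then 0 else f (top c) := by
  rw [outflow_eq, StripArc.sum_eq]
  simp only [src_start, src_bot, src_vert, src_enter, src_leave, src_top_eq_source, reduceCtorEq,
    if_true, if_false, Finset.sum_const_zero, add_zero]
  congr 1
  refine Finset.sum_congr rfl fun c _ => ?_
  cases (S.col c).restore <;> simp

theorem inflow_source : S.network.inflow f source =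
    ∑ c : Fin S.C, if (S.col c).restore then f (top c) else 0 := by
  rw [inflow_eq, StripArc.sum_eq]
  simp only [tgt_start, tgt_bot, tgt_vert, tgt_enter, tgt_leave_eq_source, tgt_top_eq_source,
    reduceCtorEq, if_false, Finset.sum_const_zero, add_zero, zero_add]

theorem outflow_gate (c : Fin (S.C + 1)) (i : Fin S.k) : S.network.outflow f (gate c i) =
    ∑ p : Fin (S.k * S.L), if p.divNat = i then f (enter c p) else 0 := by
  rw [outflow_eq, StripArc.sum_eq]
  simp only [src_start, src_bot, src_vert, src_enter, src_leave, src_top_eq_gate, reduceCtorEq,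
    if_false, Finset.sum_const_zero, add_zero, zero_add, gate.injEq]
  rw [Finset.sum_eq_single c]
  · simp
  · intro b _ hb; simp [hb]
  · simp

theorem inflow_gate_zero (i : Fin S.k) : S.network.inflow f (gate 0 i) = f (start i) := by
  rw [inflow_eq, StripArc.sum_eq]
  simp only [tgt_start, tgt_bot, tgt_vert, tgt_enter, tgt_leave_eq_gate, tgt_top_eq_gate,
    reduceCtorEq, if_false, Finset.sum_const_zero, add_zero, gate.injEq, true_and,
    Fin.val_zero, Nat.succ_ne_zero, false_and]
  exact sum_ite_of_unique _ _ _ fun b => Iff.rfl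

theorem inflow_gate_succ (c : Fin S.C) (i : Fin S.k) : S.network.inflow f (gate c.succ i) =
    ∑ p : Fin (S.k * S.L), if p.divNat = i then f (leave c.castSucc p) else 0 := by
  rw [inflow_eq, StripArc.sum_eq]
  have h0 : (0 : Fin (S.C + 1)) ≠ c.succ := (Fin.succ_ne_zero c).symm
  simp only [tgt_start, tgt_bot, tgt_vert, tgt_enter, tgt_leave_eq_gate, tgt_top_eq_gate,
    reduceCtorEq, if_false, Finset.sum_const_zero, zero_add, gate.injEq, h0,
    false_and]
  rw [Finset.sum_eq_single c.castSucc]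
  · simp
  · intro b _ hb
    refine sum_ite_of_not _ _ fun p h => hb ?_
    simpa [Fin.ext_iff] using h.1
  · simp

theorem inflow_mid (c : Fin S.C) (p : Fin (S.k * S.L)) :
    S.network.inflow f (mid c.castSucc p.castSucc) =
      f (enter c.castSucc p) + S.vflow f c p := by
  rw [inflow_eq, StripArc.sum_eq]
  simp only [tgt_start, tgt_bot, tgt_vert, tgt_enter, tgt_leave_eq_mid, tgt_top_eq_mid,
    reduceCtorEq, if_false, Finset.sum_const_zero, add_zero, zero_add, mid.injEq,
    Fin.castSucc_inj]
  rw [sum_sum_ite_of_unique _ _ c.castSucc p fun _ _ => Iff.rfl]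
  by_cases h : p.val = 0
  · rw [sum_sum_ite_of_not _ _ (by simp [Fin.ext_iff, h]), zero_add, add_comm, h, vflow]
    congr 1
    by_cases hr : (S.col c).restore
    · rw [if_pos hr]
      refine sum_ite_of_not _ _ fun b hb => ?_
      obtain ⟨h1, rfl, h2⟩ := hb
      simp_all
    · rw [if_neg hr]
      refine sum_ite_of_unique _ _ c fun b => ⟨fun hb => hb.2.1, ?_⟩
      rintro rfl
      simpa [Fin.ext_iff, h] using hr
  · obtain ⟨q, hq⟩ := Nat.exists_eq_succ_of_ne_zero h
    have hq' : q < S.k * S.L := by omega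
    rw [sum_ite_of_not _ _ (by simp [Fin.ext_iff, h]), zero_add, add_comm, hq, vflow, dif_pos hq',
      sum_sum_ite_of_unique _ _ c ⟨q, hq'⟩]
    intro a b
    simp [Fin.ext_iff, hq]

theorem outflow_mid (c : Fin S.C) (p : Fin (S.k * S.L)) :
    S.network.outflow f (mid c.castSucc p.castSucc) =
      f (leave c.castSucc p) + S.vflow f c (p + 1) +
        if p.val = 0 ∧ (S.col c).restore then f (top c) else 0 := by
  rw [outflow_eq, StripArc.sum_eq]
  have h0 : ∀ c' : Fin S.C, ¬ (c' = c ∧ Fin.last (S.k * S.L) = p.castSucc) :=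
    fun _ h => (Fin.castSucc_ne_last p) h.2.symm
  simp only [src_start, src_bot, src_vert, src_enter, src_leave, src_top_eq_mid, reduceCtorEq,
    if_false, Finset.sum_const_zero, zero_add, mid.injEq, Fin.castSucc_inj, h0]
  rw [sum_sum_ite_of_unique _ _ c.castSucc p fun _ _ => Iff.rfl,
    sum_sum_ite_of_unique _ _ c p fun _ _ => Iff.rfl, vflow, dif_pos p.isLt, add_comm,
    add_comm (f (vert c p))]
  congr 1
  by_cases h : p.val = 0 ∧ (S.col c).restore
  · rw [if_pos h]
    refine sum_ite_of_unique _ _ c fun b => ⟨fun hb => hb.2.1, ?_⟩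
    rintro rfl
    simpa [Fin.ext_iff, h.1] using h.2
  · rw [if_neg h]
    refine sum_ite_of_not _ _ fun b hb => h ?_
    obtain ⟨h1, rfl, h2⟩ := hb
    simpa [Fin.ext_iff, h1] using h2

theorem inflow_mid_last (c : Fin S.C) :
    S.network.inflow f (mid c.castSucc (Fin.last _)) = S.vflow f c (S.k * S.L) := by
  rw [inflow_eq, StripArc.sum_eq]
  have h0 := S.kL_pos
  obtain ⟨q, hq⟩ := Nat.exists_eq_succ_of_ne_zero h0.ne'
  have hq' : q < S.k * S.L := by omega
  have e : S.vflow f c (S.k * S.L) = f (vert c ⟨q, hq'⟩) := by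
    have : S.vflow f c (q + 1) = f (vert c ⟨q, hq'⟩) := by rw [vflow, dif_pos hq']
    rw [← this, ← Nat.succ_eq_add_one, ← hq]
  simp only [tgt_start, tgt_bot, tgt_vert, tgt_enter, tgt_leave_eq_mid, tgt_top_eq_mid,
    reduceCtorEq, if_false, Finset.sum_const_zero, add_zero, zero_add, mid.injEq,
    Fin.castSucc_inj]
  rw [e, sum_ite_of_not, sum_sum_ite_of_unique _ _ c ⟨q, hq'⟩, sum_sum_ite_of_not, zero_add,
    add_zero]
  · intro a b h; exact (Fin.castSucc_ne_last b) h.2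
  · intro a b
    simp only [Fin.ext_iff, Fin.val_succ, Fin.val_last]
    omega
  · intro b h
    have := h.2.2
    simp only [Fin.ext_iff, Fin.val_last, Fin.val_zero] at this
    omega

theorem outflow_mid_last (c : Fin S.C) :
    S.network.outflow f (mid c.castSucc (Fin.last _)) = f (bot c) := by
  rw [outflow_eq, StripArc.sum_eq]
  have h0 := S.kL_pos
  simp only [src_start, src_bot, src_vert, src_enter, src_leave, src_top_eq_mid, reduceCtorEq,
    if_false, Finset.sum_const_zero, zero_add, mid.injEq, Fin.castSucc_inj]
  rw [sum_ite_of_not, sum_sum_ite_of_not, sum_sum_ite_of_not, zero_add, add_zero, add_zero]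
  · exact sum_ite_of_unique _ _ c fun b => by simp
  · intro a b h; exact (Fin.castSucc_ne_last b) h.2
  · intro a b h; exact (Fin.castSucc_ne_last b) h.2
  · intro b h
    have := h.2.2
    simp only [Fin.ext_iff, Fin.val_last, Fin.val_zero] at this
    omega

theorem inflow_final (p : Fin (S.k * S.L)) :
    S.network.inflow f (mid (Fin.last _) p.castSucc) = f (enter (Fin.last _) p) := by
  rw [inflow_eq, StripArc.sum_eq]
  have h0 : ∀ c : Fin S.C, c.castSucc ≠ Fin.last S.C := Fin.castSucc_ne_last
  simp only [tgt_start, tgt_bot, tgt_vert, tgt_enter, tgt_leave_eq_mid, tgt_top_eq_mid,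
    reduceCtorEq, if_false, Finset.sum_const_zero, add_zero, zero_add, mid.injEq, h0, false_and,
    and_false, Fin.castSucc_inj]
  exact sum_sum_ite_of_unique _ _ _ _ fun _ _ => Iff.rfl

theorem outflow_final (p : Fin (S.k * S.L)) :
    S.network.outflow f (mid (Fin.last _) p.castSucc) = f (leave (Fin.last _) p) := by
  rw [outflow_eq, StripArc.sum_eq]
  have h0 : ∀ c : Fin S.C, c.castSucc ≠ Fin.last S.C := Fin.castSucc_ne_last
  simp only [src_start, src_bot, src_vert, src_enter, src_leave, src_top_eq_mid, reduceCtorEq,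
    if_false, Finset.sum_const_zero, zero_add, mid.injEq, h0, false_and,
    and_false, Fin.castSucc_inj]
  exact sum_sum_ite_of_unique _ _ _ _ fun _ _ => Iff.rfl

/-- Without a vertical path in the last column, its bottom middle vertex is isolated. -/
theorem inflow_final_last : S.network.inflow f (mid (Fin.last _) (Fin.last _)) = 0 := by
  rw [inflow_eq, StripArc.sum_eq]
  have h0 : ∀ c : Fin S.C, c.castSucc ≠ Fin.last S.C := Fin.castSucc_ne_last
  have h1 : ∀ p : Fin (S.k * S.L), p.castSucc ≠ Fin.last _ := Fin.castSucc_ne_last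
  simp only [tgt_start, tgt_bot, tgt_vert, tgt_enter, tgt_leave_eq_mid, tgt_top_eq_mid,
    reduceCtorEq, if_false, Finset.sum_const_zero, add_zero, mid.injEq, h0, h1, false_and,
    and_false]

theorem outflow_final_last : S.network.outflow f (mid (Fin.last _) (Fin.last _)) = 0 := by
  rw [outflow_eq, StripArc.sum_eq]
  have h0 : ∀ c : Fin S.C, c.castSucc ≠ Fin.last S.C := Fin.castSucc_ne_last
  have h1 : ∀ p : Fin (S.k * S.L), p.castSucc ≠ Fin.last _ := Fin.castSucc_ne_last
  simp only [src_start, src_bot, src_vert, src_enter, src_leave, src_top_eq_mid, reduceCtorEq,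
    if_false, Finset.sum_const_zero, add_zero, mid.injEq, h0, h1, false_and, and_false]

/-- Conservation in terms of single arcs. -/
theorem isFlow_iff : S.network.IsFlow f ↔ (∀ e, f e ≤ S.cap e) ∧
    (∀ i, f (start i) = ∑ p : Fin (S.k * S.L), if p.divNat = i then f (enter 0 p) else 0) ∧
    (∀ c : Fin S.C, ∀ i, (∑ p : Fin (S.k * S.L),
      if p.divNat = i then f (leave c.castSucc p) else 0) =
      ∑ p : Fin (S.k * S.L), if p.divNat = i then f (enter c.succ p) else 0) ∧
    (∀ c : Fin S.C, ∀ p : Fin (S.k * S.L), f (enter c.castSucc p) + S.vflow f c p =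
      f (leave c.castSucc p) + S.vflow f c (p + 1) +
        if p.val = 0 ∧ (S.col c).restore then f (top c) else 0) ∧
    (∀ c : Fin S.C, S.vflow f c (S.k * S.L) = f (bot c)) ∧
    (∀ p : Fin (S.k * S.L), f (enter (Fin.last _) p) = f (leave (Fin.last _) p)) := by
  constructor
  · intro h
    refine ⟨h.le_cap, fun i => ?_, fun c i => ?_, fun c p => ?_, fun c => ?_, fun p => ?_⟩
    · rw [← inflow_gate_zero f, ← outflow_gate f]
      exact h.conservation _ (by simp [network]) (by simp [network])
    · rw [← inflow_gate_succ, ← outflow_gate]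
      exact h.conservation _ (by simp [network]) (by simp [network])
    · rw [← inflow_mid, ← outflow_mid]
      exact h.conservation _ (by simp [network]) (by simp [network])
    · rw [← inflow_mid_last f, ← outflow_mid_last f]
      exact h.conservation _ (by simp [network]) (by simp [network])
    · rw [← inflow_final f, ← outflow_final f]
      exact h.conservation _ (by simp [network]) (by simp [network])
  · rintro ⟨h1, h2, h3, h4, h5, h6⟩
    refine ⟨h1, fun v hs ht => ?_⟩
    cases v with
    | source => exact absurd rfl hs
    | sink => exact absurd rfl ht
    | gate c i =>
      rw [outflow_gate]
      induction c using Fin.cases with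
      | zero => rw [inflow_gate_zero, h2]
      | succ c => rw [inflow_gate_succ, h3]
    | mid c p =>
      induction c using Fin.lastCases with
      | last =>
        induction p using Fin.lastCases with
        | last => rw [inflow_final_last, outflow_final_last]
        | cast p => rw [inflow_final, outflow_final, h6]
      | cast c =>
        induction p using Fin.lastCases with
        | last => rw [inflow_mid_last, outflow_mid_last, h5]
        | cast p => rw [inflow_mid, outflow_mid, h4]

theorem value_eq : S.network.value f =
    ((∑ i, f (start i) + ∑ c : Fin S.C, if (S.col c).restore then 0 else f (top c) : ℕ) : ℤ) -
      ((∑ c : Fin S.C, if (S.col c).restore then f (top c) else 0 : ℕ) : ℤ) := by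
  rw [← outflow_source, ← inflow_source]; rfl

end StripData

/-! ### Flows of maximum value as choices of labels -/

namespace StripData

open StripArc StripVertex

variable (S : StripData)

/-- A routing selects a label for each row in each column; `v c j` is the amount of flow on the arc
of the vertical path of column `c` that leads to position `j`. -/
structure IsRouting (lam : ℕ → Fin S.k → Fin S.L) (v : ℕ → ℕ → ℕ) : Prop where
  start : ∀ i : Fin S.k, (S.col 0).cin i (lam 0 i) = S.base
  next : ∀ c < S.C, ∀ i : Fin S.k, (S.col (c + 1)).cin i (lam (c + 1) i) = (S.col c).cout i (lam c i)
  last : ∀ i : Fin S.k, (S.col S.C).cin i (lam S.C i) = (S.col S.C).cout i (lam S.C i)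
  top : ∀ c < S.C, v c 0 = if (S.col c).restore then 0 else (S.col c).vcap
  vert : ∀ c < S.C, ∀ j, v c j = 0 ∨ v c j = (S.col c).vcap
  step : ∀ c < S.C, ∀ p : Fin (S.k * S.L),
    (if lam c p.divNat = p.modNat then S.capIn c p else 0) + v c p =
      (if lam c p.divNat = p.modNat then S.capOut c p else 0) + v c (p + 1)

theorem sum_row {k L : ℕ} (g : Fin (k * L) → ℕ) (i : Fin k) :
    (∑ p : Fin (k * L), if p.divNat = i then g p else 0) = ∑ l : Fin L, g (finProdFinEquiv (i, l)) := by
  rw [← finProdFinEquiv.sum_comp, Fintype.sum_prod_type, Finset.sum_eq_single i]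
  · refine Finset.sum_congr rfl fun l _ => if_pos ?_
    exact congrArg Prod.fst (finProdFinEquiv.symm_apply_apply (i, l))
  · intro j _ hj
    refine Finset.sum_eq_zero fun l _ => if_neg ?_
    have : (finProdFinEquiv (j, l)).divNat = j :=
      congrArg Prod.fst (finProdFinEquiv.symm_apply_apply (j, l))
    rwa [this]
  · simp

@[simp]
theorem divNat_finProdFinEquiv {k L : ℕ} (i : Fin k) (l : Fin L) :
    (finProdFinEquiv (i, l)).divNat = i :=
  congrArg Prod.fst (finProdFinEquiv.symm_apply_apply (i, l))

@[simp]
theorem modNat_finProdFinEquiv {k L : ℕ} (i : Fin k) (l : Fin L) :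
    (finProdFinEquiv (i, l)).modNat = l :=
  congrArg Prod.snd (finProdFinEquiv.symm_apply_apply (i, l))

theorem finProdFinEquiv_divNat_modNat {k L : ℕ} (p : Fin (k * L)) :
    finProdFinEquiv (p.divNat, p.modNat) = p :=
  finProdFinEquiv.apply_symm_apply p

/-- Two used arcs would carry at least `2 * A` and no used arc would carry `0 < A`, so a total in
`[A, 2 * A)` comes from a single full arc. -/
theorem exists_unique_used {α : Type} [Fintype α] [DecidableEq α] (A : ℕ) (g c : α → ℕ)
    (hc : ∀ a, A ≤ c a) (hg : ∀ a, g a = 0 ∨ g a = c a) (h0 : 0 < A) (h1 : A ≤ ∑ a, g a)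
    (h2 : ∑ a, g a < 2 * A) : ∃ a, c a = ∑ a, g a ∧ ∀ b, g b = if a = b then c b else 0 := by
  obtain ⟨a, -, ha⟩ := Finset.exists_ne_zero_of_sum_ne_zero (h0.trans_le h1).ne'
  have hac : g a = c a := (hg a).resolve_left ha
  have hb : ∀ b, b ≠ a → g b = 0 := by
    intro b hb
    by_contra hne
    have hbc := (hg b).resolve_left hne
    have : g a + g b ≤ ∑ a, g a := by
      rw [← Finset.sum_pair hb.symm]
      exact Finset.sum_le_sum_of_subset (Finset.subset_univ _)
    have := hc a
    have := hc b
    omega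
  refine ⟨a, ?_, fun b => ?_⟩
  · rw [Finset.sum_eq_single a (fun b _ => hb b) (by simp), hac]
  · split_ifs with h
    · rw [← h, hac]
    · exact hb b (Ne.symm h)

variable {S}

theorem vflow_of_isFlow {f : StripArc S.C S.k S.L → ℕ} (hf : ∀ e, f e = 0 ∨ f e = S.cap e)
    (c : Fin S.C) (j : ℕ) : S.vflow f c j = 0 ∨ S.vflow f c j = (S.col c).vcap := by
  cases j with
  | zero =>
    rw [vflow]
    split_ifs
    · exact Or.inl rfl
    · exact hf (StripArc.top c)
  | succ j =>
    rw [vflow]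
    split_ifs
    · exact hf (StripArc.vert c _)
    · exact Or.inl rfl

/-- By induction along the columns each row carries an amount in `[base, 2 * base)`, hence uses
exactly one label by `exists_unique_used`. -/
theorem exists_routing_of_flow {f : StripArc S.C S.k S.L → ℕ} (hflow : S.network.IsFlow f)
    (hf : ∀ e, f e = 0 ∨ f e = S.cap e) (hv : S.network.value f = S.target) :
    ∃ lam v, S.IsRouting lam v := by
  obtain ⟨h1, h2, h3, h4, h5, h6⟩ := (isFlow_iff f).1 hflow
  have hA := S.base_pos
  -- all arcs out of the source are full, all arcs into it are empty
  have hs1 : ∑ i, f (StripArc.start i) ≤ S.k * S.base := by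
    refine (Finset.sum_le_card_nsmul _ _ S.base fun i _ => h1 _).trans ?_
    simp
  have htop : ∀ c : Fin S.C, (if (S.col c).restore then 0 else f (StripArc.top c)) ≤
      if (S.col c).restore then 0 else (S.col c).vcap := by
    intro c
    split_ifs
    · exact le_rfl
    · exact h1 _
  have hs2 := Finset.sum_le_sum fun c (_ : c ∈ Finset.univ) => htop c
  rw [value_eq, target, Finset.sum_range fun c => if (S.col c).restore then 0 else (S.col c).vcap]
    at hv
  have hz : ∑ c : Fin S.C, (if (S.col c).restore then f (StripArc.top c) else 0) = 0 := by omega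
  have e1 : ∑ i, f (StripArc.start i) = ∑ i : Fin S.k, S.base := by simp; omega
  have e2 : ∑ c : Fin S.C, (if (S.col c).restore then 0 else f (StripArc.top c)) =
      ∑ c : Fin S.C, if (S.col c).restore then 0 else (S.col c).vcap := by omega
  have hstart : ∀ i, f (StripArc.start i) = S.base := fun i =>
    (Finset.sum_eq_sum_iff_of_le fun i _ => h1 (StripArc.start i)).1 e1 i (Finset.mem_univ i)
  have htop' : ∀ c : Fin S.C, (if (S.col c).restore then 0 else f (StripArc.top c)) =
      if (S.col c).restore then 0 else (S.col c).vcap := fun c =>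
    (Finset.sum_eq_sum_iff_of_le fun c _ => htop c).1 e2 c (Finset.mem_univ c)
  have hback : ∀ c : Fin S.C, ∀ p : Fin (S.k * S.L),
      (if p.val = 0 ∧ (S.col c).restore then f (StripArc.top c) else 0) = 0 := by
    intro c p
    split_ifs with h
    · have := (Finset.sum_eq_zero_iff.1 hz) c (Finset.mem_univ c)
      rwa [if_pos h.2] at this
    · rfl
  simp only [hback, add_zero] at h4
  simp only [sum_row] at h2 h3
  -- The vertical flow is less than `base`, so it cannot make up for a missing row arc: both row
  -- arcs at a middle vertex are full or both are empty.
  have hused : ∀ c : Fin S.C, ∀ p : Fin (S.k * S.L),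
      (f (enter c.castSucc p) = S.capIn c p ∧ f (leave c.castSucc p) = S.capOut c p) ∨
      (f (enter c.castSucc p) = 0 ∧ f (leave c.castSucc p) = 0) := by
    intro c p
    have a1 : f (enter c.castSucc p) = 0 ∨ f (enter c.castSucc p) = S.capIn c p :=
      hf (enter c.castSucc p)
    have a2 : f (leave c.castSucc p) = 0 ∨ f (leave c.castSucc p) = S.capOut c p :=
      hf (leave c.castSucc p)
    have := h4 c p
    have := S.le_cin c p.divNat p.modNat
    have := S.le_cout c p.divNat p.modNat
    have := S.vcap_lt c
    have := vflow_of_isFlow hf c p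
    have := vflow_of_isFlow hf c (p + 1)
    simp only [capIn, capOut] at *
    omega
  have key : ∀ c : Fin (S.C + 1), ∀ i : Fin S.k,
      S.base ≤ ∑ l : Fin S.L, f (enter c (finProdFinEquiv (i, l))) →
      ∑ l : Fin S.L, f (enter c (finProdFinEquiv (i, l))) < 2 * S.base →
      ∃ a : Fin S.L, (S.col c).cin i a = ∑ l : Fin S.L, f (enter c (finProdFinEquiv (i, l))) ∧
        ∀ b : Fin S.L, f (enter c (finProdFinEquiv (i, b))) =
          if a = b then (S.col c).cin i b else 0 := by
    intro c i ha hb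
    refine exists_unique_used S.base _ (fun b : Fin S.L => (S.col c).cin i b)
      (fun b => S.le_cin _ _ _) (fun b => ?_) hA ha hb
    have := hf (enter c (finProdFinEquiv (i, b)))
    simpa [cap, capIn] using this
  have hleave : ∀ c : Fin S.C, ∀ i : Fin S.k, ∀ a : Fin S.L,
      (∀ b : Fin S.L, f (enter c.castSucc (finProdFinEquiv (i, b))) =
          if a = b then (S.col c).cin i b else 0) →
      ∀ b : Fin S.L, f (leave c.castSucc (finProdFinEquiv (i, b))) =
          if a = b then (S.col c).cout i b else 0 := by
    intro c i a ha b
    have e1 := ha b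
    have e2 := hused c (finProdFinEquiv (i, b))
    have := S.le_cin c i b
    simp only [capIn, capOut, divNat_finProdFinEquiv, modNat_finProdFinEquiv] at e2
    split_ifs at e1 ⊢ <;> omega
  -- What enters a column is what left the previous one, namely the capacity of a single leaving
  -- arc, which lies in the right interval.
  have range : ∀ c : Fin (S.C + 1), ∀ i : Fin S.k,
      S.base ≤ ∑ l : Fin S.L, f (enter c (finProdFinEquiv (i, l))) ∧
      ∑ l : Fin S.L, f (enter c (finProdFinEquiv (i, l))) < 2 * S.base := by
    intro c
    induction c using Fin.induction with
    | zero =>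
      intro i
      rw [← h2, hstart]
      omega
    | succ c ih =>
      intro i
      obtain ⟨a, -, ha⟩ := key _ i (ih i).1 (ih i).2
      have hl := hleave c i a ha
      rw [← h3]
      simp only [hl, Finset.sum_ite_eq, Finset.mem_univ, if_true]
      exact ⟨S.le_cout _ _ _, S.cout_lt _ _ _ a.isLt⟩
  choose lam hlam1 hlam2 using fun c i => key c i (range c i).1 (range c i).2
  have hlamp : ∀ c : Fin S.C, ∀ p : Fin (S.k * S.L), f (enter c.castSucc p) =
      if lam c.castSucc p.divNat = p.modNat then S.capIn c p else 0 := by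
    intro c p
    have := hlam2 c.castSucc p.divNat p.modNat
    rwa [finProdFinEquiv_divNat_modNat] at this
  have hlamq : ∀ c : Fin S.C, ∀ p : Fin (S.k * S.L), f (leave c.castSucc p) =
      if lam c.castSucc p.divNat = p.modNat then S.capOut c p else 0 := by
    intro c p
    have := hleave c p.divNat _ (hlam2 c.castSucc p.divNat) p.modNat
    rwa [finProdFinEquiv_divNat_modNat] at this
  -- Columns beyond the last one are not constrained, so the default values are arbitrary.
  refine ⟨fun c => if h : c < S.C + 1 then lam ⟨c, h⟩ else lam 0,
    fun c j => if h : c < S.C then S.vflow f ⟨c, h⟩ j else 0, ?_, ?_, ?_, ?_, ?_, ?_⟩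
  · intro i
    have := hlam1 0 i
    rw [← h2, hstart] at this
    simpa using this
  · intro c hc i
    have e1 := hlam1 (Fin.succ ⟨c, hc⟩) i
    rw [← h3] at e1
    have hl := hleave ⟨c, hc⟩ i _ (hlam2 (Fin.castSucc ⟨c, hc⟩) i)
    simp only [hl, Finset.sum_ite_eq, Finset.mem_univ, if_true] at e1
    simp only [dif_pos (Nat.succ_lt_succ hc), dif_pos (Nat.lt_succ_of_lt hc)]
    exact e1
  · intro i
    -- In the last column nothing is absorbed: the leaving arc carries the positive amount of the
    -- entering arc, so it is full too and both capacities agree.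
    have e1 := hlam2 (Fin.last S.C) i (lam (Fin.last S.C) i)
    have e2 := h6 (finProdFinEquiv (i, lam (Fin.last S.C) i))
    have e3 := hf (leave (Fin.last S.C) (finProdFinEquiv (i, lam (Fin.last S.C) i)))
    have := S.le_cin S.C i (lam (Fin.last S.C) i)
    simp only [if_true, Fin.val_last] at e1
    simp only [cap, capOut, divNat_finProdFinEquiv, modNat_finProdFinEquiv, Fin.val_last] at e3
    simp only [dif_pos (Nat.lt_succ_self S.C)]
    change (S.col S.C).cin i (lam (Fin.last S.C) i) = (S.col S.C).cout i (lam (Fin.last S.C) i)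
    omega
  · intro c hc
    rw [dif_pos hc]
    exact htop' ⟨c, hc⟩
  · intro c hc j
    rw [dif_pos hc]
    exact vflow_of_isFlow hf ⟨c, hc⟩ j
  · intro c hc p
    have := h4 ⟨c, hc⟩ p
    rw [hlamp, hlamq] at this
    simp only [dif_pos hc, dif_pos (Nat.lt_succ_of_lt hc)]
    exact this

theorem exists_flow_of_routing {lam : ℕ → Fin S.k → Fin S.L} {v : ℕ → ℕ → ℕ}
    (h : S.IsRouting lam v) : S.network.HasAllOrNothingFlow S.target := by
  let f : StripArc S.C S.k S.L → ℕ := fun e => match e with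
    | StripArc.start i => S.base
    | StripArc.top c => if (S.col c).restore then 0 else (S.col c).vcap
    -- Whatever reaches the bottom of the path goes on to the sink, which is why a routing has no
    -- condition there.
    | StripArc.bot c => v c (S.k * S.L)
    | StripArc.vert c p => v c (p + 1)
    | enter c p => if lam c p.divNat = p.modNat then S.capIn c p else 0
    | leave c p => if lam c p.divNat = p.modNat then S.capOut c p else 0
  have hvf : ∀ c : Fin S.C, ∀ j ≤ S.k * S.L, S.vflow f c j = v c j := by
    intro c j hj
    cases j with
    | zero =>
      rw [vflow, h.top c c.isLt]
      split_ifs with hr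
      · rfl
      · exact if_neg hr
    | succ j => rw [vflow, dif_pos (by omega)]
  have hall : ∀ e, f e = 0 ∨ f e = S.cap e := by
    intro e
    cases e with
    | start i => exact Or.inr rfl
    | top c =>
      change ite _ _ _ = _ ∨ ite _ _ _ = _
      split_ifs
      · exact Or.inl rfl
      · exact Or.inr rfl
    | bot c => exact h.vert c c.isLt _
    | vert c p => exact h.vert c c.isLt _
    | enter c p =>
      change ite _ _ _ = _ ∨ ite _ _ _ = _
      split_ifs
      · exact Or.inr rfl
      · exact Or.inl rfl
    | leave c p =>
      change ite _ _ _ = _ ∨ ite _ _ _ = _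
      split_ifs
      · exact Or.inr rfl
      · exact Or.inl rfl
  have henter : ∀ c : Fin (S.C + 1), ∀ i, ∑ l : Fin S.L, f (enter c (finProdFinEquiv (i, l))) =
      (S.col c).cin i (lam c i) := by
    intro c i
    simp only [f, capIn, divNat_finProdFinEquiv, modNat_finProdFinEquiv, Finset.sum_ite_eq,
      Finset.mem_univ, if_true]
  have hleave : ∀ c : Fin (S.C + 1), ∀ i, ∑ l : Fin S.L, f (leave c (finProdFinEquiv (i, l))) =
      (S.col c).cout i (lam c i) := by
    intro c i
    simp only [f, capOut, divNat_finProdFinEquiv, modNat_finProdFinEquiv, Finset.sum_ite_eq,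
      Finset.mem_univ, if_true]
  refine ⟨f, (isFlow_iff f).2 ⟨?_, ?_, ?_, ?_, ?_, ?_⟩, hall, ?_⟩
  · intro e
    rcases hall e with h | h <;> omega
  · intro i
    rw [sum_row, henter]
    exact (h.start i).symm
  · intro c i
    rw [sum_row, sum_row, henter, hleave]
    exact (h.next c c.isLt i).symm
  · intro c p
    rw [hvf _ _ p.isLt.le, hvf _ _ p.isLt]
    have e : (if p.val = 0 ∧ (S.col c).restore then f (StripArc.top c) else 0) = 0 := by
      split_ifs with hr
      · exact if_pos hr.2
      · rfl
    rw [e, add_zero]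
    exact h.step c c.isLt p
  · intro c
    exact hvf c _ le_rfl
  · intro p
    change ite _ _ _ = ite _ _ _
    split_ifs with hp
    · rw [capIn, capOut, ← hp]
      exact h.last _
    · rfl
  · rw [value_eq, target, Finset.sum_range]
    have e1 : (∑ c : Fin S.C, if (S.col c).restore then f (StripArc.top c) else 0) = 0 := by
      refine Finset.sum_eq_zero fun c _ => ?_
      split_ifs with hr
      · exact if_pos hr
      · rfl
    have e2 : (∑ c : Fin S.C, if (S.col c).restore then 0 else f (StripArc.top c)) =
        ∑ c : Fin S.C, if (S.col c).restore then 0 else (S.col c).vcap := by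
      refine Finset.sum_congr rfl fun c _ => ?_
      split_ifs with hr
      · rfl
      · exact if_neg hr
    rw [e1, e2]
    simp [f]

/-- All-or-nothing flows of the maximum value correspond to routings. -/
theorem hasAllOrNothingFlow_iff :
    S.network.HasAllOrNothingFlow S.target ↔ ∃ lam v, S.IsRouting lam v :=
  ⟨fun ⟨_, h1, h2, h3⟩ => exists_routing_of_flow h1 h2 h3,
    fun ⟨_, _, h⟩ => exists_flow_of_routing h⟩

end StripData

/-! ### The strip network of an instance of Multicolored Clique -/

namespace CliqueStrip

variable (n : ℕ) (part : ℕ → ℕ) (adj : ℕ → ℕ → Bool)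

/-- The column in which a row may select the vertex `x`. Label `0` means that nothing has been
selected yet, label `x + 1` that `x` has been selected. -/
def selectColumn (x : ℕ) : StripColumn where
  vcap := 2 * (x + 1)
  restore := false
  -- Only at label `x + 1` in the row of the class of `x` do the two capacities differ: the row
  -- enters with the amount of an unselected row and leaves with that of `x`, absorbing `vcap`.
  cin i l := if i = part x ∧ l = x + 1 then 2 * n + 2 else 2 * n + 2 + 2 * l
  cout _ l := 2 * n + 2 + 2 * l

/-- The amount of vertical flow that a row with label `l` absorbs in the test of `x` and `y`. -/
def absorb (x y l : ℕ) : ℕ := if adj x y = false ∧ (l = x + 1 ∨ l = y + 1) then 1 else 0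

/-- The column that tests the pair `x`, `y`, and the column that undoes its effect. -/
def testColumn (x y : ℕ) (b : Bool) : StripColumn where
  vcap := 1
  restore := b
  -- As `absorb` is at most `1` and `2 * l` is even, the amount between the test and its restoring
  -- column still determines the label.
  cin _ l := 2 * n + 2 + 2 * l + if b then absorb adj x y l else 0
  cout _ l := 2 * n + 2 + 2 * l + if b then 0 else absorb adj x y l

/-- The column that forbids rows without a selected vertex. -/
def finalColumn : StripColumn where
  vcap := 1
  restore := false
  -- The amounts that arrive here have an even excess over `2 * n + 2`; the odd excess demanded at
  -- label `0` leaves no label for a row with excess `0`.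
  cin _ l := 2 * n + 2 + if l = 0 then 1 else 2 * l
  cout _ l := 2 * n + 2 + if l = 0 then 1 else 2 * l

/-- The columns in their order. -/
def column (c : ℕ) : StripColumn :=
  if c < n then selectColumn n part c
  -- The pairs come in row-major order, like the adjacency bits of the input; the parity of `c - n`
  -- separates a test from its restoring column.
  else if c < n + 2 * (n * n) then
    testColumn n adj ((c - n) / 2 / n) ((c - n) / 2 % n) ((c - n) % 2 == 1)
  else finalColumn n

theorem absorb_le (x y l : ℕ) : absorb adj x y l ≤ 1 := by
  unfold absorb; split_ifs <;> simp

theorem column_select {c : ℕ} (hc : c < n) : column n part adj c = selectColumn n part c :=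
  if_pos hc

theorem column_test {x y : ℕ} (hx : x < n) (hy : y < n) :
    column n part adj (n + 2 * (x * n + y)) = testColumn n adj x y false := by
  have : x * n + y < n * n := by nlinarith
  have e1 : (n + 2 * (x * n + y) - n) / 2 = x * n + y := by omega
  have e2 : (n + 2 * (x * n + y) - n) % 2 = 0 := by omega
  have e3 : (x * n + y) / n = x := by
    rw [Nat.mul_comm, Nat.mul_add_div (by omega), Nat.div_eq_of_lt hy, Nat.add_zero]
  have e4 : (x * n + y) % n = y := by
    rw [Nat.mul_comm, Nat.mul_add_mod, Nat.mod_eq_of_lt hy]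
  rw [column, if_neg (by omega), if_pos (by omega), e1, e2, e3, e4]
  rfl

theorem column_restore {x y : ℕ} (hx : x < n) (hy : y < n) :
    column n part adj (n + 2 * (x * n + y) + 1) = testColumn n adj x y true := by
  have : x * n + y < n * n := by nlinarith
  have e1 : (n + 2 * (x * n + y) + 1 - n) / 2 = x * n + y := by omega
  have e2 : (n + 2 * (x * n + y) + 1 - n) % 2 = 1 := by omega
  have e3 : (x * n + y) / n = x := by
    rw [Nat.mul_comm, Nat.mul_add_div (by omega), Nat.div_eq_of_lt hy, Nat.add_zero]
  have e4 : (x * n + y) % n = y := by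
    rw [Nat.mul_comm, Nat.mul_add_mod, Nat.mod_eq_of_lt hy]
  rw [column, if_neg (by omega), if_pos (by omega), e1, e2, e3, e4]
  rfl

theorem column_final : column n part adj (n + 2 * (n * n)) = finalColumn n := by
  rw [column, if_neg (by omega), if_neg (by omega)]

theorem column_cases {P : ℕ → Prop} (h1 : ∀ c < n, P c)
    (h2 : ∀ x < n, ∀ y < n, P (n + 2 * (x * n + y)))
    (h3 : ∀ x < n, ∀ y < n, P (n + 2 * (x * n + y) + 1)) (c : ℕ) (hc : c < n + 2 * (n * n)) :
    P c := by
  by_cases hcn : c < n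
  · exact h1 c hcn
  have hn : 0 < n := by
    rcases Nat.eq_zero_or_pos n with rfl | h
    · simp at hc
    · exact h
  have hx : (c - n) / 2 / n < n := Nat.div_lt_of_lt_mul (by omega)
  have hy : (c - n) / 2 % n < n := Nat.mod_lt _ hn
  have e : (c - n) / 2 / n * n + (c - n) / 2 % n = (c - n) / 2 := Nat.div_add_mod' _ _
  rcases Nat.mod_two_eq_zero_or_one (c - n) with h | h
  · have := h2 _ hx _ hy
    rw [e] at this
    rwa [show n + 2 * ((c - n) / 2) = c by omega] at this
  · have := h3 _ hx _ hy
    rw [e] at this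
    rwa [show n + 2 * ((c - n) / 2) + 1 = c by omega] at this

/-- The strip network of an instance. -/
def data (k : ℕ) (hk : 0 < k) : StripData where
  C := n + 2 * (n * n)
  k := k
  L := n + 1
  -- The largest excess is `2 * n + 1` and the largest vertical capacity that occurs is at most `2 *
  -- n`; both must be less than `base`.
  base := 2 * n + 2
  col := column n part adj
  k_pos := hk
  L_pos := Nat.succ_pos n
  vcap_pos c := by
    unfold column; split_ifs <;> simp [selectColumn, testColumn, finalColumn]
  vcap_lt c := by
    unfold column; split_ifs <;> simp [selectColumn, testColumn, finalColumn]; omega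
  le_cin c i l := by
    unfold column; split_ifs <;> simp [selectColumn, testColumn, finalColumn] <;>
      (try split_ifs) <;> omega
  le_cout c i l := by
    unfold column; split_ifs <;> simp [selectColumn, testColumn, finalColumn] <;>
      (try split_ifs) <;> omega
  cin_lt c i l hl := by
    have := absorb_le adj ((c - n) / 2 / n) ((c - n) / 2 % n) l
    unfold column; split_ifs <;> simp [selectColumn, testColumn, finalColumn] <;>
      (try split_ifs) <;> omega
  cout_lt c i l hl := by
    have := absorb_le adj ((c - n) / 2 / n) ((c - n) / 2 % n) l
    unfold column; split_ifs <;> simp [selectColumn, testColumn, finalColumn] <;>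
      (try split_ifs) <;> omega

variable {n part adj} {k : ℕ} {hk : 0 < k}

/-- Follow the amount of a row: selection columns change it only from the unselected amount to that
of a vertex of its class, each pair of test columns preserves it, and the last column rejects the
unselected amount. If two rows ended with nonadjacent vertices, both would have to absorb the single
unit in the test of these vertices. -/
theorem exists_clique_of_routing {lam : ℕ → Fin k → Fin (n + 1)} {v} (h : (data n part adj k hk).IsRouting lam v) :
    ∃ x : Fin k → ℕ, (∀ i, x i < n ∧ part (x i) = i) ∧
      ∀ i j, i ≠ j → adj (x i) (x j) = true := by
  have next : ∀ c < n + 2 * (n * n), ∀ i : Fin k, (column n part adj (c + 1)).cin i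
    (lam (c + 1) i) = (column n part adj c).cout i (lam c i) := h.next
  have hsel : ∀ c ≤ n, ∀ i : Fin k,
      (column n part adj c).cin i (lam c i) = 2 * n + 2 ∨ ∃ x < n, part x = i ∧
        (column n part adj c).cin i (lam c i) = 2 * n + 2 + 2 * (x + 1) := by
    intro c
    induction c with
    | zero => exact fun _ i => Or.inl (h.start i)
    | succ c ih =>
      intro hc i
      have ihc := ih (by omega) i
      rw [next c (by omega) i]
      rw [column_select n part adj (by omega)] at ihc ⊢
      by_cases hi : (i : ℕ) = part c ∧ (lam c i : ℕ) = c + 1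
      · refine Or.inr ⟨c, by omega, hi.1.symm, ?_⟩
        simp [selectColumn, hi.2]
      · simp only [selectColumn, if_neg hi] at ihc ⊢
        exact ihc
  have htest : ∀ j ≤ n * n, ∀ i : Fin k,
      (column n part adj (n + 2 * j)).cin i (lam (n + 2 * j) i) =
        (column n part adj n).cin i (lam n i) := by
    intro j
    induction j with
    | zero => exact fun _ i => rfl
    | succ j ih =>
      intro hj i
      have hn : 0 < n := Nat.pos_of_ne_zero fun h => by subst h; omega
      have hx : j / n < n := Nat.div_lt_of_lt_mul (by omega)
      have hy : j % n < n := Nat.mod_lt _ hn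
      have e : j / n * n + j % n = j := Nat.div_add_mod' _ _
      have c1 := column_test n part adj hx hy
      have c2 := column_restore n part adj hx hy
      rw [e] at c1 c2
      have n1 := next (n + 2 * j) (by omega) i
      have n2 := next (n + 2 * j + 1) (by omega) i
      have ihj := ih (by omega) i
      -- Halving the excess shows that the labels in the two columns coincide, so the second column
      -- undoes the first.
      have a1 := absorb_le adj (j / n) (j % n) (lam (n + 2 * j) i)
      have a2 := absorb_le adj (j / n) (j % n) (lam (n + 2 * j + 1) i)
      rw [c1] at ihj n1
      rw [c2] at n1 n2
      rw [show n + 2 * (j + 1) = n + 2 * j + 1 + 1 by ring, n2, ← ihj]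
      simp only [testColumn, if_true, Bool.false_eq_true, if_false] at n1 ⊢
      omega
  have hend : ∀ i : Fin k, ∃ x < n, part x = i ∧
        (column n part adj n).cin i (lam n i) = 2 * n + 2 + 2 * (x + 1) := by
    intro i
    refine (hsel n le_rfl i).resolve_left fun h0 => ?_
    have := htest _ le_rfl i
    rw [h0, column_final] at this
    simp only [finalColumn] at this
    split_ifs at this <;> omega
  choose x hx hp hw using hend
  refine ⟨x, fun i => ⟨hx i, hp i⟩, fun i j hij => ?_⟩
  by_contra hadj
  rw [Bool.not_eq_true] at hadj
  have hlt : x i * n + x j < n * n := by nlinarith [hx i, hx j]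
  have hc : n + 2 * (x i * n + x j) < n + 2 * (n * n) := by omega
  have col := column_test n part adj (hx i) (hx j)
  have hlam : ∀ i' : Fin k, (lam (n + 2 * (x i * n + x j)) i' : ℕ) = x i' + 1 := by
    intro i'
    have := htest _ hlt.le i'
    rw [hw, col] at this
    simp only [testColumn, Bool.false_eq_true, if_false] at this
    omega
  set c := n + 2 * (x i * n + x j) with hcdef
  have step : ∀ p : Fin (k * (n + 1)),
      (if lam c p.divNat = p.modNat then (column n part adj c).cin p.divNat p.modNat else 0) +
        v c p = (if lam c p.divNat = p.modNat then (column n part adj c).cout p.divNat p.modNat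
          else 0) + v c (p + 1) := h.step _ hc
  have vert : ∀ m, v c m = 0 ∨ v c m = (column n part adj c).vcap := h.vert _ hc
  rw [col] at step vert
  simp only [testColumn, Bool.false_eq_true, if_false] at step vert
  set w := v c with hwdef
  -- Conservation is known only below position `k * (n + 1)`; the minimum makes the sequence
  -- constant from there on.
  have anti : Antitone (fun m => w (min m (k * (n + 1)))) := by
    refine antitone_nat_of_succ_le fun m => ?_
    by_cases hm : m < k * (n + 1)
    · have := step ⟨m, hm⟩
      rw [min_eq_left hm.le, min_eq_left hm]
      split_ifs at this <;> simp at this <;> omega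
    · rw [min_eq_right (by omega), min_eq_right (by omega)]
  -- A row that absorbs the unit makes the vertical flow drop from `1` to `0` at its position, which
  -- an antitone sequence can do only once.
  have full : ∀ i', i' = i ∨ i' = j → ∃ p : Fin (k * (n + 1)), p.divNat = i' ∧
      w p = 1 ∧ w (p + 1) = 0 := by
    intro i' hi'
    refine ⟨finProdFinEquiv (i', lam c i'),
      StripData.divNat_finProdFinEquiv _ _, ?_⟩
    have := step (finProdFinEquiv (i', lam c i'))
    rw [StripData.divNat_finProdFinEquiv, StripData.modNat_finProdFinEquiv, if_pos rfl, if_pos rfl,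
      hlam i'] at this
    have e : absorb adj (x i) (x j) (x i' + 1) = 1 := by
      rcases hi' with rfl | rfl <;> simp [absorb, hadj]
    rw [e] at this
    have v1 := vert (finProdFinEquiv (i', lam c i') : Fin (k * (n + 1)))
    have v2 := vert
      ((finProdFinEquiv (i', lam c i') : Fin (k * (n + 1))) + 1)
    omega
  obtain ⟨p, hp1, hp2, hp3⟩ := full i (Or.inl rfl)
  obtain ⟨q, hq1, hq2, hq3⟩ := full j (Or.inr rfl)
  rcases lt_trichotomy p.val q.val with hpq | hpq | hpq
  · have : w (min q _) ≤ w (min (p + 1) _) := anti (Nat.succ_le_of_lt hpq)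
    rw [min_eq_left (Nat.succ_le_of_lt p.isLt), min_eq_left q.isLt.le, Nat.succ_eq_add_one] at this
    omega
  · exact hij (by rw [← hp1, ← hq1, Fin.ext hpq])
  · have : w (min p _) ≤ w (min (q + 1) _) := anti (Nat.succ_le_of_lt hpq)
    rw [min_eq_left (Nat.succ_le_of_lt q.isLt), min_eq_left p.isLt.le, Nat.succ_eq_add_one] at this
    omega

end CliqueStrip

/-! ### From a clique to a routing -/

namespace StripData

/-- Vertical flows exist if in each column there is at most one position at which the flow along
the selected labels changes. -/
theorem exists_routing_of_labels (S : StripData) (lam : ℕ → Fin S.k → Fin S.L)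
    (start : ∀ i : Fin S.k, (S.col 0).cin i (lam 0 i) = S.base)
    (next : ∀ c < S.C, ∀ i : Fin S.k,
      (S.col (c + 1)).cin i (lam (c + 1) i) = (S.col c).cout i (lam c i))
    (last : ∀ i : Fin S.k, (S.col S.C).cin i (lam S.C i) = (S.col S.C).cout i (lam S.C i))
    (change : ∀ c < S.C, ∀ i : Fin S.k, (S.col c).cin i (lam c i) = (S.col c).cout i (lam c i) ∨
      if (S.col c).restore then (S.col c).cin i (lam c i) =
        (S.col c).cout i (lam c i) + (S.col c).vcap
      else (S.col c).cout i (lam c i) = (S.col c).cin i (lam c i) + (S.col c).vcap)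
    (unique : ∀ c < S.C, ∀ i j : Fin S.k,
      (S.col c).cin i (lam c i) ≠ (S.col c).cout i (lam c i) →
      (S.col c).cin j (lam c j) ≠ (S.col c).cout j (lam c j) → i = j) :
    ∃ lam v, S.IsRouting lam v := by
  classical
  let active (c : ℕ) (p : Fin (S.k * S.L)) : Prop :=
    lam c p.divNat = p.modNat ∧ S.capIn c p ≠ S.capOut c p
  have huniq : ∀ c < S.C, ∀ p q, active c p → active c q → p = q := by
    rintro c hc p q ⟨h1, h2⟩ ⟨h3, h4⟩
    have e : p.divNat = q.divNat := by
      refine unique c hc _ _ ?_ ?_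
      · rw [h1]; exact h2
      · rw [h3]; exact h4
    rw [← finProdFinEquiv_divNat_modNat p, ← finProdFinEquiv_divNat_modNat q, ← h1, ← h3, e]
  -- The vertical flow switches once, just below the active position: on in a restoring column, off
  -- in any other.
  refine ⟨lam, fun c j => if (S.col c).restore then
      if ∃ p, active c p ∧ p.val < j then (S.col c).vcap else 0
    else if ∃ p, active c p ∧ p.val < j then 0 else (S.col c).vcap,
    start, next, last, fun c _ => by simp, fun c _ j => by split_ifs <;> simp, fun c hc p => ?_⟩
  by_cases hp : active c p
  · have h1 : ¬ ∃ q, active c q ∧ q.val < p.val := by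
      rintro ⟨q, hq, hlt⟩
      rw [huniq c hc q p hq hp] at hlt
      exact lt_irrefl _ hlt
    have h2 : ∃ q, active c q ∧ q.val < p.val + 1 := ⟨p, hp, Nat.lt_succ_self _⟩
    have h3 := (change c hc p.divNat).resolve_left (by rw [hp.1]; exact hp.2)
    rw [hp.1] at h3
    simp only [h1, h2, if_true, if_false, if_pos hp.1]
    split_ifs at h3 ⊢ <;> simp only [capIn, capOut] <;> omega
  · have h1 : (∃ q, active c q ∧ q.val < p.val + 1) ↔ ∃ q, active c q ∧ q.val < p.val := by
      refine exists_congr fun q => and_congr_right fun hq => ?_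
      have : q.val ≠ p.val := fun e => hp (Fin.ext e ▸ hq)
      omega
    simp only [h1]
    congr 1
    by_cases hl : lam c p.divNat = p.modNat
    · rw [if_pos hl, if_pos hl]
      by_contra hne
      exact hp ⟨hl, hne⟩
    · rw [if_neg hl, if_neg hl]

end StripData

namespace CliqueStrip

variable {n : ℕ} {part : ℕ → ℕ} {adj : ℕ → ℕ → Bool} {k : ℕ} {hk : 0 < k}

/-- In each column at most one row changes its amount: in a selection column the row that selects
its vertex, in a test column a row holding a vertex of a nonadjacent pair, since the vertices of two
different rows are adjacent. The vertical flows then come from `StripData.exists_routing_of_labels`.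
-/
theorem exists_routing_of_clique (hsymm : ∀ x y, adj x y = adj y x) {x : Fin k → ℕ}
    (hx : ∀ i, x i < n) (hpart : ∀ i, part (x i) = i)
    (hadj : ∀ i j, i ≠ j → adj (x i) (x j) = true) :
    ∃ lam v, (data n part adj k hk).IsRouting lam v := by
  have hinj : ∀ i j, x i = x j → i = j := fun i j e => Fin.ext (by rw [← hpart, ← hpart, e])
  -- Two different rows would hold `a` and `b`, in one order or the other; symmetry of `adj` covers
  -- both.
  have habs : ∀ a b i j, absorb adj a b (x i + 1) ≠ 0 → absorb adj a b (x j + 1) ≠ 0 → i = j := by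
    intro a b i j hi hj
    simp only [absorb, ne_eq, ite_eq_right_iff, Classical.not_imp, Nat.add_right_cancel_iff,
      one_ne_zero, not_false_eq_true, and_true] at hi hj
    obtain ⟨h1, h2⟩ := hi
    obtain ⟨-, h3⟩ := hj
    by_contra hij
    have e1 := hadj i j hij
    have e2 := hsymm (x i) (x j)
    have e3 : x i ≠ x j := fun h => hij (hinj i j h)
    rcases h2 with h2 | h2 <;> rcases h3 with h3 | h3 <;> simp_all
  -- In column `x i` itself the label is already `x i + 1`, although the row still enters with the
  -- unselected amount.
  let lam : ℕ → Fin k → Fin (n + 1) := fun c i =>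
    ⟨if c < x i then 0 else x i + 1, by have := hx i; split_ifs <;> omega⟩
  have lam_ge : ∀ c (i : Fin k), n ≤ c → (lam c i : ℕ) = x i + 1 := fun c i h =>
    if_neg (by have := hx i; omega)
  have lam_val : ∀ c (i : Fin k), (lam c i : ℕ) = if c < x i then 0 else x i + 1 := fun c i => rfl
  have cin_eq : ∀ c ≤ n + 2 * (n * n), ∀ i : Fin k, (c ≤ x i →
      (column n part adj c).cin i (lam c i) = 2 * n + 2) := by
    intro c hc i hci
    have := hx i
    rw [column_select n part adj (by omega), selectColumn, lam_val]
    rcases hci.lt_or_eq with h | h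
    · simp [h]
    · simp [h, hpart]
  have cin_eq' : ∀ c (i : Fin k), c < n → x i < c →
      (column n part adj c).cin i (lam c i) = 2 * n + 2 + 2 * (x i + 1) := by
    intro c i hc hci
    rw [column_select n part adj hc, selectColumn, lam_val, if_neg (by omega)]
    simp only
    rw [if_neg]
    omega
  have cout_eq : ∀ c (i : Fin k), c < n → (column n part adj c).cout i (lam c i) =
      if c < x i then 2 * n + 2 else 2 * n + 2 + 2 * (x i + 1) := by
    intro c i hc
    rw [column_select n part adj hc, selectColumn, lam_val]
    simp only
    split_ifs <;> simp
  have ctest : ∀ a < n, ∀ b < n, ∀ i : Fin k,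
      (column n part adj (n + 2 * (a * n + b))).cin i (lam (n + 2 * (a * n + b)) i) =
        2 * n + 2 + 2 * (x i + 1) ∧
      (column n part adj (n + 2 * (a * n + b))).cout i (lam (n + 2 * (a * n + b)) i) =
        2 * n + 2 + 2 * (x i + 1) + absorb adj a b (x i + 1) := by
    intro a ha b hb i
    rw [column_test n part adj ha hb, lam_ge _ _ (by omega)]
    simp [testColumn]
  have crest : ∀ a < n, ∀ b < n, ∀ i : Fin k,
      (column n part adj (n + 2 * (a * n + b) + 1)).cin i (lam (n + 2 * (a * n + b) + 1) i) =
        2 * n + 2 + 2 * (x i + 1) + absorb adj a b (x i + 1) ∧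
      (column n part adj (n + 2 * (a * n + b) + 1)).cout i (lam (n + 2 * (a * n + b) + 1) i) =
        2 * n + 2 + 2 * (x i + 1) := by
    intro a ha b hb i
    rw [column_restore n part adj ha hb, lam_ge _ _ (by omega)]
    simp [testColumn]
  have cfin : ∀ i : Fin k, (column n part adj (n + 2 * (n * n))).cin i (lam (n + 2 * (n * n)) i) =
        2 * n + 2 + 2 * (x i + 1) := by
    intro i
    rw [column_final, lam_ge _ _ (by omega)]
    simp [finalColumn]
  have ceven : ∀ j ≤ n * n, ∀ i : Fin k, (column n part adj (n + 2 * j)).cin i (lam (n + 2 * j) i) =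
        2 * n + 2 + 2 * (x i + 1) := by
    intro j hj i
    rcases hj.lt_or_eq with h | h
    · have hn : 0 < n := by have := hx i; omega
      have := (ctest (j / n) (Nat.div_lt_of_lt_mul h) (j % n) (Nat.mod_lt _ hn) i).1
      rwa [Nat.div_add_mod'] at this
    · rw [h]; exact cfin i
  refine StripData.exists_routing_of_labels _ lam ?_ ?_ ?_ ?_ ?_
  · intro i
    exact cin_eq 0 (Nat.zero_le _) i (Nat.zero_le _)
  · intro c hc i
    change (column n part adj (c + 1)).cin i (lam (c + 1) i) =
      (column n part adj c).cout i (lam c i)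
    revert i
    refine column_cases n (P := fun c => ∀ i : Fin k, (column n part adj (c + 1)).cin i
      (lam (c + 1) i) = (column n part adj c).cout i (lam c i)) ?_ ?_ ?_ c hc
    · intro c hc i
      rw [cout_eq c i hc]
      split_ifs with h
      · exact cin_eq _ (by omega) i h
      · rcases Nat.lt_or_ge (c + 1) n with h1 | h1
        · exact cin_eq' _ i h1 (by omega)
        · have := ceven 0 (Nat.zero_le _) i
          rwa [show n + 2 * 0 = c + 1 by omega] at this
    · intro a ha b hb i
      rw [(crest a ha b hb i).1, (ctest a ha b hb i).2]
    · intro a ha b hb i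
      rw [(crest a ha b hb i).2]
      exact ceven (a * n + b + 1) (by nlinarith) i
  · intro i
    change (column n part adj (n + 2 * (n * n))).cin _ _ =
      (column n part adj (n + 2 * (n * n))).cout _ _
    rw [column_final]
    rfl
  · intro c hc i
    revert i
    refine column_cases n (P := fun c => ∀ i : Fin k, (column n part adj c).cin i (lam c i) =
      (column n part adj c).cout i (lam c i) ∨ if (column n part adj c).restore then
      (column n part adj c).cin i (lam c i) = (column n part adj c).cout i (lam c i) +
      (column n part adj c).vcap else (column n part adj c).cout i (lam c i) =
      (column n part adj c).cin i (lam c i) + (column n part adj c).vcap) ?_ ?_ ?_ c hc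
    · intro c hc i
      have e : (column n part adj c).restore = false ∧ (column n part adj c).vcap = 2 * (c + 1) := by
        rw [column_select n part adj hc]; exact ⟨rfl, rfl⟩
      rw [cout_eq c i hc, e.1, e.2]
      rcases lt_trichotomy c (x i) with h | h | h
      · left; rw [cin_eq c (hc.le.trans (Nat.le_add_right _ _)) i h.le, if_pos h]
      · right
        rw [cin_eq c (hc.le.trans (Nat.le_add_right _ _)) i h.le]
        simp [h]
      · left; rw [cin_eq' c i hc h, if_neg (by omega)]
    · intro a ha b hb i
      have e := column_test n part adj ha hb
      have := absorb_le adj a b (x i + 1)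
      rw [(ctest a ha b hb i).1, (ctest a ha b hb i).2, e]
      simp only [testColumn, Bool.false_eq_true, if_false]
      omega
    · intro a ha b hb i
      have e := column_restore n part adj ha hb
      have := absorb_le adj a b (x i + 1)
      rw [(crest a ha b hb i).1, (crest a ha b hb i).2, e]
      simp only [testColumn, if_true]
      omega
  · intro c hc i j
    revert i j
    refine column_cases n (P := fun c => ∀ i j : Fin k,
      (column n part adj c).cin i (lam c i) ≠ (column n part adj c).cout i (lam c i) →
      (column n part adj c).cin j (lam c j) ≠ (column n part adj c).cout j (lam c j) → i = j)
      ?_ ?_ ?_ c hc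
    · have key : ∀ c < n, ∀ i : Fin k, (column n part adj c).cin i (lam c i) ≠
          (column n part adj c).cout i (lam c i) → x i = c := by
        intro c hc i h
        by_contra hne
        refine h ?_
        rw [cout_eq c i hc]
        rcases lt_or_gt_of_ne hne with h | h
        · rw [cin_eq' c i hc h, if_neg (by omega)]
        · rw [cin_eq c (hc.le.trans (Nat.le_add_right _ _)) i h.le, if_pos h]
      intro c hc i j hi hj
      exact hinj i j ((key c hc i hi).trans (key c hc j hj).symm)
    · intro a ha b hb i j hi hj
      rw [(ctest a ha b hb i).1, (ctest a ha b hb i).2] at hi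
      rw [(ctest a ha b hb j).1, (ctest a ha b hb j).2] at hj
      exact habs a b i j (by omega) (by omega)
    · intro a ha b hb i j hi hj
      rw [(crest a ha b hb i).1, (crest a ha b hb i).2] at hi
      rw [(crest a ha b hb j).1, (crest a ha b hb j).2] at hj
      exact habs a b i j (by omega) (by omega)

end CliqueStrip

/-! ### Renaming vertices and arcs -/

namespace FlowNetwork

variable {V E V' E' : Type}

/-- Rename the vertices and arcs of a network. -/
def reindex (D : FlowNetwork V E) (φ : V ≃ V') (ψ : E ≃ E') : FlowNetwork V' E' where
  src e := φ (D.src (ψ.symm e))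
  tgt e := φ (D.tgt (ψ.symm e))
  cap e := D.cap (ψ.symm e)
  s := φ D.s
  t := φ D.t
  src_ne_tgt e h := D.src_ne_tgt _ (φ.injective h)
  cap_pos e := D.cap_pos _
  s_ne_t h := D.s_ne_t (φ.injective h)

variable (D : FlowNetwork V E) (φ : V ≃ V') (ψ : E ≃ E')

section

variable [DecidableEq V] [DecidableEq V'] [Fintype E] [Fintype E']

theorem outflow_reindex (f : E' → ℕ) (v : V) :
    (D.reindex φ ψ).outflow f (φ v) = D.outflow (f ∘ ψ) v := by
  rw [outflow, outflow, Finset.sum_filter, Finset.sum_filter, ← ψ.sum_comp]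
  simp [reindex]

theorem inflow_reindex (f : E' → ℕ) (v : V) :
    (D.reindex φ ψ).inflow f (φ v) = D.inflow (f ∘ ψ) v := by
  rw [inflow, inflow, Finset.sum_filter, Finset.sum_filter, ← ψ.sum_comp]
  simp [reindex]

theorem hasAllOrNothingFlow_reindex (F : ℕ) :
    (D.reindex φ ψ).HasAllOrNothingFlow F ↔ D.HasAllOrNothingFlow F := by
  have key : ∀ f : E' → ℕ, ((D.reindex φ ψ).IsFlow f ∧ (∀ e, f e = 0 ∨
      f e = (D.reindex φ ψ).cap e) ∧ (D.reindex φ ψ).value f = F) ↔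
      (D.IsFlow (f ∘ ψ) ∧ (∀ e, (f ∘ ψ) e = 0 ∨ (f ∘ ψ) e = D.cap e) ∧ D.value (f ∘ ψ) = F) := by
    intro f
    refine and_congr ⟨fun h => ⟨fun e => ?_, fun v hs ht => ?_⟩,
      fun h => ⟨fun e => ?_, fun v hs ht => ?_⟩⟩ (and_congr ?_ ?_)
    · simpa [reindex] using h.le_cap (ψ e)
    · rw [← inflow_reindex D φ ψ, ← outflow_reindex D φ ψ]
      exact h.conservation _ (fun h => hs (φ.injective h)) (fun h => ht (φ.injective h))
    · simpa [reindex] using h.le_cap (ψ.symm e)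
    · obtain ⟨v, rfl⟩ := φ.surjective v
      rw [inflow_reindex, outflow_reindex]
      exact h.conservation _ (fun h => hs (congrArg φ h)) (fun h => ht (congrArg φ h))
    · rw [← ψ.forall_congr_right]
      simp [reindex]
    · rw [value, value, ← outflow_reindex D φ ψ, ← inflow_reindex D φ ψ]
      rfl
  constructor
  · rintro ⟨f, hf⟩
    exact ⟨f ∘ ψ, (key f).1 hf⟩
  · rintro ⟨f, hf⟩
    refine ⟨f ∘ ψ.symm, (key _).2 ?_⟩
    rwa [Function.comp_assoc, Equiv.symm_comp_self, Function.comp_id]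

end

theorem IsPlanar.reindex {D : FlowNetwork V E} (h : D.IsPlanar) (φ : V ≃ V') (ψ : E ≃ E') :
    (D.reindex φ ψ).IsPlanar := by
  obtain ⟨P⟩ := h
  exact ⟨{
    point := P.point ∘ φ.symm
    curve := P.curve ∘ ψ.symm
    point_injective := P.point_injective.comp φ.symm.injective
    curve_continuous := fun e => P.curve_continuous _
    curve_injective := fun e => P.curve_injective _
    curve_zero := fun e => by simpa [FlowNetwork.reindex] using P.curve_zero _
    curve_one := fun e => by simpa [FlowNetwork.reindex] using P.curve_one _
    avoids_points := fun e x v => P.avoids_points _ _ _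
    avoids_curves := fun e e' h => P.avoids_curves _ _ (fun h' => h (ψ.symm.injective h')) }⟩

theorem pathwidth_reindex_le [DecidableEq V'] (P : PathDecomposition D.underlying) :
    pathwidth (D.reindex φ ψ).underlying ≤ P.width := by
  have hadj : ∀ u v, (D.reindex φ ψ).underlying.Adj u v → D.underlying.Adj (φ.symm u) (φ.symm v) := by
    intro u v
    simp only [underlying, SimpleGraph.fromRel_adj, reindex]
    rintro ⟨hne, ⟨e, rfl, rfl⟩ | ⟨e, rfl, rfl⟩⟩
    · exact ⟨fun h => hne (by simpa using h), Or.inl ⟨ψ.symm e, by simp, by simp⟩⟩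
    · exact ⟨fun h => hne (by simpa using h), Or.inr ⟨ψ.symm e, by simp, by simp⟩⟩
  let Q : PathDecomposition (D.reindex φ ψ).underlying :=
    { length := P.length
      bag := fun i => (P.bag i).map φ.toEmbedding
      exists_mem_bag := fun v => by
        obtain ⟨i, hi⟩ := P.exists_mem_bag (φ.symm v)
        exact ⟨i, by simpa [Finset.mem_map_equiv] using hi⟩
      exists_adj_bag := fun u v h => by
        obtain ⟨i, hi⟩ := P.exists_adj_bag _ _ (hadj u v h)
        exact ⟨i, by simpa [Finset.mem_map_equiv] using hi⟩
      mem_bag_of_between := fun v i j l hij hjl hi hl => by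
        rw [Finset.mem_map_equiv] at *
        exact P.mem_bag_of_between _ i j l hij hjl hi hl }
  have : Q.width = P.width := by simp [Q, PathDecomposition.width]
  exact this ▸ Nat.sInf_le ⟨Q, rfl⟩

end FlowNetwork

/-! ### Pathwidth of strip networks -/

namespace StripData

open StripArc StripVertex

variable (S : StripData)

/-- The vertices in the bag number `j`. -/
def InBag (j : ℕ) : StripVertex S.C S.k S.L → Prop
  | source => True
  | sink => True
  | gate c _ => (c : ℕ) = j / (S.k * S.L) ∨ (c : ℕ) = j / (S.k * S.L) + 1
  | mid c p => (c : ℕ) = j / (S.k * S.L) ∧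
      ((p : ℕ) = j % (S.k * S.L) ∨ (p : ℕ) = j % (S.k * S.L) + 1)

open Classical in
/-- The bag number `j`. -/
noncomputable def bag (j : ℕ) : Finset (StripVertex S.C S.k S.L) := Finset.univ.filter (S.InBag j)

theorem mem_bag (j : ℕ) (v) : v ∈ S.bag j ↔ S.InBag j v := by simp [bag]

/-- The source, the sink and two middle vertices account for `4`, the gates of two consecutive
columns for `2 * k`. -/
theorem card_bag_le (j : ℕ) : (S.bag j).card ≤ 2 * S.k + 4 := by
  -- Indices are clamped because the column after the last one does not exist.
  let cl (m c : ℕ) : Fin (m + 1) := ⟨min c m, by omega⟩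
  let c := j / (S.k * S.L)
  let p := j % (S.k * S.L)
  have hsub : S.bag j ⊆ ({source, sink, mid (cl _ c) (cl _ p), mid (cl _ c) (cl _ (p + 1))} :
      Finset (StripVertex S.C S.k S.L)) ∪
      (Finset.univ.image (gate (cl _ c)) ∪ Finset.univ.image (gate (cl _ (c + 1)))) := by
    intro v hv
    rw [mem_bag] at hv
    have hcl : ∀ m (x : Fin (m + 1)) y, (x : ℕ) = y → x = cl m y := fun m x y h => by
      have := x.isLt
      exact Fin.ext (by simp only [cl]; omega)
    simp only [Finset.mem_union, Finset.mem_insert, Finset.mem_singleton, Finset.mem_image,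
      Finset.mem_univ, true_and]
    cases v with
    | source => simp
    | sink => simp
    | gate c' i =>
      rcases hv with h | h
      · right; left; exact ⟨i, by rw [hcl _ _ _ h]⟩
      · right; right; exact ⟨i, by rw [hcl _ _ _ h]⟩
    | mid c' p' =>
      obtain ⟨h, h' | h'⟩ := hv
      · left; right; right; left; rw [hcl _ _ _ h, hcl _ _ _ h']
      · left; right; right; right; rw [hcl _ _ _ h, hcl _ _ _ h']
  refine (Finset.card_le_card hsub).trans ((Finset.card_union_le _ _).trans ?_)
  have h1 := Finset.card_union_le
    (Finset.univ.image (gate (L := S.L) (k := S.k) (cl S.C c)))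
    (Finset.univ.image (gate (L := S.L) (k := S.k) (cl S.C (c + 1))))
  have h2 := Finset.card_image_le (s := Finset.univ) (f := gate (L := S.L) (k := S.k) (cl S.C c))
  have h3 := Finset.card_image_le (s := Finset.univ)
    (f := gate (L := S.L) (k := S.k) (cl S.C (c + 1)))
  have h4 := Finset.card_le_four (a := (source : StripVertex S.C S.k S.L)) (b := sink)
    (c := mid (cl _ c) (cl _ p)) (d := mid (cl _ c) (cl _ (p + 1)))
  simp only [Finset.card_univ, Fintype.card_fin] at h2 h3
  omega

/-- Bag `j` belongs to position `j % (k * L)` of column `j / (k * L)`. A gate stays for two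
consecutive columns at most and a middle vertex for two consecutive positions of one column at most,
which are intervals of `j`. -/
theorem inBag_between (v) (i j l : ℕ) (hij : i ≤ j) (hjl : j ≤ l) (hi : S.InBag i v)
    (hl : S.InBag l v) : S.InBag j v := by
  have h1 := Nat.div_le_div_right (c := S.k * S.L) hij
  have h2 := Nat.div_le_div_right (c := S.k * S.L) hjl
  cases v with
  | source => trivial
  | sink => trivial
  | gate c x => simp only [InBag] at *; omega
  | mid c p =>
    have e1 := Nat.div_add_mod i (S.k * S.L)
    have e2 := Nat.div_add_mod j (S.k * S.L)
    have e3 := Nat.div_add_mod l (S.k * S.L)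
    simp only [InBag] at *
    have hj : j / (S.k * S.L) = c := by omega
    rw [← hi.1] at e1
    rw [hj] at e2
    rw [← hl.1] at e3
    omega

theorem div_mod_position (c p : ℕ) (hp : p < S.k * S.L) :
    (S.k * S.L * c + p) / (S.k * S.L) = c ∧ (S.k * S.L * c + p) % (S.k * S.L) = p :=
  ⟨by rw [Nat.mul_add_div S.kL_pos, Nat.div_eq_of_lt hp, Nat.add_zero],
    by rw [Nat.mul_add_mod, Nat.mod_eq_of_lt hp]⟩

theorem position_lt {c p : ℕ} (hc : c ≤ S.C) (hp : p < S.k * S.L) :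
    S.k * S.L * c + p < (S.C + 1) * (S.k * S.L) := by
  nlinarith [Nat.mul_le_mul_left (S.k * S.L) hc]

/-- A path decomposition that sweeps through the columns. -/
noncomputable def decomposition : PathDecomposition S.network.underlying where
  length := (S.C + 1) * (S.k * S.L)
  bag j := S.bag j
  exists_mem_bag v := by
    have h0 := S.kL_pos
    have key : ∀ c p, c ≤ S.C → p < S.k * S.L → S.InBag (S.k * S.L * c + p) v →
        ∃ j : Fin ((S.C + 1) * (S.k * S.L)), v ∈ S.bag j :=
      fun c p hc hp h => ⟨⟨_, S.position_lt hc hp⟩, (S.mem_bag _ _).2 h⟩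
    cases v with
    | source => exact key 0 0 (Nat.zero_le _) h0 trivial
    | sink => exact key 0 0 (Nat.zero_le _) h0 trivial
    | gate c i =>
      have := S.div_mod_position c 0 h0
      exact key c 0 (by omega) h0 (by simp only [InBag]; omega)
    | mid c p =>
      by_cases hp : (p : ℕ) < S.k * S.L
      · have := S.div_mod_position c p hp
        exact key c p (by omega) hp (by simp only [InBag]; omega)
      -- The bottom middle vertex has no position of its own and shares the bag of the position
      -- above it.
      · have := S.div_mod_position c (S.k * S.L - 1) (by omega)
        exact key c (S.k * S.L - 1) (by omega) (by omega) (by simp only [InBag]; omega)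
  exists_adj_bag u v h := by
    have h0 := S.kL_pos
    have key : ∀ c p, c ≤ S.C → p < S.k * S.L → ∀ u v, S.InBag (S.k * S.L * c + p) u →
        S.InBag (S.k * S.L * c + p) v →
        ∃ j : Fin ((S.C + 1) * (S.k * S.L)), u ∈ S.bag j ∧ v ∈ S.bag j :=
      fun c p hc hp u v h h' =>
        ⟨⟨_, S.position_lt hc hp⟩, (S.mem_bag _ _).2 h, (S.mem_bag _ _).2 h'⟩
    have arc : ∀ e, ∃ j : Fin ((S.C + 1) * (S.k * S.L)), S.src e ∈ S.bag j ∧ S.tgt e ∈ S.bag j := by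
      intro e
      cases e with
      | start i =>
        exact key 0 0 (Nat.zero_le _) h0 _ _ trivial (by simp [tgt, InBag])
      | top c =>
        have := S.div_mod_position c 0 h0
        refine key c 0 (by omega) h0 _ _ ?_ ?_ <;> simp only [src, tgt] <;> split_ifs <;>
          first | trivial | (simp only [InBag, Fin.val_castSucc, Fin.val_zero]; omega)
      | bot c =>
        have := S.div_mod_position c (S.k * S.L - 1) (by omega)
        refine key c (S.k * S.L - 1) (by omega) (by omega) _ _ ?_ trivial
        simp only [src, InBag, Fin.val_castSucc, Fin.val_last]
        omega
      | vert c p =>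
        have := S.div_mod_position c p p.isLt
        refine key c p (by omega) p.isLt _ _ ?_ ?_ <;>
          simp only [src, tgt, InBag, Fin.val_castSucc, Fin.val_succ] <;> omega
      | enter c p =>
        have := S.div_mod_position c p p.isLt
        refine key c p (by omega) p.isLt _ _ ?_ ?_ <;>
          simp only [src, tgt, InBag, Fin.val_castSucc] <;> omega
      | leave c p =>
        have := S.div_mod_position c p p.isLt
        refine key c p (by omega) p.isLt _ _ ?_ ?_
        · simp only [src, InBag, Fin.val_castSucc]; omega
        · simp only [tgt]
          split_ifs
          · simp only [InBag]; omega
          · trivial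
    simp only [FlowNetwork.underlying, SimpleGraph.fromRel_adj] at h
    obtain ⟨-, ⟨e, rfl, rfl⟩ | ⟨e, rfl, rfl⟩⟩ := h
    · exact arc e
    · exact (arc e).imp fun j hj => hj.symm
  mem_bag_of_between v i j l hij hjl hi hl :=
    (S.mem_bag _ _).2 (S.inBag_between v i j l hij hjl ((S.mem_bag _ _).1 hi) ((S.mem_bag _ _).1 hl))

theorem width_decomposition_le : S.decomposition.width ≤ 5 * S.k := by
  have h : (Finset.univ.sup fun i => (S.decomposition.bag i).card) ≤ 2 * S.k + 4 :=
    Finset.sup_le fun i _ => S.card_bag_le i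
  -- For `k ≥ 1`, `2 * k + 4 - 1 ≤ 5 * k`.
  have := S.k_pos
  unfold PathDecomposition.width
  omega

end StripData

/-! ### Planarity of strip networks -/

namespace StripData

open StripArc StripVertex

variable (S : StripData)

/-- The position of a vertex in the plane. -/
noncomputable def pos : StripVertex S.C S.k S.L → ℝ × ℝ
  -- Gates and middle vertices fill the box `[0, 2C + 1] × [-(kL + 1), -1]`, gates at even and
  -- middle vertices at odd abscissae, each gate level with the first middle vertex of its row. The
  -- source is above and to the left of the box, the sink below and to the right.
  | source => (-2, 1)
  | sink => (2 * S.C + 4, -(S.k * S.L + 3))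
  | gate c i => (2 * (c : ℕ), -((i : ℕ) * S.L + 1))
  | mid c p => (2 * (c : ℕ) + 1, -((p : ℕ) + 1))

/-- The segment that represents an arc, from left to right or from top to bottom. -/
noncomputable def segment : StripArc S.C S.k S.L → ℝ → ℝ × ℝ
  | start i, τ => (-2 + 2 * τ, 1 - τ * ((i : ℕ) * S.L + 2))
  | top c, τ => (-2 + τ * (2 * (c : ℕ) + 3), 1 - 2 * τ)
  | bot c, τ => (2 * (c : ℕ) + 1 + τ * (2 * S.C + 3 - 2 * (c : ℕ)), -(S.k * S.L + 1) - 2 * τ)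
  | vert c p, τ => (2 * (c : ℕ) + 1, -((p : ℕ) + 1) - τ)
  | enter c p, τ => (2 * (c : ℕ) + τ,
      -((p.divNat : ℕ) * S.L + 1 + τ * (p.modNat : ℕ)))
  | leave c p, τ =>
    if (c : ℕ) < S.C then (2 * (c : ℕ) + 1 + τ,
      -((p.divNat : ℕ) * S.L + 1 + (1 - τ) * (p.modNat : ℕ)))
    else (2 * S.C + 1 + 3 * τ, -((p : ℕ) + 1) - τ * (S.k * S.L + 2 - (p : ℕ)))

theorem nat_eq_of_add_eq {a b : ℕ} {x y : ℝ} (hx : 0 ≤ x) (hx' : x < 1) (hy : 0 ≤ y) (hy' : y < 1)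
    (h : (a : ℝ) + x = b + y) : a = b ∧ x = y := by
  have h1 : (a : ℝ) < b + 1 := by linarith
  have h2 : (b : ℝ) < a + 1 := by linarith
  norm_cast at h1 h2
  have : a = b := by omega
  subst this
  exact ⟨rfl, by linarith⟩

theorem position_eq {k L : ℕ} (p : Fin (k * L)) :
    ((p : ℕ) : ℝ) = (p.divNat : ℕ) * L + (p.modNat : ℕ) := by
  have : (p : ℕ) = (p.divNat : ℕ) * L + (p.modNat : ℕ) := by
    simp [Fin.coe_divNat, Fin.coe_modNat, Nat.div_add_mod']
  exact_mod_cast this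

theorem position_bounds {k L : ℕ} (p : Fin (k * L)) :
    ((p.divNat : ℕ) : ℝ) * L ≥ 0 ∧ ((p.divNat : ℕ) : ℝ) * L + L ≤ k * L ∧
      ((p.modNat : ℕ) : ℝ) ≥ 0 ∧ ((p.modNat : ℕ) : ℝ) + 1 ≤ L := by
  refine ⟨by positivity, ?_, by positivity, ?_⟩
  · have h : (p.divNat : ℕ) + 1 ≤ k := p.divNat.isLt
    have : ((p.divNat : ℕ) + 1) * L ≤ k * L := Nat.mul_le_mul_right _ h
    rw [Nat.succ_mul] at this
    exact_mod_cast this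
  · exact_mod_cast p.modNat.isLt

/-- At a fixed abscissa the fans of different rows lie in disjoint intervals of length `L`, and
inside a fan the heights are distinct multiples of `σ`. -/
theorem fan_injective {k L : ℕ} {p q : Fin (k * L)} {σ : ℝ} (h0 : 0 < σ) (h1 : σ < 1)
    (h : ((p.divNat : ℕ) : ℝ) * L + 1 + σ * (p.modNat : ℕ) =
      (q.divNat : ℕ) * L + 1 + σ * (q.modNat : ℕ)) : p = q := by
  obtain ⟨p1, p2, p3, p4⟩ := position_bounds p
  obtain ⟨q1, q2, q3, q4⟩ := position_bounds q
  have key : ∀ a b : ℕ, ∀ x y : ℝ, 0 ≤ x → 0 ≤ y → x < L → y < L →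
      (a : ℝ) * L + x = b * L + y → a ≤ b := by
    intro a b x y hx hy hx' hy' hab
    by_contra hlt
    have : (b : ℝ) + 1 ≤ a := by exact_mod_cast Nat.succ_le_of_lt (not_le.1 hlt)
    nlinarith
  have hp : σ * (p.modNat : ℕ) < L := by nlinarith
  have hq : σ * (q.modNat : ℕ) < L := by nlinarith
  have hp0 : 0 ≤ σ * (p.modNat : ℕ) := by positivity
  have hq0 : 0 ≤ σ * (q.modNat : ℕ) := by positivity
  have e1 : (p.divNat : ℕ) = q.divNat :=
    le_antisymm (key _ _ _ _ hp0 hq0 hp hq (by linarith))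
      (key _ _ _ _ hq0 hp0 hq hp (by linarith))
  have e2 : ((p.modNat : ℕ) : ℝ) = (q.modNat : ℕ) := by
    rw [e1] at h
    exact mul_left_cancel₀ h0.ne' (by linarith)
  rw [← finProdFinEquiv_divNat_modNat p, ← finProdFinEquiv_divNat_modNat q, Fin.ext e1,
    Fin.ext (Nat.cast_injective e2)]

theorem pos_injective : Function.Injective S.pos := by
  intro u v h
  have hL : (1 : ℝ) ≤ S.L := by exact_mod_cast S.L_pos
  cases u <;> cases v <;> simp only [pos, Prod.mk.injEq] at h <;> obtain ⟨h1, h2⟩ := h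
  case source.source => rfl
  case sink.sink => rfl
  case gate.gate c i d j =>
    have e1 : (c : ℕ) = d := Nat.cast_injective (R := ℝ) (by linarith)
    have e2 : (i : ℕ) = j := Nat.cast_injective (R := ℝ)
      (mul_right_cancel₀ (by linarith : (S.L : ℝ) ≠ 0) (by linarith))
    rw [Fin.ext e1, Fin.ext e2]
  case mid.mid c p d q =>
    have e1 : (c : ℕ) = d := Nat.cast_injective (R := ℝ) (by linarith)
    have e2 : (p : ℕ) = q := Nat.cast_injective (R := ℝ) (by linarith)
    rw [Fin.ext e1, Fin.ext e2]
  case gate.mid c i d j => exfalso; norm_cast at h1; omega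
  case mid.gate c i d j => exfalso; norm_cast at h1; omega
  all_goals
    exfalso
    first
    | (have : (0 : ℝ) ≤ S.C := by positivity
       linarith)
    | (rename_i c i
       have : ((c : ℕ) : ℝ) ≥ 0 := by positivity
       have : ((c : ℕ) : ℝ) ≤ S.C := by exact_mod_cast Nat.lt_succ_iff.1 c.isLt
       linarith)

/-- Arcs at the source. -/
def AtSource : StripArc S.C S.k S.L → Prop
  | start _ => True
  | top _ => True
  | _ => False

/-- Arcs at the sink. -/
def AtSink : StripArc S.C S.k S.L → Prop
  | bot _ => True
  | leave c _ => ¬ (c : ℕ) < S.C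
  | _ => False

variable {S} {τ τ' : ℝ}

/-- This and the next three lemmas separate the arcs by regions: inner points of arcs at the source
lie to the left of or above the box, those of arcs at the sink to the right of or below it, all
others inside. -/
theorem segment_atSource {e : StripArc S.C S.k S.L} (he : S.AtSource e) (h0 : 0 < τ) (h1 : τ < 1) :
    ((S.segment e τ).1 < 0 ∨ -1 < (S.segment e τ).2) ∧ -2 < (S.segment e τ).1 ∧
      (S.segment e τ).1 < 2 * S.C + 4 := by
  have hC : (0 : ℝ) ≤ S.C := by positivity
  cases e with
  | start i => simp only [segment]; exact ⟨Or.inl (by linarith), by linarith, by linarith⟩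
  | top c =>
    have h2 : ((c : ℕ) : ℝ) ≤ S.C := by exact_mod_cast c.isLt.le
    have h3 : (0 : ℝ) ≤ (c : ℕ) := by positivity
    simp only [segment]
    exact ⟨Or.inr (by linarith), by nlinarith, by nlinarith⟩
  | _ => exact he.elim

theorem segment_not_atSource {e : StripArc S.C S.k S.L} (he : ¬ S.AtSource e) (h0 : 0 < τ)
    (h1 : τ < 1) : 0 ≤ (S.segment e τ).1 ∧ (S.segment e τ).2 ≤ -1 ∧
      (S.segment e τ).1 < 2 * S.C + 4 := by
  have hC : (0 : ℝ) ≤ S.C := by positivity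
  have hkL : (0 : ℝ) ≤ S.k * S.L := by positivity
  cases e with
  | start i => exact (he trivial).elim
  | top c => exact (he trivial).elim
  | bot c =>
    have h2 : ((c : ℕ) : ℝ) ≤ S.C := by exact_mod_cast c.isLt.le
    have h3 : (0 : ℝ) ≤ (c : ℕ) := by positivity
    simp only [segment]
    exact ⟨by nlinarith, by nlinarith, by nlinarith⟩
  | vert c p =>
    have h2 : ((c : ℕ) : ℝ) ≤ S.C := by exact_mod_cast c.isLt.le
    have h4 : (0 : ℝ) ≤ (p : ℕ) := by positivity
    simp only [segment]
    exact ⟨by positivity, by linarith, by linarith⟩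
  | enter c p =>
    have h2 : ((c : ℕ) : ℝ) ≤ S.C := by exact_mod_cast Nat.lt_succ_iff.1 c.isLt
    obtain ⟨p1, p2, p3, p4⟩ := position_bounds p
    simp only [segment]
    exact ⟨by positivity, by nlinarith, by linarith⟩
  | leave c p =>
    obtain ⟨p1, p2, p3, p4⟩ := position_bounds p
    have h2 : ((c : ℕ) : ℝ) ≤ S.C := by exact_mod_cast Nat.lt_succ_iff.1 c.isLt
    have h4 : (0 : ℝ) ≤ (p : ℕ) := by positivity
    have h5 : ((p : ℕ) : ℝ) ≤ S.k * S.L := by exact_mod_cast p.isLt.le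
    simp only [segment]
    split_ifs
    · exact ⟨by positivity, by nlinarith, by linarith⟩
    · exact ⟨by positivity, by nlinarith, by linarith⟩

theorem segment_atSink {e : StripArc S.C S.k S.L} (he : S.AtSink e) (h0 : 0 < τ) :
    2 * S.C + 1 < (S.segment e τ).1 ∨ (S.segment e τ).2 < -(S.k * S.L + 1) := by
  cases e with
  | bot c => right; simp only [segment]; linarith
  | leave c p => left; simp only [segment, if_neg he]; linarith
  | _ => exact he.elim

theorem segment_not_atSink {e : StripArc S.C S.k S.L} (he : ¬ S.AtSink e)
    (hs : ¬ S.AtSource e) (h0 : 0 < τ) (h1 : τ < 1) :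
    (S.segment e τ).1 ≤ 2 * S.C + 1 ∧ -(S.k * S.L + 1) ≤ (S.segment e τ).2 := by
  cases e with
  | start i => exact (hs trivial).elim
  | top c => exact (hs trivial).elim
  | bot c => exact (he trivial).elim
  | vert c p =>
    have h2 : ((c : ℕ) : ℝ) ≤ S.C := by exact_mod_cast c.isLt.le
    have h5 : ((p : ℕ) : ℝ) + 1 ≤ S.k * S.L := by exact_mod_cast p.isLt
    simp only [segment]
    exact ⟨by linarith, by linarith⟩
  | enter c p =>
    have h2 : ((c : ℕ) : ℝ) ≤ S.C := by exact_mod_cast Nat.lt_succ_iff.1 c.isLt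
    obtain ⟨p1, p2, p3, p4⟩ := position_bounds p
    simp only [segment]
    exact ⟨by linarith, by nlinarith⟩
  | leave c p =>
    obtain ⟨p1, p2, p3, p4⟩ := position_bounds p
    have hc : (c : ℕ) < S.C := not_not.1 he
    have h2 : ((c : ℕ) : ℝ) + 1 ≤ S.C := by exact_mod_cast hc
    simp only [segment, if_pos hc]
    exact ⟨by linarith, by nlinarith⟩

/-- Inner points of arcs at the source determine the arc. -/
theorem eq_of_segment_eq_of_atSource {e e' : StripArc S.C S.k S.L} (he : S.AtSource e)
    (he' : S.AtSource e') (h0 : 0 < τ) (h0' : 0 < τ')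
    (h : S.segment e τ = S.segment e' τ') : e = e' := by
  have hL : (1 : ℝ) ≤ S.L := by exact_mod_cast S.L_pos
  -- Two rays from the source: the first coordinate forces `2 * b ≥ 3 * a`, the second `a ≥ b`.
  have cross : ∀ (c : Fin S.C) (i : Fin S.k) (a b : ℝ), 0 < a → 0 < b →
      S.segment (top c) a ≠ S.segment (StripArc.start i) b := by
    intro c i a b ha hb hab
    simp only [segment, Prod.mk.injEq] at hab
    obtain ⟨h1, h2⟩ := hab
    have h3 : (0 : ℝ) ≤ (c : ℕ) := by positivity
    have h4 : (0 : ℝ) ≤ (i : ℕ) * S.L := by positivity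
    have h5 : 2 * b ≥ 3 * a := by nlinarith
    have h6 : 2 * a ≥ 2 * b := by nlinarith
    linarith
  cases e with
  | start i =>
    cases e' with
    | start j =>
      simp only [segment, Prod.mk.injEq] at h
      obtain ⟨h1, h2⟩ := h
      have ht : τ = τ' := by linarith
      subst ht
      have h3 : ((i : ℕ) : ℝ) * S.L = (j : ℕ) * S.L :=
        mul_left_cancel₀ h0.ne' (by linarith)
      have h4 : (i : ℕ) = j := Nat.cast_injective (R := ℝ)
        (mul_right_cancel₀ (by linarith : (S.L : ℝ) ≠ 0) h3)
      rw [Fin.ext h4]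
    | top c => exact (cross c i _ _ h0' h0 h.symm).elim
    | _ => exact he'.elim
  | top c =>
    cases e' with
    | start j => exact (cross c j _ _ h0 h0' h).elim
    | top d =>
      simp only [segment, Prod.mk.injEq] at h
      obtain ⟨h1, h2⟩ := h
      have ht : τ = τ' := by linarith
      subst ht
      have h3 : (2 * (c : ℕ) + 3 : ℝ) = 2 * (d : ℕ) + 3 :=
        mul_left_cancel₀ h0.ne' (by linarith)
      have h4 : (c : ℕ) = d := Nat.cast_injective (R := ℝ) (by linarith)
      rw [Fin.ext h4]
    | _ => exact he'.elim
  | _ => exact he.elim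

/-- Inner points of arcs at the sink determine the arc. -/
theorem eq_of_segment_eq_of_atSink {e e' : StripArc S.C S.k S.L} (he : S.AtSink e)
    (he' : S.AtSink e') (h1 : τ < 1) (h1' : τ' < 1)
    (h : S.segment e τ = S.segment e' τ') : e = e' := by
  -- The same comparison of rays, with parameters `1 - a` and `1 - b` measured from the sink.
  have cross : ∀ (c : Fin S.C) (d : Fin (S.C + 1)) (p : Fin (S.k * S.L)) (a b : ℝ),
      ¬ (d : ℕ) < S.C → a < 1 → b < 1 → S.segment (bot c) a ≠ S.segment (leave d p) b := by
    intro c d p a b hd ha hb hab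
    simp only [segment, if_neg hd, Prod.mk.injEq] at hab
    obtain ⟨h1, h2⟩ := hab
    have h3 : ((c : ℕ) : ℝ) + 1 ≤ S.C := by exact_mod_cast c.isLt
    have h4 : ((p : ℕ) : ℝ) + 1 ≤ S.k * S.L := by exact_mod_cast p.isLt
    have h5 : 3 * (1 - b) ≥ 5 * (1 - a) := by nlinarith
    have h6 : 2 * (1 - a) ≥ 3 * (1 - b) := by nlinarith
    linarith
  have fin_eq : ∀ c d : Fin (S.C + 1), ¬ (c : ℕ) < S.C → ¬ (d : ℕ) < S.C → c = d := by
    intro c d hc hd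
    exact Fin.ext (by omega)
  cases e with
  | bot c =>
    cases e' with
    | bot d =>
      simp only [segment, Prod.mk.injEq] at h
      obtain ⟨h2, h3⟩ := h
      have ht : τ = τ' := by linarith
      subst ht
      have h4 : ((c : ℕ) : ℝ) = (d : ℕ) :=
        mul_left_cancel₀ (by linarith : (1 - τ) ≠ 0) (by linarith)
      rw [Fin.ext (Nat.cast_injective h4)]
    | leave d p => exact (cross c d p _ _ he' h1 h1' h).elim
    | _ => exact he'.elim
  | leave c p =>
    cases e' with
    | bot d => exact (cross d c p _ _ he h1' h1 h.symm).elim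
    | leave d q =>
      simp only [segment, if_neg he, if_neg he', Prod.mk.injEq] at h
      obtain ⟨h2, h3⟩ := h
      have ht : τ = τ' := by linarith
      subst ht
      have h4 : ((p : ℕ) : ℝ) = (q : ℕ) :=
        mul_left_cancel₀ (by linarith : (1 - τ) ≠ 0) (by linarith)
      rw [Fin.ext (Nat.cast_injective h4), fin_eq c d he he']
    | _ => exact he'.elim
  | _ => exact he.elim

/-- The integral part of the first coordinate of an inner point of an arc inside the grid. -/
def xFloor : StripArc S.C S.k S.L → ℕ
  | vert c _ => 2 * c + 1
  | enter c _ => 2 * c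
  | leave c _ => 2 * c + 1
  | _ => 0

/-- The fractional part of the first coordinate of an inner point of an arc inside the grid. -/
def xFract : StripArc S.C S.k S.L → ℝ → ℝ
  | enter _ _, τ => τ
  | leave _ _, τ => τ
  | _, _ => 0

theorem segment_fst {e : StripArc S.C S.k S.L} (hs : ¬ S.AtSource e) (ht : ¬ S.AtSink e) (τ : ℝ) :
    (S.segment e τ).1 = (xFloor e : ℕ) + xFract e τ := by
  cases e with
  | start i => exact (hs trivial).elim
  | top c => exact (hs trivial).elim
  | bot c => exact (ht trivial).elim
  | vert c p => simp [segment, xFloor, xFract]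
  | enter c p => simp [segment, xFloor, xFract]
  | leave c p => simp only [segment, if_pos (not_not.1 ht), xFloor, xFract]; push_cast; rfl

theorem xFract_nonneg (e : StripArc S.C S.k S.L) (h0 : 0 ≤ τ) : 0 ≤ xFract e τ := by
  cases e <;> simp [xFract, h0]

theorem xFract_lt (e : StripArc S.C S.k S.L) (h1 : τ < 1) : xFract e τ < 1 := by
  cases e <;> simp [xFract, h1]

/-- The integral part of the first coordinate gives the column and tells entering from leaving arcs;
the fractional part vanishes only on vertical arcs. Within one kind and column the height decides,
by `fan_injective` for the fans. -/
theorem eq_of_segment_eq_of_grid {e e' : StripArc S.C S.k S.L} (hs : ¬ S.AtSource e)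
    (ht : ¬ S.AtSink e) (hs' : ¬ S.AtSource e') (ht' : ¬ S.AtSink e') (h0 : 0 < τ) (h1 : τ < 1)
    (h0' : 0 < τ') (h1' : τ' < 1) (h : S.segment e τ = S.segment e' τ') : e = e' := by
  have hx := congrArg Prod.fst h
  have hy := congrArg Prod.snd h
  rw [segment_fst hs ht, segment_fst hs' ht'] at hx
  obtain ⟨hx1, hx2⟩ := nat_eq_of_add_eq (xFract_nonneg e h0.le) (xFract_lt e h1)
    (xFract_nonneg e' h0'.le) (xFract_lt e' h1') hx
  cases e with
  | start i => exact (hs trivial).elim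
  | top c => exact (hs trivial).elim
  | bot c => exact (ht trivial).elim
  | vert c p =>
    cases e' with
    | start i => exact (hs' trivial).elim
    | top c => exact (hs' trivial).elim
    | bot c => exact (ht' trivial).elim
    | vert d q =>
      simp only [xFloor] at hx1
      simp only [segment] at hy
      have h3 := nat_eq_of_add_eq h0.le h1 h0'.le h1'
        (by linarith : ((p : ℕ) : ℝ) + τ = (q : ℕ) + τ')
      rw [Fin.ext (by omega : (c : ℕ) = d), Fin.ext h3.1]
    | enter d q => exact absurd hx2 h0'.ne
    | leave d q => exact absurd hx2 h0'.ne
  | enter c p =>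
    cases e' with
    | start i => exact (hs' trivial).elim
    | top c => exact (hs' trivial).elim
    | bot c => exact (ht' trivial).elim
    | vert d q => exact absurd hx2 h0.ne'
    | enter d q =>
      simp only [xFloor] at hx1
      simp only [xFract] at hx2
      subst hx2
      simp only [segment] at hy
      rw [Fin.ext (by omega : (c : ℕ) = d), fan_injective h0 h1 (neg_injective hy)]
    | leave d q => simp only [xFloor] at hx1; omega
  | leave c p =>
    cases e' with
    | start i => exact (hs' trivial).elim
    | top c => exact (hs' trivial).elim
    | bot c => exact (ht' trivial).elim
    | vert d q => exact absurd hx2 h0.ne'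
    | enter d q => simp only [xFloor] at hx1; omega
    | leave d q =>
      simp only [xFloor] at hx1
      simp only [xFract] at hx2
      subst hx2
      simp only [segment, if_pos (not_not.1 ht), if_pos (not_not.1 ht')] at hy
      rw [Fin.ext (by omega : (c : ℕ) = d),
        fan_injective (by linarith) (by linarith) (neg_injective hy)]

theorem eq_of_segment_eq {e e' : StripArc S.C S.k S.L} (h0 : 0 < τ) (h1 : τ < 1)
    (h0' : 0 < τ') (h1' : τ' < 1) (h : S.segment e τ = S.segment e' τ') : e = e' := by
  have sep : ∀ (e e' : StripArc S.C S.k S.L) (a b : ℝ), 0 < a → a < 1 → 0 < b → b < 1 →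
      S.segment e a = S.segment e' b → S.AtSource e → S.AtSource e' := by
    intro e e' a b ha ha' hb hb' hab hs
    by_contra hs'
    have := (segment_atSource hs ha ha').1
    have := segment_not_atSource hs' hb hb'
    rw [← hab] at this
    rcases ‹_ ∨ _› with h | h <;> linarith
  have sep' : ∀ (e e' : StripArc S.C S.k S.L) (a b : ℝ), 0 < a → 0 < b → b < 1 →
      S.segment e a = S.segment e' b → ¬ S.AtSource e' → S.AtSink e → S.AtSink e' := by
    intro e e' a b ha hb hb' hab hs ht
    by_contra ht'
    have := segment_atSink ht ha
    have := segment_not_atSink ht' hs hb hb'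
    rw [← hab] at this
    rcases ‹_ ∨ _› with h | h <;> linarith
  by_cases hs : S.AtSource e
  · exact eq_of_segment_eq_of_atSource hs (sep _ _ _ _ h0 h1 h0' h1' h hs) h0 h0' h
  have hs' : ¬ S.AtSource e' := fun hs' => hs (sep _ _ _ _ h0' h1' h0 h1 h.symm hs')
  by_cases ht : S.AtSink e
  · exact eq_of_segment_eq_of_atSink ht (sep' _ _ _ _ h0 h0' h1' h hs' ht) h1 h1' h
  have ht' : ¬ S.AtSink e' := fun ht' => ht (sep' _ _ _ _ h0' h0 h1 h.symm hs ht')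
  exact eq_of_segment_eq_of_grid hs ht hs' ht' h0 h1 h0' h1' h

/-- Gates and middle vertices have integral abscissae, so inside the box only a vertical arc could
pass through one, and its inner points have nonintegral heights. -/
theorem segment_ne_pos (e : StripArc S.C S.k S.L) (v : StripVertex S.C S.k S.L) (h0 : 0 < τ)
    (h1 : τ < 1) : S.segment e τ ≠ S.pos v := by
  intro h
  have hC : (0 : ℝ) ≤ S.C := by positivity
  have outer : (v = source ∨ v = sink) → False := by
    intro hv
    by_cases hs : S.AtSource e
    · have := (segment_atSource hs h0 h1).2
      rw [h] at this
      rcases hv with rfl | rfl <;> simp only [pos] at this <;> linarith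
    · have := segment_not_atSource hs h0 h1
      rw [h] at this
      rcases hv with rfl | rfl <;> simp only [pos] at this <;> linarith
  have inner : (0 ≤ (S.pos v).1 ∧ (S.pos v).2 ≤ -1) → ((S.pos v).1 ≤ 2 * S.C + 1 ∧
      -(S.k * S.L + 1) ≤ (S.pos v).2) → ¬ S.AtSource e ∧ ¬ S.AtSink e := by
    intro hv hv'
    rw [← h] at hv hv'
    constructor
    · intro hs
      have := (segment_atSource hs h0 h1).1
      rcases this with h | h <;> linarith
    · intro ht
      have := segment_atSink ht h0
      rcases this with h | h <;> linarith
  cases v with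
  | source => exact outer (Or.inl rfl)
  | sink => exact outer (Or.inr rfl)
  | gate c i =>
    have h2 : ((c : ℕ) : ℝ) ≤ S.C := by exact_mod_cast Nat.lt_succ_iff.1 c.isLt
    have h3 : ((i : ℕ) : ℝ) + 1 ≤ S.k := by exact_mod_cast i.isLt
    have h4 : (0 : ℝ) ≤ (i : ℕ) * S.L := by positivity
    have h5 : (1 : ℝ) ≤ S.L := by exact_mod_cast S.L_pos
    obtain ⟨hs, ht⟩ := inner ⟨by simp only [pos]; positivity, by simp only [pos]; linarith⟩
      ⟨by simp only [pos]; linarith, by simp only [pos]; nlinarith⟩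
    have hx := congrArg Prod.fst h
    rw [segment_fst hs ht, pos] at hx
    have e2 := nat_eq_of_add_eq (xFract_nonneg e h0.le) (xFract_lt e h1) le_rfl one_pos
      (by push_cast; simpa using hx : ((xFloor e : ℕ) : ℝ) + xFract e τ = (2 * (c : ℕ) : ℕ) + 0)
    cases e with
    | start i => exact (hs trivial).elim
    | top c => exact (hs trivial).elim
    | bot c => exact (ht trivial).elim
    | vert d q => simp only [xFloor] at e2; omega
    | enter d q => exact h0.ne' e2.2
    | leave d q => exact h0.ne' e2.2
  | mid c p =>
    have h2 : ((c : ℕ) : ℝ) ≤ S.C := by exact_mod_cast Nat.lt_succ_iff.1 c.isLt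
    have h3 : ((p : ℕ) : ℝ) ≤ S.k * S.L := by exact_mod_cast Nat.lt_succ_iff.1 p.isLt
    have h4 : (0 : ℝ) ≤ (p : ℕ) := by positivity
    obtain ⟨hs, ht⟩ := inner ⟨by simp only [pos]; positivity, by simp only [pos]; linarith⟩
      ⟨by simp only [pos]; linarith, by simp only [pos]; linarith⟩
    have hx := congrArg Prod.fst h
    have hy := congrArg Prod.snd h
    rw [segment_fst hs ht, pos] at hx
    have e2 := nat_eq_of_add_eq (xFract_nonneg e h0.le) (xFract_lt e h1) le_rfl one_pos
      (by push_cast; simpa using hx :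
        ((xFloor e : ℕ) : ℝ) + xFract e τ = (2 * (c : ℕ) + 1 : ℕ) + 0)
    cases e with
    | start i => exact (hs trivial).elim
    | top c => exact (hs trivial).elim
    | bot c => exact (ht trivial).elim
    | vert d q =>
      simp only [segment, pos] at hy
      have e3 := nat_eq_of_add_eq h0.le h1 le_rfl one_pos
        (by linarith : ((q : ℕ) : ℝ) + τ = (p : ℕ) + 0)
      exact h0.ne' e3.2
    | enter d q => exact h0.ne' e2.2
    | leave d q => exact h0.ne' e2.2

theorem segment_injective (e : StripArc S.C S.k S.L) : Function.Injective (S.segment e) := by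
  intro a b h
  cases e with
  | start i => simp only [segment, Prod.mk.injEq] at h; linarith [h.1]
  | top c => simp only [segment, Prod.mk.injEq] at h; linarith [h.2]
  | bot c => simp only [segment, Prod.mk.injEq] at h; linarith [h.2]
  | vert c p => simp only [segment, Prod.mk.injEq] at h; linarith [h.2]
  | enter c p => simp only [segment, Prod.mk.injEq] at h; linarith [h.1]
  | leave c p =>
    simp only [segment] at h
    split_ifs at h <;> rw [Prod.mk.injEq] at h <;> linarith [h.1]

theorem segment_continuous (e : StripArc S.C S.k S.L) : Continuous (S.segment e) := by
  change Continuous fun τ => S.segment e τ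
  cases e with
  | leave c p => simp only [segment]; split_ifs <;> fun_prop
  | _ => simp only [segment]; fun_prop

/-- Whether an arc leads from right to left or from bottom to top. -/
def reversed : StripArc S.C S.k S.L → Bool
  | top c => (S.col c).restore
  | _ => false

theorem segment_zero (e : StripArc S.C S.k S.L) :
    S.segment e 0 = S.pos (if reversed e then S.tgt e else S.src e) := by
  cases e with
  | top c => simp only [reversed, src, tgt]; split_ifs <;> simp [segment, pos]
  | leave c p =>
    simp only [reversed, segment, src, pos, Bool.false_eq_true, if_false]
    have := position_eq p
    have hc := c.isLt
    split_ifs with h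
    · simp [this]; ring
    · have : (c : ℕ) = S.C := by omega
      simp [this]
  | enter c p => simp [reversed, segment, src, pos]
  | _ => simp [reversed, segment, src, pos]

theorem segment_one (e : StripArc S.C S.k S.L) :
    S.segment e 1 = S.pos (if reversed e then S.src e else S.tgt e) := by
  cases e with
  | top c => simp only [reversed, src, tgt]; split_ifs <;> simp [segment, pos] <;> ring_nf <;> simp
  | leave c p =>
    simp only [reversed, segment, tgt, Bool.false_eq_true, if_false]
    split_ifs with h
    · simp [pos]; ring
    · simp only [pos, Prod.mk.injEq]; constructor <;> ring
  | enter c p =>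
    have := position_eq p
    simp [reversed, segment, tgt, pos, this]; ring
  | start i => simp only [reversed, segment, tgt, pos, Bool.false_eq_true, if_false,
      Prod.mk.injEq]; constructor <;> simp <;> ring
  | bot c => simp only [reversed, segment, tgt, pos, Bool.false_eq_true, if_false,
      Prod.mk.injEq]; constructor <;> ring
  | vert c p => simp only [reversed, segment, tgt, pos, Bool.false_eq_true, if_false,
      Prod.mk.injEq]; constructor <;> simp <;> ring

variable (S) in
/-- Strip networks are planar. -/
theorem isPlanar_network : S.network.IsPlanar := by
  -- Segments are oriented to the right or downwards; a reversed arc runs through its segment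
  -- backwards.
  let r (e : StripArc S.C S.k S.L) (x : ℝ) : ℝ := if reversed e then 1 - x else x
  have r_unit : ∀ e (x : unitInterval), ¬ (x = 0 ∨ x = 1) → 0 < r e x ∧ r e x < 1 := by
    intro e x hx
    have h0 : (0 : ℝ) < x := lt_of_le_of_ne x.2.1 fun h => hx (Or.inl (Subtype.ext h.symm))
    have h1 : (x : ℝ) < 1 := lt_of_le_of_ne x.2.2 fun h => hx (Or.inr (Subtype.ext h))
    simp only [r]
    split_ifs <;> constructor <;> linarith
  have hpts : ∀ e (x : unitInterval) v, S.segment e (r e x) = S.pos v → x = 0 ∨ x = 1 := by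
    intro e x v h
    by_contra hx
    exact segment_ne_pos e v (r_unit e x hx).1 (r_unit e x hx).2 h
  have hends : ∀ e (x : unitInterval), x = 0 ∨ x = 1 → ∃ v, S.segment e (r e x) = S.pos v := by
    intro e x hx
    simp only [r]
    rcases hx with rfl | rfl <;> split_ifs <;>
      simp only [Set.Icc.coe_zero, Set.Icc.coe_one, sub_zero, sub_self, segment_zero,
        segment_one] <;> exact ⟨_, rfl⟩
  exact ⟨{
    point := S.pos
    curve := fun e x => S.segment e (r e x)
    point_injective := S.pos_injective
    curve_continuous := fun e => by
      refine (segment_continuous e).comp ?_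
      simp only [r]
      split_ifs <;> fun_prop
    curve_injective := fun e x y h => by
      have := segment_injective e h
      simp only [r] at this
      apply Subtype.ext
      split_ifs at this <;> linarith
    curve_zero := fun e => by
      simp only [r, network]
      split_ifs with h
      · simp [segment_one, h]
      · simp [segment_zero, h]
    curve_one := fun e => by
      simp only [r, network]
      split_ifs with h
      · simp [segment_zero, h]
      · simp [segment_one, h]
    avoids_points := hpts
    avoids_curves := fun e e' hne x y h => by
      by_cases hx : x = 0 ∨ x = 1
      · obtain ⟨v, hv⟩ := hends e x hx
        exact ⟨hx, hpts e' y v (h ▸ hv)⟩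
      · by_cases hy : y = 0 ∨ y = 1
        · obtain ⟨v, hv⟩ := hends e' y hy
          exact ⟨hpts e x v (h.trans hv), hy⟩
        · exact (hne (eq_of_segment_eq (r_unit e x hx).1 (r_unit e x hx).2 (r_unit e' y hy).1
            (r_unit e' y hy).2 h)).elim }⟩

end StripData

/-! ### Polynomial running times of counter programs -/

namespace CounterState

variable {K : Type} [DecidableEq K]

theorem set_set (s : CounterState K) (r : K) (a b : ℕ) : (s.set r a).set r b = s.set r b := by
  simp [set]

theorem set_self (s : CounterState K) (r : K) : s.set r (s.reg r) = s := by
  simp [set]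

end CounterState

namespace CounterProg

variable {K : Type} [DecidableEq K]

/-- Each written bit costs a step, so a time bound also bounds the output. -/
theorem length_out_eval_le (p : CounterProg K) (s : CounterState K) :
    (p.eval s).out.length ≤ s.out.length + p.cost s := by
  induction p generalizing s with
  | skip | inc | dec | write | readNum => simp [eval, cost]
  | readBit p q ihp ihq =>
    simp only [eval, cost]
    split_ifs
    · have := ihp { s with inp := s.inp.tail }; simp only at this; omega
    · have := ihq { s with inp := s.inp.tail }; simp only at this; omega
  | seq p q ihp ihq =>
    have := ihp s
    have := ihq (p.eval s)
    simp only [eval, cost]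
    omega
  | rep r p ih =>
    have key : ∀ m s, ((p.eval)^[m] s).out.length ≤ s.out.length +
        iterateCost p.eval p.cost m s := by
      intro m
      induction m with
      | zero => intro s; simp [iterateCost]
      | succ m ihm =>
        intro s
        have := ihm (p.eval s)
        have := ih s
        simp only [Function.iterate_succ_apply, iterateCost]
        omega
    have := key (s.reg r) s
    simp only [eval, cost]
    omega
  | ifZero r p q ihp ihq =>
    have := ihp s
    have := ihq s
    simp only [eval, cost]
    split_ifs <;> omega

/-- In the run of the program the values of the counters that control loops and the numbers that
are read are at most `N`. -/
def Bounded (N : ℕ) : CounterProg K → CounterState K → Prop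
  | readNum _, s => (splitUnary s.inp).1 ≤ N
  | readBit p q, s =>
    if s.inp.head? = some true then p.Bounded N { s with inp := s.inp.tail }
    else q.Bounded N { s with inp := s.inp.tail }
  | seq p q, s => p.Bounded N s ∧ q.Bounded N (p.eval s)
  | rep r p, s => s.reg r ≤ N ∧ ∀ j < s.reg r, p.Bounded N ((p.eval)^[j] s)
  | ifZero r p q, s => if s.reg r = 0 then p.Bounded N s else q.Bounded N s
  | _, _ => True

open Polynomial in
/-- A polynomial that bounds the cost in terms of the values of the counters. -/
noncomputable def costPoly : CounterProg K → Polynomial ℕ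
  | skip => 0
  | inc _ | dec _ | write _ => 1
  | readNum _ => X + 1
  | readBit p q => 1 + (p.costPoly + q.costPoly)
  | seq p q => p.costPoly + q.costPoly
  | rep _ p => 3 * (X + 1) + X * p.costPoly
  | ifZero _ p q => 1 + (p.costPoly + q.costPoly)

/-- A loop makes at most `N` iterations and its body obeys the same bound in each of them, so
nesting loops multiplies polynomials that depend only on the program. -/
theorem cost_le (N : ℕ) (p : CounterProg K) (s : CounterState K) (h : p.Bounded N s) :
    p.cost s ≤ p.costPoly.eval N := by
  induction p generalizing s with
  | skip | inc | dec | write => simp [cost, costPoly]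
  | readNum r =>
    simp only [Bounded] at h
    simp [cost, costPoly, h]
  | readBit p q ihp ihq =>
    simp only [Bounded, cost, costPoly, Polynomial.eval_add, Polynomial.eval_one] at h ⊢
    split_ifs at h ⊢
    · have := ihp _ h; omega
    · have := ihq _ h; omega
  | seq p q ihp ihq =>
    simp only [cost, costPoly, Polynomial.eval_add]
    exact Nat.add_le_add (ihp _ h.1) (ihq _ h.2)
  | rep r p ih =>
    have key : ∀ m s, (∀ j < m, p.Bounded N ((p.eval)^[j] s)) →
        iterateCost p.eval p.cost m s ≤ m * p.costPoly.eval N := by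
      intro m
      induction m with
      | zero => intro s _; simp [iterateCost]
      | succ m ihm =>
        intro s hs
        have h1 := ihm (p.eval s) fun j hj => hs (j + 1) (by omega)
        have h2 := ih s (hs 0 (by omega))
        rw [iterateCost, Nat.succ_mul]
        omega
    have h1 := key _ s h.2
    have h2 := Nat.mul_le_mul_right (p.costPoly.eval N) h.1
    have h3 := h.1
    simp only [cost, costPoly, Polynomial.eval_add, Polynomial.eval_mul, Polynomial.eval_X,
      Polynomial.eval_one, Polynomial.eval_ofNat]
    omega
  | ifZero r p q ihp ihq =>
    simp only [Bounded, cost, costPoly, Polynomial.eval_add, Polynomial.eval_one] at h ⊢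
    split_ifs at h ⊢
    · have := ihp _ h; omega
    · have := ihq _ h; omega

/-- The program leads from `s` to `s'`, with loop counters bounded by `N`. -/
structure Runs (N : ℕ) (p : CounterProg K) (s s' : CounterState K) : Prop where
  eval_eq : p.eval s = s'
  bounded : p.Bounded N s

variable {N : ℕ}

theorem Runs.seq {p q : CounterProg K} {s s' s''} (hp : p.Runs N s s') (hq : q.Runs N s' s'') :
    (p.seq q).Runs N s s'' := by
  obtain ⟨rfl, hp2⟩ := hp
  obtain ⟨rfl, hq2⟩ := hq
  exact ⟨rfl, hp2, hq2⟩

/-- `S` serves as loop invariant: `S j` is the exact state after `j` iterations. -/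
theorem Runs.rep {p : CounterProg K} {r : K} {s s' : CounterState K} (S : ℕ → CounterState K)
    (h0 : S 0 = s) (h1 : S (s.reg r) = s') (hr : s.reg r ≤ N)
    (hp : ∀ j < s.reg r, p.Runs N (S j) (S (j + 1))) : (rep r p).Runs N s s' := by
  have key : ∀ j ≤ s.reg r, (p.eval)^[j] s = S j := by
    intro j
    induction j with
    | zero => exact fun _ => h0.symm
    | succ j ih =>
      intro hj
      rw [Function.iterate_succ_apply', ih (by omega), (hp j hj).eval_eq]
  refine ⟨?_, hr, fun j hj => ?_⟩
  · rw [eval, key _ le_rfl, h1]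
  · rw [key j hj.le]
    exact (hp j hj).bounded

theorem Runs.congr {p : CounterProg K} {s s' t t'} (h : p.Runs N s s') (e : s = t) (e' : s' = t') :
    p.Runs N t t' := e ▸ e' ▸ h

/-! ### Derived programs -/

/-- Run programs one after the other. -/
def block (l : List (CounterProg K)) : CounterProg K := l.foldr seq skip

/-- Add a counter to another one. -/
def addTo (d r : K) : CounterProg K := rep r (inc d)

/-- Set a counter to zero. -/
def clear (r : K) : CounterProg K := rep r (dec r)

/-- Subtract a counter from another one. -/
def subFrom (d r : K) : CounterProg K := rep r (dec d)

/-- Write the unary code of the sum of some counters. -/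
def emit (l : List K) : CounterProg K := l.foldr (fun r p => seq (rep r (write true)) p) (write false)

theorem Runs.nil (s : CounterState K) : (block []).Runs N s s := ⟨rfl, trivial⟩

theorem Runs.cons {p : CounterProg K} {l} {s s' s''} (hp : p.Runs N s s')
    (hl : (block l).Runs N s' s'') : (block (p :: l)).Runs N s s'' := hp.seq hl

theorem runs_addTo (d r : K) (s : CounterState K) (h : s.reg r ≤ N) :
    (addTo d r).Runs N s (s.set d (s.reg d + s.reg r)) :=
  Runs.rep (fun j => s.set d (s.reg d + j)) (s.set_self d) rfl h fun j _ =>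
    ⟨by simp [eval, CounterState.set, Nat.add_assoc], trivial⟩

theorem runs_subFrom (d r : K) (s : CounterState K) (h : s.reg r ≤ N) :
    (subFrom d r).Runs N s (s.set d (s.reg d - s.reg r)) :=
  Runs.rep (fun j => s.set d (s.reg d - j)) (s.set_self d) rfl h fun j _ =>
    ⟨by simp [eval, CounterState.set, Nat.sub_sub], trivial⟩

/-- Clearing is the subtraction of a counter from itself, sound because the number of iterations is
fixed on entry. -/
theorem runs_clear (r : K) (s : CounterState K) (h : s.reg r ≤ N) :
    (clear r).Runs N s (s.set r 0) :=
  (runs_subFrom r r s h).congr rfl (by rw [Nat.sub_self])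

theorem runs_emit (l : List K) (s : CounterState K) (h : ∀ r ∈ l, s.reg r ≤ N) :
    (emit l).Runs N s { s with out := s.out ++ unaryCode (l.map s.reg).sum } := by
  induction l generalizing s with
  | nil => exact ⟨by simp [emit, eval, unaryCode], trivial⟩
  | cons r l ih =>
    have h1 : (rep r (write true)).Runs N s
        { s with out := s.out ++ List.replicate (s.reg r) true } :=
      Runs.rep (fun j => { s with out := s.out ++ List.replicate j true }) (by simp) rfl
        (h r (by simp)) fun j _ => ⟨by simp [eval, List.replicate_succ'], trivial⟩
    refine (h1.seq (ih _ fun r' hr' => h r' (by simp [hr']))).congr rfl ?_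
    simp only [unaryCode, List.map_cons, List.sum_cons, List.replicate_add, List.append_assoc]

-- The final state does not depend on the bound, so `N` is chosen large enough. With the `bounded`
-- lemmas below, `simp` can execute straight-line programs.
@[simp] theorem eval_addTo (d r : K) (s : CounterState K) :
    (addTo d r).eval s = s.set d (s.reg d + s.reg r) := (runs_addTo d r s le_rfl).eval_eq

@[simp] theorem eval_subFrom (d r : K) (s : CounterState K) :
    (subFrom d r).eval s = s.set d (s.reg d - s.reg r) := (runs_subFrom d r s le_rfl).eval_eq

@[simp] theorem eval_clear (r : K) (s : CounterState K) :
    (clear r).eval s = s.set r 0 := (runs_clear r s le_rfl).eval_eq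

@[simp] theorem eval_emit (l : List K) (s : CounterState K) :
    (emit l).eval s = { s with out := s.out ++ unaryCode (l.map s.reg).sum } :=
  (runs_emit l s (N := (l.map s.reg).sum) fun r hr =>
    List.single_le_sum (by simp) _ (List.mem_map_of_mem hr)).eval_eq

@[simp] theorem bounded_addTo (d r : K) (s : CounterState K) :
    (addTo d r).Bounded N s ↔ s.reg r ≤ N := ⟨fun h => h.1, fun h => (runs_addTo d r s h).bounded⟩

@[simp] theorem bounded_subFrom (d r : K) (s : CounterState K) :
    (subFrom d r).Bounded N s ↔ s.reg r ≤ N :=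
  ⟨fun h => h.1, fun h => (runs_subFrom d r s h).bounded⟩

@[simp] theorem bounded_clear (r : K) (s : CounterState K) :
    (clear r).Bounded N s ↔ s.reg r ≤ N := ⟨fun h => h.1, fun h => (runs_clear r s h).bounded⟩

@[simp] theorem bounded_emit (l : List K) (s : CounterState K) :
    (emit l).Bounded N s ↔ ∀ r ∈ l, s.reg r ≤ N := by
  refine ⟨fun h => ?_, fun h => (runs_emit l s h).bounded⟩
  induction l generalizing s with
  | nil => simp
  | cons r l ih =>
    have h1 := (runs_emit [r] s (N := s.reg r) (by simp)).eval_eq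
    have h2 : ((rep r (write true)).eval s).reg = s.reg := by
      have := congrArg CounterState.reg h1
      simpa [emit, eval] using this
    have h3 := ih _ h.2
    rw [h2] at h3
    simpa using ⟨h.1.1, h3⟩

theorem runs_readNum (r : K) (s : CounterState K) (a : ℕ) (l : List Bool)
    (h : s.inp = unaryCode a ++ l) (ha : a ≤ N) :
    (readNum r).Runs N s { s.set r (s.reg r + a) with inp := l } := by
  refine ⟨?_, ?_⟩
  · rw [eval, h, splitUnary_unaryCode_append]
  · rw [Bounded, h, splitUnary_unaryCode_append]
    exact ha

theorem runs_ifZero {r : K} {p q : CounterProg K} {s s'}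
    (h0 : s.reg r = 0 → p.Runs N s s') (h1 : s.reg r ≠ 0 → q.Runs N s s') :
    (ifZero r p q).Runs N s s' := by
  by_cases h : s.reg r = 0
  · exact ⟨by rw [eval, if_pos h, (h0 h).eval_eq], by rw [Bounded, if_pos h]; exact (h0 h).bounded⟩
  · exact ⟨by rw [eval, if_neg h, (h1 h).eval_eq], by rw [Bounded, if_neg h]; exact (h1 h).bounded⟩

theorem runs_readBit {p q : CounterProg K} {s s'} {b : Bool} {l : List Bool} (h : s.inp = b :: l)
    (h0 : b = true → p.Runs N { s with inp := l } s')
    (h1 : b = false → q.Runs N { s with inp := l } s') : (readBit p q).Runs N s s' := by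
  cases b with
  | true => exact ⟨by simp [eval, h, (h0 rfl).eval_eq], by simpa [Bounded, h] using (h0 rfl).bounded⟩
  | false => exact ⟨by simp [eval, h, (h1 rfl).eval_eq], by simpa [Bounded, h] using (h1 rfl).bounded⟩

/-- Functions computed by counter programs with polynomially bounded counters are computable in
polynomial time. -/
theorem nonempty_computableInPolyTime_of_runs [Fintype K] {α β : Type} {ea : α → List Bool}
    {eb : β → List Bool} {F : α → β} (p : CounterProg K) (P : Polynomial ℕ)
    (hp : ∀ a, p.Runs (P.eval (ea a).length) ⟨fun _ => 0, ea a, []⟩ ⟨fun _ => 0, [], eb (F a)⟩) :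
    Nonempty (Turing.TM2ComputableInPolyTime ea eb F) := by
  have hcost : ∀ a, p.cost ⟨fun _ => 0, ea a, []⟩ ≤ (p.costPoly.comp P).eval (ea a).length := by
    intro a
    rw [Polynomial.eval_comp]
    exact cost_le _ p _ (hp a).bounded
  refine nonempty_computableInPolyTime p (fun a => (hp a).eval_eq) _ (p.costPoly.comp P) hcost
    fun a => ?_
  have := length_out_eval_le p ⟨fun _ => 0, ea a, []⟩
  rw [(hp a).eval_eq] at this
  simpa using this.trans (Nat.add_le_add_left (hcost a) _)

end CounterProg

/-! ### The encoding of a strip network -/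

namespace List

theorem flatMap_finRange_val {α : Type*} (m : ℕ) (f : ℕ → List α) :
    (finRange m).flatMap (fun i : Fin m => f i.val) = (range m).flatMap f := by
  rw [← List.map_coe_finRange_eq_range, flatMap_map]

theorem flatMap_range_mul {α : Type*} (a b : ℕ) (f : ℕ → List α) :
    (range (a * b)).flatMap f =
      (range a).flatMap fun i => (range b).flatMap fun l => f (i * b + l) := by
  induction a with
  | zero => simp
  | succ a ih =>
    rw [Nat.succ_mul, range_add, flatMap_append, ih, range_succ, flatMap_append, flatMap_map]
    simp

theorem flatMap_congr_mem {α β : Type*} {l : List α} {f g : α → List β}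
    (h : ∀ a ∈ l, f a = g a) : l.flatMap f = l.flatMap g := by
  rw [flatMap_def, flatMap_def, map_congr_left h]

end List

/-- The code of an arc. -/
def arcCode (a b c : ℕ) : List Bool := unaryCode a ++ unaryCode b ++ unaryCode c

namespace StripColumn

/-- The code of the arcs of a column before the last one. The first vertex of the column has
number `B`, the first vertex of the next column number `B + S`. -/
def code (k L B S : ℕ) (col : StripColumn) : List Bool :=
  (if col.restore then arcCode (B + k) 0 col.vcap else arcCode 0 (B + k) col.vcap) ++
    (List.range k).flatMap (fun i => (List.range L).flatMap fun l =>
      arcCode (B + i) (B + k + (i * L + l)) (col.cin i l) ++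
      arcCode (B + k + (i * L + l)) (B + S + i) (col.cout i l) ++
      arcCode (B + k + (i * L + l)) (B + k + (i * L + l) + 1) col.vcap) ++
    arcCode (B + k + k * L) 1 col.vcap

/-- The code of the arcs of the last column. -/
def lastCode (k L B : ℕ) (col : StripColumn) : List Bool :=
  (List.range k).flatMap fun i => (List.range L).flatMap fun l =>
    arcCode (B + i) (B + k + (i * L + l)) (col.cin i l) ++
    arcCode (B + k + (i * L + l)) 1 (col.cout i l)

end StripColumn

namespace StripArc

variable (C k L : ℕ)

/-- The arcs in the order of the output. -/
def list : List (StripArc C k L) :=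
  (List.finRange k).map start ++
    (List.finRange C).flatMap (fun c => [top c] ++
      (List.finRange (k * L)).flatMap
        (fun p => [enter c.castSucc p, leave c.castSucc p, vert c p]) ++ [bot c]) ++
    (List.finRange (k * L)).flatMap fun p => [enter (Fin.last C) p, leave (Fin.last C) p]

theorem mem_list (e : StripArc C k L) : e ∈ list C k L := by
  cases e with
  | enter c p | leave c p => refine Fin.lastCases ?_ (fun c => ?_) c <;> simp [list]
  | _ => simp [list]

theorem length_list : (list C k L).length = k + C * (2 + k * L * 3) + k * L * 2 := by
  simp [list, List.length_flatMap]
  ring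

theorem card_eq : Fintype.card (StripArc C k L) = k + C * (2 + k * L * 3) + k * L * 2 := by
  rw [Fintype.card_congr equivSum]
  simp only [Fintype.card_sum, Fintype.card_prod, Fintype.card_fin]
  ring

/-- The list contains every arc and is as long as the number of arcs. -/
theorem nodup_list : (list C k L).Nodup := by
  have h1 : (list C k L).toFinset = Finset.univ :=
    Finset.eq_univ_iff_forall.2 fun e => List.mem_toFinset.2 (mem_list C k L e)
  have h2 : (list C k L).toFinset.card = (list C k L).length := by
    rw [h1, Finset.card_univ, card_eq, length_list]
  rwa [List.card_toFinset, (List.dedup_sublist _).length_eq, List.dedup_eq_self] at h2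

/-- The numbering of the arcs. -/
def equivFin : Fin (list C k L).length ≃ StripArc C k L :=
  (nodup_list C k L).getEquivOfForallMemList _ (mem_list C k L)

theorem flatMap_equivFin {α : Type*} (f : StripArc C k L → List α) :
    (List.finRange (list C k L).length).flatMap (fun e => f (equivFin C k L e)) =
      (list C k L).flatMap f := by
  conv_rhs => rw [← List.map_get_finRange (list C k L), List.flatMap_map]
  rfl

end StripArc

namespace StripData

open StripArc StripVertex

variable (S : StripData)

theorem target_pos : 0 < S.target :=
  Nat.add_pos_left (Nat.mul_pos S.k_pos S.base_pos) _

/-- The strip network as an instance of All-or-Nothing Flow. -/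
def toInstance : AllOrNothingFlow where
  n := 2 + (S.C + 1) * (S.k + (S.k * S.L + 1))
  m := (StripArc.list S.C S.k S.L).length
  network := S.network.reindex StripVertex.equivFin (StripArc.equivFin S.C S.k S.L).symm
  target := S.target
  target_pos := S.target_pos

/-- Splitting a position as `i * L + l` turns the code into nested loops over plain numbers, the
shape in which a counter program writes it. -/
theorem encode_toInstance : S.toInstance.encode =
    unaryCode (2 + (S.C + 1) * (S.k + (S.k * S.L + 1))) ++
    unaryCode (S.k + S.C * (2 + S.k * S.L * 3) + S.k * S.L * 2) ++ unaryCode 0 ++ unaryCode 1 ++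
    unaryCode S.target ++
    (List.range S.k).flatMap (fun i => arcCode 0 (2 + i) S.base) ++
    (List.range S.C).flatMap (fun c => (S.col c).code S.k S.L
      (2 + c * (S.k + (S.k * S.L + 1))) (S.k + (S.k * S.L + 1))) ++
    (S.col S.C).lastCode S.k S.L (2 + S.C * (S.k + (S.k * S.L + 1))) := by
  have hL := S.L_pos
  have key : (List.finRange S.toInstance.m).flatMap (fun e =>
      unaryCode (S.toInstance.network.src e) ++ unaryCode (S.toInstance.network.tgt e) ++
        unaryCode (S.toInstance.network.cap e)) =
      (StripArc.list S.C S.k S.L).flatMap fun e =>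
        arcCode (StripVertex.equivFin (S.src e)) (StripVertex.equivFin (S.tgt e)) (S.cap e) := by
    rw [← StripArc.flatMap_equivFin]
    rfl
  rw [AllOrNothingFlow.encode, key]
  simp only [List.append_assoc]
  refine congrArg₂ _ rfl (congrArg₂ _ (congrArg _ (length_list _ _ _)) (congrArg₂ _ rfl (congrArg₂ _ rfl (congrArg₂ _ rfl ?_))))
  have pos : ∀ (f : ℕ → ℕ → ℕ → List Bool),
      (List.finRange (S.k * S.L)).flatMap (fun p : Fin (S.k * S.L) => f p.divNat.val p.modNat.val p.val) =
      (List.range S.k).flatMap fun i => (List.range S.L).flatMap fun l => f i l (i * S.L + l) := by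
    intro f
    refine (List.flatMap_finRange_val _ fun p => f (p / S.L) (p % S.L) p).trans ?_
    rw [List.flatMap_range_mul]
    refine List.flatMap_congr_mem fun i _ => List.flatMap_congr_mem fun l hl => ?_
    have hl := List.mem_range.1 hl
    rw [Nat.mul_comm i, Nat.mul_add_div hL, Nat.div_eq_of_lt hl, Nat.add_zero, Nat.mul_add_mod,
      Nat.mod_eq_of_lt hl]
  rw [StripArc.list, List.flatMap_append, List.flatMap_append, List.append_assoc]
  refine congrArg₂ _ ?_ (congrArg₂ _ ?_ ?_)
  · rw [List.flatMap_map]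
    refine Eq.trans ?_ (List.flatMap_finRange_val _ _)
    refine List.flatMap_congr_mem fun i _ => ?_
    simp [src, tgt, cap, equivFin_gate]
  · rw [List.flatMap_assoc]
    refine Eq.trans ?_ (List.flatMap_finRange_val _ _)
    refine List.flatMap_congr_mem fun c _ => ?_
    rw [List.flatMap_append, List.flatMap_append, StripColumn.code]
    refine congrArg₂ _ (congrArg₂ _ ?_ ?_) ?_
    · by_cases h : (S.col c).restore
      · simp [src, tgt, cap, equivFin_mid, h]
      · simp [src, tgt, cap, equivFin_mid, h]
    · rw [List.flatMap_assoc]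
      refine Eq.trans ?_ (pos fun i l p => _)
      refine List.flatMap_congr_mem fun p _ => ?_
      simp [src, tgt, cap, capIn, capOut, equivFin_mid, equivFin_gate, Nat.succ_mul, Nat.div_add_mod']
      simp only [add_assoc]
    · simp [src, tgt, cap, equivFin_mid]
  · rw [List.flatMap_assoc]
    refine Eq.trans ?_ (pos fun i l p => _)
    refine List.flatMap_congr_mem fun p _ => ?_
    simp [src, tgt, cap, capIn, capOut, equivFin_mid, equivFin_gate, Nat.div_add_mod']

end StripData

/-! ### The counter program of the reduction -/

namespace CliqueStrip

open CounterProg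

/-- The counters of the program. The counters `n`, `k`, `L`, `S`, `C`, `A`, `kL`, `one` hold the
parameters of the strip network, `B` the number of the first vertex of the current column, `X` and
`Y` the current vertices of the graph plus one, `P` the class of the former, `w` whether the two
are not adjacent, `q` the vertical capacity, `i`, `l`, `p` the current row, label and position,
`ci` and `co` the excess of the capacities in the row, and `t` and `v` are auxiliary. -/
inductive Counter
  | n | k | L | S | C | A | kL | one | B | X | Y | P | w | q | i | l | p | ci | co | t | v
  deriving DecidableEq

instance : Fintype Counter :=
  Fintype.ofList [.n, .k, .L, .S, .C, .A, .kL, .one, .B, .X, .Y, .P, .w, .q, .i, .l, .p, .ci, .co,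
    .t, .v] fun r => by cases r <;> simp

/-- Change the current row, label and position, and the output. -/
def place (s : CounterState Counter) (i l p : ℕ) (o : List Bool) : CounterState Counter :=
  { ((s.set .i i).set .l l).set .p p with out := o }

/-- Run a program in all rows and for all labels. -/
def grid (body : CounterProg Counter) : CounterProg Counter :=
  block [rep .k (block [rep .L body, clear .l, inc .i]), clear .i]

variable {N : ℕ}

/-- The body itself advances `l` and `p`. The counter `p` is not reset between rows, so it equals `i
* L + l` without any multiplication. -/
theorem runs_grid {body : CounterProg Counter} {s : CounterState Counter} (hN : ∀ r, s.reg r ≤ N)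
    (hi : s.reg .i = 0) (hl : s.reg .l = 0) (hp : s.reg .p = 0) (g : ℕ → ℕ → List Bool)
    (h : ∀ i < s.reg .k, ∀ l < s.reg .L, ∀ o, body.Runs N
      (place s i l (i * s.reg .L + l) o)
      (place s i (l + 1) (i * s.reg .L + l + 1) (o ++ g i l))) :
    (grid body).Runs N s (place s 0 0 (s.reg .k * s.reg .L)
      (s.out ++ (List.range (s.reg .k)).flatMap fun i => (List.range (s.reg .L)).flatMap (g i))) := by
  refine Runs.cons (s' := place s (s.reg .k) 0 (s.reg .k * s.reg .L) (s.out ++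
    (List.range (s.reg .k)).flatMap fun i => (List.range (s.reg .L)).flatMap (g i))) ?_ ?_
  · refine Runs.rep (fun j => place s j 0 (j * s.reg .L) (s.out ++
      (List.range j).flatMap fun i => (List.range (s.reg .L)).flatMap (g i))) ?_ rfl (hN _) ?_
    · refine CounterState.ext (funext fun r => ?_) rfl (by simp [place])
      cases r <;> simp [place, hi, hl, hp]
    · intro i hik
      refine Runs.cons (Runs.rep (fun j => place s i j (i * s.reg .L + j) (s.out ++
        ((List.range i).flatMap fun i => (List.range (s.reg .L)).flatMap (g i)) ++
        (List.range j).flatMap (g i))) (by simp) rfl ?_ ?_) ?_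
      · simpa [place] using hN _
      · intro l hl
        refine (h i hik l (by simpa [place] using hl) _).congr rfl ?_
        rw [List.range_succ, List.flatMap_append]
        simp [Nat.add_assoc]
      · refine ⟨CounterState.ext (funext fun r => ?_) ?_ ?_, ?_⟩
        · cases r <;> simp [block, eval, place, Nat.succ_mul]
        · simp [block, eval, place]
        · simp [block, eval, place, List.range_succ]
        · have := hN .L
          simpa [block, Bounded, place]
  · refine ⟨CounterState.ext (funext fun r => ?_) ?_ ?_, ?_⟩
    · cases r <;> simp [block, eval, place]
    · simp [block, eval, place]
    · simp [block, eval, place]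
    · simpa [block, Bounded, place] using hN .k

/-- Write the arcs at a position. The program `pre` computes the capacities. -/
def columnBody (pre : CounterProg Counter) : CounterProg Counter :=
  block [pre, emit [.B, .i], emit [.B, .k, .p], emit [.A, .ci],
    emit [.B, .k, .p], emit [.B, .S, .i], emit [.A, .co],
    emit [.B, .k, .p], emit [.B, .k, .p, .one], emit [.q],
    clear .ci, clear .co, inc .p, inc .l]

/-- Write the arcs at a position of the last column. -/
def lastColumnBody (pre : CounterProg Counter) : CounterProg Counter :=
  block [pre, emit [.B, .i], emit [.B, .k, .p], emit [.A, .ci],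
    emit [.B, .k, .p], emit [.one], emit [.A, .co],
    clear .ci, clear .co, inc .p, inc .l]

/-- Write a column and go to the next one. -/
def columnProg (pre : CounterProg Counter) (b : Bool) : CounterProg Counter :=
  block [if b then block [emit [.B, .k], emit []] else block [emit [], emit [.B, .k]],
    emit [.q], grid (columnBody pre), emit [.B, .k, .p], emit [.one], emit [.q], clear .p,
    addTo .B .S]

/-- The excess capacities are computed by `pre`. -/
def Computes (N : ℕ) (s : CounterState Counter) (pre : CounterProg Counter)
    (u v : ℕ → ℕ → ℕ) : Prop :=
  ∀ i < s.reg .k, ∀ l < s.reg .L, ∀ p o, u i l ≤ N ∧ v i l ≤ N ∧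
    pre.Runs N (place s i l p o) (((place s i l p o).set .ci (u i l)).set .co (v i l))

theorem Computes.congr {s pre u v} (h : Computes N s pre u v) {s' : CounterState Counter}
    (hs : s'.inp = s.inp) (hr : s'.reg = s.reg) : Computes N s' pre u v := by
  have : ∀ i l p o, place s' i l p o = place s i l p o := fun i l p o =>
    CounterState.ext (by simp [place, CounterState.set, hr]) (by simp [place, hs]) rfl
  unfold Computes
  simp only [this, hr]
  exact h

/-- The state before the run of a column program. -/
structure Ready (N : ℕ) (s : CounterState Counter) : Prop where
  le : ∀ r, s.reg r ≤ N
  mul_le : s.reg .k * s.reg .L ≤ N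
  i_eq : s.reg .i = 0
  l_eq : s.reg .l = 0
  p_eq : s.reg .p = 0
  ci_eq : s.reg .ci = 0
  co_eq : s.reg .co = 0
  one_eq : s.reg .one = 1

section

variable {s : CounterState Counter} {u v : ℕ → ℕ → ℕ} {pre : CounterProg Counter}

theorem runs_columnBody (hs : Ready N s) (hpre : Computes N s pre u v) {i l : ℕ} (hik : i < s.reg .k) (hlL : l < s.reg .L) (o : List Bool) :
    (columnBody pre).Runs N (place s i l (i * s.reg .L + l) o)
      (place s i (l + 1) (i * s.reg .L + l + 1) (o ++
        (arcCode (s.reg .B + i) (s.reg .B + s.reg .k + (i * s.reg .L + l)) (s.reg .A + u i l) ++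
        arcCode (s.reg .B + s.reg .k + (i * s.reg .L + l)) (s.reg .B + s.reg .S + i)
          (s.reg .A + v i l) ++
        arcCode (s.reg .B + s.reg .k + (i * s.reg .L + l))
          (s.reg .B + s.reg .k + (i * s.reg .L + l) + 1) (s.reg .q)))) := by
  obtain ⟨hN, hkL, hi0, hl0, hp0, hci, hco, h1⟩ := hs
  obtain ⟨hu, hv, h⟩ := hpre i hik l hlL (i * s.reg .L + l) o
  have hp : i * s.reg .L + l ≤ N := by nlinarith
  have hi : i ≤ N := hik.le.trans (hN _)
  refine Runs.cons h ⟨CounterState.ext (funext fun r => ?_) ?_ ?_, ?_⟩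
  · cases r <;> simp [block, eval, place, hci, hco]
  · simp [block, eval, place]
  · simp [block, eval, place, arcCode, h1, Nat.add_assoc]
  · simp [block, Bounded, place, Function.update_apply, hN, hp, hu, hv, hi]

theorem runs_lastColumnBody (hs : Ready N s) (hpre : Computes N s pre u v) {i l : ℕ} (hik : i < s.reg .k) (hlL : l < s.reg .L) (o : List Bool) :
    (lastColumnBody pre).Runs N (place s i l (i * s.reg .L + l) o)
      (place s i (l + 1) (i * s.reg .L + l + 1) (o ++
        (arcCode (s.reg .B + i) (s.reg .B + s.reg .k + (i * s.reg .L + l)) (s.reg .A + u i l) ++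
        arcCode (s.reg .B + s.reg .k + (i * s.reg .L + l)) 1 (s.reg .A + v i l)))) := by
  obtain ⟨hN, hkL, hi0, hl0, hp0, hci, hco, h1⟩ := hs
  obtain ⟨hu, hv, h⟩ := hpre i hik l hlL (i * s.reg .L + l) o
  have hp : i * s.reg .L + l ≤ N := by nlinarith
  have hi : i ≤ N := hik.le.trans (hN _)
  refine Runs.cons h ⟨CounterState.ext (funext fun r => ?_) ?_ ?_, ?_⟩
  · cases r <;> simp [block, eval, place, hci, hco]
  · simp [block, eval, place]
  · simp [block, eval, place, arcCode, h1, Nat.add_assoc]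
  · simp [block, Bounded, place, Function.update_apply, hN, hp, hu, hv, hi]

theorem runs_columnProg (hs : Ready N s) (hpre : Computes N s pre u v) {b : Bool} {col : StripColumn} (hb : col.restore = b)
    (hq : s.reg .q = col.vcap)
    (hcin : ∀ i < s.reg .k, ∀ l < s.reg .L, s.reg .A + u i l = col.cin i l)
    (hcout : ∀ i < s.reg .k, ∀ l < s.reg .L, s.reg .A + v i l = col.cout i l) :
    (columnProg pre b).Runs N s { s.set .B (s.reg .B + s.reg .S) with
      out := s.out ++ col.code (s.reg .k) (s.reg .L) (s.reg .B) (s.reg .S) } := by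
  obtain ⟨hN, hkL, hi, hl, hp, hci, hco, h1⟩ := hs
  have h0 : (if b then block [emit [.B, .k], emit []] else block [emit [], emit [.B, .k]]).Runs N s
      { s with out := s.out ++ if col.restore then unaryCode (s.reg .B + s.reg .k) ++ unaryCode 0
        else unaryCode 0 ++ unaryCode (s.reg .B + s.reg .k) } := by
    rw [hb]
    cases b <;>
    exact ⟨by simp [block, eval], by simp [block, Bounded, hN]⟩
  generalize ho : (s.out ++ if col.restore then unaryCode (s.reg .B + s.reg .k) ++ unaryCode 0
        else unaryCode 0 ++ unaryCode (s.reg .B + s.reg .k)) = o0 at h0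
  refine Runs.cons h0 (Runs.cons (s' := { s with out := o0 ++ unaryCode (s.reg .q) })
    ⟨by simp, by simp [hN]⟩ (Runs.cons (runs_grid
    (s := { s with out := o0 ++ unaryCode (s.reg .q) }) hN hi hl hp
    (fun i l => arcCode (s.reg .B + i) (s.reg .B + s.reg .k + (i * s.reg .L + l)) (col.cin i l) ++
        arcCode (s.reg .B + s.reg .k + (i * s.reg .L + l)) (s.reg .B + s.reg .S + i)
          (col.cout i l) ++
        arcCode (s.reg .B + s.reg .k + (i * s.reg .L + l))
          (s.reg .B + s.reg .k + (i * s.reg .L + l) + 1) col.vcap) ?_) ?_))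
  · intro i hik l hlL o
    rw [← hcin i hik l hlL, ← hcout i hik l hlL, ← hq]
    exact runs_columnBody (s := { s with out := _ }) ⟨hN, hkL, hi, hl, hp, hci, hco, h1⟩
      (hpre.congr (by rfl) (by rfl)) hik hlL o
  · refine ⟨CounterState.ext (funext fun r => ?_) ?_ ?_, ?_⟩
    · cases r <;> simp [block, eval, place, hi, hl, hp]
    · simp [block, eval, place]
    · rw [← ho, StripColumn.code]
      split_ifs <;> simp [block, eval, place, arcCode, hq, h1, Nat.add_assoc]
    · simp [block, Bounded, place, Function.update_apply, hN, hkL]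

theorem runs_lastColumn (hs : Ready N s) (hpre : Computes N s pre u v) {col : StripColumn}
    (hcin : ∀ i < s.reg .k, ∀ l < s.reg .L, s.reg .A + u i l = col.cin i l)
    (hcout : ∀ i < s.reg .k, ∀ l < s.reg .L, s.reg .A + v i l = col.cout i l) :
    (grid (lastColumnBody pre)).Runs N s { s.set .p (s.reg .k * s.reg .L) with
      out := s.out ++ col.lastCode (s.reg .k) (s.reg .L) (s.reg .B) } := by
  refine (runs_grid hs.le hs.i_eq hs.l_eq hs.p_eq
    (fun i l => arcCode (s.reg .B + i) (s.reg .B + s.reg .k + (i * s.reg .L + l)) (col.cin i l) ++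
        arcCode (s.reg .B + s.reg .k + (i * s.reg .L + l)) 1 (col.cout i l)) ?_).congr rfl ?_
  · intro i hik l hlL o
    rw [← hcin i hik l hlL, ← hcout i hik l hlL]
    exact runs_lastColumnBody hs hpre hik hlL o
  · refine CounterState.ext (funext fun r => ?_) rfl rfl
    cases r <;> simp [place, hs.i_eq, hs.l_eq]

end

end CliqueStrip

/-! ### Programs for the capacities in a column -/

namespace CliqueStrip

open CounterProg

variable {N : ℕ}

/-- Add the distance of two counters to `t`. -/
def addDist (a b : Counter) : CounterProg Counter :=
  block [addTo .v a, subFrom .v b, addTo .t .v, clear .v,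
    addTo .v b, subFrom .v a, addTo .t .v, clear .v]

/-- With truncated subtraction one of the two differences is zero and their sum is the distance,
which vanishes exactly when the counters agree. Two distances accumulated in `t` test a conjunction.
-/
theorem runs_addDist {a b : Counter} {s : CounterState Counter} (hat : a ≠ .t) (hav : a ≠ .v)
    (hbt : b ≠ .t) (hbv : b ≠ .v) (hv : s.reg .v = 0) (ha : s.reg a ≤ N) (hb : s.reg b ≤ N) :
    (addDist a b).Runs N s
      (s.set .t (s.reg .t + ((s.reg a - s.reg b) + (s.reg b - s.reg a)))) := by
  refine ⟨CounterState.ext (funext fun r => ?_) ?_ ?_, ?_⟩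
  · by_cases hrt : r = .t
    · subst hrt
      simp [addDist, block, eval, hat, hav, hbt, hbv, hv, Nat.add_assoc]
    · by_cases hrv : r = .v
      · subst hrv
        simp [addDist, block, eval, hv]
      · simp [addDist, block, eval, hrt, hrv]
  · simp [addDist, block, eval]
  · simp [addDist, block, eval]
  · simp [addDist, block, Bounded, hat, hav, hbt, hbv, hv, ha, hb]
    omega

/-- Computes the capacities in the columns for the selection of a vertex. -/
def selectPre : CounterProg Counter :=
  block [addDist .i .P, addDist .l .X, ifZero .t skip (block [addTo .ci .l, addTo .ci .l]),
    addTo .co .l, addTo .co .l, clear .t]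

/-- Computes the capacities in the columns for the test of a pair of vertices. -/
def testPre (d : Counter) : CounterProg Counter :=
  block [ifZero .w skip (block [addDist .l .X, ifZero .t (inc d)
      (block [clear .t, addDist .l .Y, ifZero .t (inc d) skip]), clear .t]),
    addTo .ci .l, addTo .ci .l, addTo .co .l, addTo .co .l]

/-- Computes the capacities in the last column. -/
def lastPre : CounterProg Counter :=
  ifZero .l (block [inc .ci, inc .co])
    (block [addTo .ci .l, addTo .ci .l, addTo .co .l, addTo .co .l])

section

variable {s : CounterState Counter} {M : ℕ}

theorem computes_selectPre (hs : Ready N s) (ht : s.reg .t = 0) (hv : s.reg .v = 0)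
    (hM : 2 * M ≤ N) (hk : s.reg .k ≤ M) (hL : s.reg .L ≤ M) (hP : s.reg .P ≤ M)
    (hX : s.reg .X ≤ M) :
    Computes N s selectPre (fun i l => if i = s.reg .P ∧ l = s.reg .X then 0 else 2 * l)
      (fun _ l => 2 * l) := by
  intro i hi l hl p o
  refine ⟨by dsimp only; split_ifs <;> omega, by dsimp only; omega, ?_⟩
  have hci := hs.ci_eq
  have hco := hs.co_eq
  refine Runs.cons (runs_addDist (by simp) (by simp) (by simp) (by simp) (by simpa [place])
    (by simp [place]; omega) (by simp [place]; omega)) (Runs.cons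
    (runs_addDist (by simp) (by simp) (by simp) (by simp) (by simpa [place])
    (by simp [place]; omega) (by simp [place]; omega)) (Runs.cons (s' :=
    ((place s i l p o).set .ci (if i = s.reg .P ∧ l = s.reg .X then 0 else 2 * l)).set .t
      ((i - s.reg .P) + (s.reg .P - i) + ((l - s.reg .X) + (s.reg .X - l))) )
    (runs_ifZero ?_ ?_) ?_))
  · intro h
    have h : i = s.reg .P ∧ l = s.reg .X := by
      simp [place, ht] at h; omega
    refine ⟨CounterState.ext (funext fun r => ?_) ?_ ?_, trivial⟩
    · rw [if_pos h]
      cases r <;> simp [eval, place, hci, ht]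
    · simp [eval]
    · simp [eval]
  · intro h
    have h : ¬ (i = s.reg .P ∧ l = s.reg .X) := by
      simp [place, ht] at h; omega
    refine ⟨CounterState.ext (funext fun r => ?_) ?_ ?_, ?_⟩
    · rw [if_neg h]
      cases r <;> simp [block, eval, place, hci, ht, two_mul]
    · simp [block, eval]
    · simp [block, eval]
    · simp [block, Bounded, place]; omega
  · refine ⟨CounterState.ext (funext fun r => ?_) ?_ ?_, ?_⟩
    · cases r <;> simp [block, eval, place, hco, ht, two_mul]
    · simp [block, eval]
    · simp [block, eval]
    · simp [block, Bounded, place]; omega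

/-- The disjunction in `absorb` is tested by nesting: `l` is compared with `Y` only if it differs
from `X`, so that nothing is counted twice when `x = y`. -/
theorem computes_testPre (adj : ℕ → ℕ → Bool) (x y : ℕ) (b : Bool) (hs : Ready N s)
    (ht : s.reg .t = 0) (hv : s.reg .v = 0) (hM : 2 * M ≤ N)
    (hL : s.reg .L ≤ M) (hX : s.reg .X ≤ M) (hY : s.reg .Y ≤ M)
    (hx : s.reg .X = x + 1) (hy : s.reg .Y = y + 1)
    (hw : s.reg .w = if adj x y then 0 else 1) :
    Computes N s (testPre (if b then .ci else .co))
      (fun _ l => 2 * l + if b then absorb adj x y l else 0)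
      (fun _ l => 2 * l + if b then 0 else absorb adj x y l) := by
  intro i hi l hl p o
  have hab := absorb_le adj x y l
  have hci := hs.ci_eq
  have hco := hs.co_eq
  have hl' : l ≤ N := by omega
  have hX' : s.reg .X ≤ N := by omega
  have hY' : s.reg .Y ≤ N := by omega
  refine ⟨by dsimp only; split_ifs <;> omega, by dsimp only; split_ifs <;> omega, ?_⟩
  refine Runs.cons (s' := (place s i l p o).set (if b then .ci else .co) (absorb adj x y l)) ?_ ?_
  · refine runs_ifZero (fun h => ?_) (fun h => ?_)
    · have : adj x y = true := by
        simp [place, hw] at h; exact h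
      have : absorb adj x y l = 0 := by simp [absorb, this]
      refine ⟨CounterState.ext (funext fun r => ?_) ?_ ?_, trivial⟩
      · rw [this]
        cases b <;> cases r <;> simp [eval, place, hci, hco]
      · simp [eval]
      · simp [eval]
    · have ha : adj x y = false := by
        simp [place, hw] at h; exact h
      refine Runs.cons (runs_addDist (by simp) (by simp) (by simp) (by simp) (by simpa [place])
        (by simpa [place]) (by simpa [place])) (Runs.cons (s' :=
          ((place s i l p o).set (if b then .ci else .co) (absorb adj x y l)).set .t
            (if l = x + 1 then 0 else ((l - s.reg .Y) + (s.reg .Y - l))))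
        (runs_ifZero (fun h => ?_) fun h => ?_) ?_)
      · have h : l = x + 1 := by
          simp [place, ht] at h; omega
        have : absorb adj x y l = 1 := by simp [absorb, ha, h]
        refine ⟨CounterState.ext (funext fun r => ?_) ?_ ?_, trivial⟩
        · rw [this, if_pos h]
          cases b <;> cases r <;> simp [eval, place, hci, hco, ht, h, hx]
        · simp [eval]
        · simp [eval]
      · have h : l ≠ x + 1 := by
          simp [place, ht] at h; omega
        refine Runs.cons (runs_clear _ _ (by simp [place, ht]; omega)) (Runs.cons
          (runs_addDist (by simp) (by simp) (by simp) (by simp) (by simpa [place])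
          (by simpa [place]) (by simpa [place])) (Runs.cons
          (runs_ifZero (fun h2 => ?_) fun h2 => ?_) (Runs.nil _)))
        · have h2 : l = y + 1 := by
            simp [place] at h2; omega
          have : absorb adj x y l = 1 := by simp [absorb, ha, h2]
          refine ⟨CounterState.ext (funext fun r => ?_) ?_ ?_, trivial⟩
          · rw [this, if_neg h]
            cases b <;> cases r <;> simp [eval, place, hci, hco]
          · simp [eval]
          · simp [eval]
        · have h2 : l ≠ y + 1 := by
            simp [place] at h2; omega
          have : absorb adj x y l = 0 := by simp [absorb, h, h2]
          refine ⟨CounterState.ext (funext fun r => ?_) ?_ ?_, trivial⟩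
          · rw [this, if_neg h]
            cases b <;> cases r <;> simp [eval, place, hci, hco]
          · simp [eval]
          · simp [eval]
      · refine ⟨CounterState.ext (funext fun r => ?_) ?_ ?_, ?_⟩
        · cases b <;> cases r <;> simp [block, eval, place, ht]
        · simp [block, eval]
        · simp [block, eval]
        · simp [block, Bounded, place]; split_ifs <;> omega
  · refine ⟨CounterState.ext (funext fun r => ?_) ?_ ?_, ?_⟩
    · cases b <;> cases r <;> simp [block, eval, place, hci, hco, two_mul] <;> omega
    · simp [block, eval]
    · simp [block, eval]
    · cases b <;> simp [block, Bounded, place, hl']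

theorem computes_lastPre (hs : Ready N s) (hM : 2 * M ≤ N) (hL : s.reg .L ≤ M) :
    Computes N s lastPre (fun _ l => if l = 0 then 1 else 2 * l)
      (fun _ l => if l = 0 then 1 else 2 * l) := by
  intro i hi l hl p o
  have hci := hs.ci_eq
  have hco := hs.co_eq
  refine ⟨by dsimp only; split_ifs <;> omega, by dsimp only; split_ifs <;> omega, ?_⟩
  refine runs_ifZero (fun h => ?_) (fun h => ?_)
  · have h : l = 0 := by simpa [place] using h
    refine ⟨CounterState.ext (funext fun r => ?_) ?_ ?_, ?_⟩
    · cases r <;> simp [block, eval, place, hci, hco, h]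
    · simp [block, eval]
    · simp [block, eval]
    · simp [block, Bounded]
  · have h : l ≠ 0 := by simpa [place] using h
    refine ⟨CounterState.ext (funext fun r => ?_) ?_ ?_, ?_⟩
    · cases r <;> simp [block, eval, place, hci, hco, h, two_mul]
    · simp [block, eval]
    · simp [block, eval]
    · simp [block, Bounded, place]; omega

end

end CliqueStrip

/-! ### The loops that read the graph and write the columns -/

namespace CliqueStrip

open CounterProg

/-- The distance between the numbers of corresponding vertices in consecutive columns. -/
abbrev stride (n k : ℕ) : ℕ := k + (k * (n + 1) + 1)

/-- The number of columns before the last one. -/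
abbrev numColumns (n : ℕ) : ℕ := n + 2 * (n * n)

/-- The state of the counters between the columns. -/
def frame (n k X Y P w q B : ℕ) (inp out : List Bool) : CounterState Counter where
  reg
    | .n => n
    | .k => k
    | .L => n + 1
    | .S => stride n k
    | .C => numColumns n
    | .A => 2 * n + 2
    | .kL => k * (n + 1)
    | .one => 1
    | .B => B
    | .X => X
    | .Y => Y
    | .P => P
    | .w => w
    | .q => q
    | _ => 0
  inp := inp
  out := out

/-- A bound on the values of the counters. -/
def counterBound (n k : ℕ) : ℕ :=
  -- A sum of the numbers of vertices and arcs, the target value and bounds for the other counters,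
  -- so that linear arithmetic bounds each of them.
  2 * (2 + (numColumns n + 1) * stride n k) + (k + numColumns n * (2 + k * (n + 1) * 3) +
    k * (n + 1) * 2) + (k * (2 * n + 2) + n * (n + 1) + n * n) + 2 * (2 * n + 2) + 2 * k +
    numColumns n + 4

variable {N n k X Y P w q B : ℕ} {inp out : List Bool}

theorem le_of_le_numColumns {c : ℕ} (hc : c ≤ numColumns n) :
    2 + c * stride n k ≤ 2 + (numColumns n + 1) * stride n k :=
  Nat.add_le_add_left (Nat.mul_le_mul_right _ (hc.trans (Nat.le_succ _))) _

theorem ready_frame (hN : counterBound n k ≤ N) (hX : X ≤ n) (hY : Y ≤ n) (hP : P ≤ k)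
    (hw : w ≤ 1) (hq : q ≤ 2 * n + 1) {c : ℕ} (hc : c ≤ numColumns n) (hB : B = 2 + c * stride n k) :
    Ready N (frame n k X Y P w q B inp out) := by
  have h1 := le_of_le_numColumns (n := n) (k := k) hc
  have h2 : stride n k ≤ (numColumns n + 1) * stride n k :=
    Nat.le_mul_of_pos_left _ (Nat.succ_pos _)
  rw [← hB] at h1
  simp only [counterBound] at hN
  refine ⟨fun r => ?_, ?_, rfl, rfl, rfl, rfl, rfl, rfl⟩
  · cases r <;> simp only [frame] <;> omega
  · simp only [frame]; omega

@[simp] theorem frame_reg_n :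
    (frame n k X Y P w q B inp out).reg .n = n := rfl

@[simp] theorem frame_reg_k :
    (frame n k X Y P w q B inp out).reg .k = k := rfl

@[simp] theorem frame_reg_L :
    (frame n k X Y P w q B inp out).reg .L = n + 1 := rfl

@[simp] theorem frame_reg_S :
    (frame n k X Y P w q B inp out).reg .S = stride n k := rfl

@[simp] theorem frame_reg_C :
    (frame n k X Y P w q B inp out).reg .C = numColumns n := rfl

@[simp] theorem frame_reg_A :
    (frame n k X Y P w q B inp out).reg .A = 2 * n + 2 := rfl

@[simp] theorem frame_reg_kL :
    (frame n k X Y P w q B inp out).reg .kL = k * (n + 1) := rfl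

@[simp] theorem frame_reg_one :
    (frame n k X Y P w q B inp out).reg .one = 1 := rfl

@[simp] theorem frame_reg_B :
    (frame n k X Y P w q B inp out).reg .B = B := rfl

@[simp] theorem frame_reg_X :
    (frame n k X Y P w q B inp out).reg .X = X := rfl

@[simp] theorem frame_reg_Y :
    (frame n k X Y P w q B inp out).reg .Y = Y := rfl

@[simp] theorem frame_reg_P :
    (frame n k X Y P w q B inp out).reg .P = P := rfl

@[simp] theorem frame_reg_w :
    (frame n k X Y P w q B inp out).reg .w = w := rfl

@[simp] theorem frame_reg_q :
    (frame n k X Y P w q B inp out).reg .q = q := rfl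

@[simp] theorem frame_reg_t :
    (frame n k X Y P w q B inp out).reg .t = 0 := rfl

@[simp] theorem frame_reg_i :
    (frame n k X Y P w q B inp out).reg .i = 0 := rfl

@[simp] theorem frame_reg_p :
    (frame n k X Y P w q B inp out).reg .p = 0 := rfl

@[simp] theorem frame_reg_l :
    (frame n k X Y P w q B inp out).reg .l = 0 := rfl

@[simp] theorem frame_reg_ci :
    (frame n k X Y P w q B inp out).reg .ci = 0 := rfl

@[simp] theorem frame_reg_co :
    (frame n k X Y P w q B inp out).reg .co = 0 := rfl

@[simp] theorem frame_reg_v :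
    (frame n k X Y P w q B inp out).reg .v = 0 := rfl

@[simp] theorem frame_inp : (frame n k X Y P w q B inp out).inp = inp := rfl

@[simp] theorem frame_out : (frame n k X Y P w q B inp out).out = out := rfl

@[simp] theorem mk_frame_reg (inp' out' : List Bool) :
    (⟨(frame n k X Y P w q B inp out).reg, inp', out'⟩ : CounterState Counter) =
      frame n k X Y P w q B inp' out' := rfl

@[simp] theorem frame_set_X (a : ℕ) : (frame n k X Y P w q B inp out).set .X a =
    frame n k a Y P w q B inp out :=
  CounterState.ext (funext fun r => by cases r <;> rfl) rfl rfl

@[simp] theorem frame_set_Y (a : ℕ) : (frame n k X Y P w q B inp out).set .Y a =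
    frame n k X a P w q B inp out :=
  CounterState.ext (funext fun r => by cases r <;> rfl) rfl rfl

@[simp] theorem frame_set_P (a : ℕ) : (frame n k X Y P w q B inp out).set .P a =
    frame n k X Y a w q B inp out :=
  CounterState.ext (funext fun r => by cases r <;> rfl) rfl rfl

@[simp] theorem frame_set_w (a : ℕ) : (frame n k X Y P w q B inp out).set .w a =
    frame n k X Y P a q B inp out :=
  CounterState.ext (funext fun r => by cases r <;> rfl) rfl rfl

@[simp] theorem frame_set_q (a : ℕ) : (frame n k X Y P w q B inp out).set .q a =
    frame n k X Y P w a B inp out :=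
  CounterState.ext (funext fun r => by cases r <;> rfl) rfl rfl

@[simp] theorem frame_set_B (a : ℕ) : (frame n k X Y P w q B inp out).set .B a =
    frame n k X Y P w q a inp out :=
  CounterState.ext (funext fun r => by cases r <;> rfl) rfl rfl

theorem runs_selectColumn (hN : counterBound n k ≤ N) {part : ℕ → ℕ} {x : ℕ} (hx : x < n)
    (hpx : part x < k) :
    (columnProg selectPre false).Runs N
      (frame n k (x + 1) 0 (part x) 0 (2 * (x + 1)) (2 + x * stride n k) inp out)
      (frame n k (x + 1) 0 (part x) 0 (2 * (x + 1)) (2 + (x + 1) * stride n k) inp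
        (out ++ (selectColumn n part x).code k (n + 1) (2 + x * stride n k) (stride n k))) := by
  have hr : Ready N (frame n k (x + 1) 0 (part x) 0 (2 * (x + 1)) (2 + x * stride n k) inp out) :=
    ready_frame hN (by omega) (by omega) hpx.le (by omega) (by omega)
      (c := x) (by simp only [numColumns]; omega) rfl
  simp only [counterBound] at hN
  refine (runs_columnProg hr (computes_selectPre (M := n + 1 + k) hr rfl rfl (by omega) ?_ ?_ ?_ ?_)
    (col := selectColumn n part x) rfl rfl (fun i _ l _ => ?_) (fun i _ l _ => ?_)).congr rfl ?_
  · simp only [frame]; omega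
  · simp only [frame]; omega
  · simp only [frame]; omega
  · simp only [frame]; omega
  · simp only [frame, selectColumn]; split_ifs <;> simp [*]
  · simp only [frame, selectColumn]
  · simp [Nat.succ_mul, Nat.add_assoc]

theorem runs_testColumn (hN : counterBound n k ≤ N) (adj : ℕ → ℕ → Bool) {x y c : ℕ}
    (hx : x < n) (hy : y < n) (hc : c ≤ numColumns n) (b : Bool) :
    (columnProg (testPre (if b then .ci else .co)) b).Runs N
      (frame n k (x + 1) (y + 1) 0 (if adj x y then 0 else 1) 1 (2 + c * stride n k) inp out)
      (frame n k (x + 1) (y + 1) 0 (if adj x y then 0 else 1) 1 (2 + (c + 1) * stride n k) inp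
        (out ++ (testColumn n adj x y b).code k (n + 1) (2 + c * stride n k) (stride n k))) := by
  have hr : Ready N (frame n k (x + 1) (y + 1) 0 (if adj x y then 0 else 1) 1
      (2 + c * stride n k) inp out) :=
    ready_frame hN (by omega) (by omega) (by omega) (by split_ifs <;> omega) (by omega) hc rfl
  simp only [counterBound] at hN
  refine (runs_columnProg hr (computes_testPre (M := n + 1) adj x y b hr rfl rfl (by omega)
    ?_ ?_ ?_ rfl rfl rfl) (col := testColumn n adj x y b) rfl rfl (fun i _ l _ => ?_)
    (fun i _ l _ => ?_)).congr rfl ?_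
  · simp only [frame]; omega
  · simp only [frame]; omega
  · simp only [frame]; omega
  · simp only [frame, testColumn, Nat.add_assoc]
  · simp only [frame, testColumn, Nat.add_assoc]
  · simp [Nat.succ_mul, Nat.add_assoc]

/-- Write the columns for the selection of vertices. -/
def selectProg : CounterProg Counter :=
  block [rep .n (block [inc .X, readNum .P, addTo .q .X, addTo .q .X, columnProg selectPre false,
    clear .q, clear .P]), clear .X]

/-- Write the columns for the test of pairs of vertices. -/
def testProg : CounterProg Counter :=
  block [inc .q, rep .n (block [inc .X, rep .n (block [inc .Y, readBit skip (inc .w),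
    columnProg (testPre .co) false, columnProg (testPre .ci) true, clear .w]), clear .Y]),
    clear .X, clear .q]

/-- After `j` rounds of a reading loop the items `j, …, n - 1` are still in the input; this exposes
the next one. -/
theorem range'_sub_succ {j n : ℕ} (h : j < n) :
    List.range' j (n - j) = j :: List.range' (j + 1) (n - (j + 1)) := by
  rw [show n - j = (n - (j + 1)) + 1 by omega, List.range'_succ]

theorem runs_selectProg (hN : counterBound n k ≤ N) {part : ℕ → ℕ}
    (hpart : ∀ x < n, part x < k) :
    selectProg.Runs N
      (frame n k 0 0 0 0 0 2 ((List.range n).flatMap (fun x => unaryCode (part x)) ++ inp) out)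
      (frame n k 0 0 0 0 0 (2 + n * stride n k) inp (out ++ (List.range n).flatMap fun c =>
        (selectColumn n part c).code k (n + 1) (2 + c * stride n k) (stride n k))) := by
  have hnN : n ≤ N := by simp only [counterBound] at hN; omega
  refine Runs.cons (s' := frame n k n 0 0 0 0 (2 + n * stride n k) inp
    (out ++ (List.range n).flatMap fun c =>
      (selectColumn n part c).code k (n + 1) (2 + c * stride n k) (stride n k)))
    (Runs.rep (fun j => frame n k j 0 0 0 0 (2 + j * stride n k)
      ((List.range' j (n - j)).flatMap (fun x => unaryCode (part x)) ++ inp)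
      (out ++ (List.range j).flatMap fun c =>
      (selectColumn n part c).code k (n + 1) (2 + c * stride n k) (stride n k)))
      ?_ ?_ hnN fun x hx => ?_) ?_
  · simp [List.range_eq_range']
  · simp [frame]
  · change x < n at hx
    have hpx := hpart x hx
    have hN' := hN
    simp only [counterBound] at hN'
    rw [range'_sub_succ hx, List.flatMap_cons, List.append_assoc]
    refine Runs.cons (s' := frame n k (x + 1) 0 0 0 0 _ _ _) ⟨by simp [eval]; rfl, trivial⟩
      (Runs.cons (s' := frame n k (x + 1) 0 (part x) 0 0 _ _ _)
        ((runs_readNum _ _ (part x) _ rfl (by omega)).congr rfl (by simp; rfl))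
      (Runs.cons (s' := frame n k (x + 1) 0 (part x) 0 (x + 1) _ _ _)
        ⟨by simp; rfl, by simp; omega⟩
      (Runs.cons (s' := frame n k (x + 1) 0 (part x) 0 (2 * (x + 1)) _ _ _)
        ⟨by simp [two_mul]; rfl, by simp; omega⟩
      (Runs.cons (runs_selectColumn hN hx hpx) ⟨?_, ?_⟩))))
    · simp [block, eval, List.range_succ]
    · simp [block, Bounded]; omega
  · exact ⟨by simp [block, eval], by simpa [block, Bounded]⟩

/-- The bit for `x`, `y` is read into `w`, used for the test and its restoring column, and cleared.
Both nested loops carry as invariant the unread part of the matrix and the columns written so far.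
-/
theorem runs_testProg (hN : counterBound n k ≤ N) (adj : ℕ → ℕ → Bool) :
    testProg.Runs N
      (frame n k 0 0 0 0 0 (2 + n * stride n k)
        ((List.range n).flatMap (fun x => (List.range n).map (adj x)) ++ inp) out)
      (frame n k 0 0 0 0 0 (2 + numColumns n * stride n k) inp (out ++
        (List.range n).flatMap fun x => (List.range n).flatMap fun y =>
        (testColumn n adj x y false).code k (n + 1)
          (2 + (n + 2 * (x * n + y)) * stride n k) (stride n k) ++
        (testColumn n adj x y true).code k (n + 1)
          (2 + (n + 2 * (x * n + y) + 1) * stride n k) (stride n k))) := by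
  set g : ℕ → ℕ → List Bool := fun x y => (testColumn n adj x y false).code k (n + 1)
      (2 + (n + 2 * (x * n + y)) * stride n k) (stride n k) ++
    (testColumn n adj x y true).code k (n + 1)
      (2 + (n + 2 * (x * n + y) + 1) * stride n k) (stride n k) with hg
  have hN' := hN
  simp only [counterBound] at hN'
  have hnN : n ≤ N := by omega
  refine Runs.cons (s' := frame n k 0 0 0 0 1 _ _ _) ⟨by simp [eval]; rfl, trivial⟩
    (Runs.cons (s' := frame n k n 0 0 0 1 (2 + numColumns n * stride n k) inp
      (out ++ (List.range n).flatMap fun x => (List.range n).flatMap (g x)))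
    (Runs.rep (fun j => frame n k j 0 0 0 1 (2 + (n + 2 * (j * n)) * stride n k)
      ((List.range' j (n - j)).flatMap (fun x => (List.range n).map (adj x)) ++ inp)
      (out ++ (List.range j).flatMap fun x => (List.range n).flatMap (g x)))
      (by simp [List.range_eq_range']) (by simp [numColumns]) hnN fun x hx => ?_)
    ⟨by simp [block, eval, hg], by simp [block, Bounded]; omega⟩)
  change x < n at hx
  rw [range'_sub_succ hx, List.flatMap_cons, List.append_assoc]
  generalize (List.range' (x + 1) (n - (x + 1))).flatMap
    (fun x => (List.range n).map (adj x)) ++ inp = inp'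
  rw [List.range_succ, List.flatMap_append, ← List.append_assoc]
  generalize out ++ (List.range x).flatMap (fun x => (List.range n).flatMap (g x)) = out'
  refine Runs.cons (s' := frame n k (x + 1) 0 0 0 1 _ _ _) ⟨by simp [eval]; rfl, trivial⟩
    (Runs.cons (s' := frame n k (x + 1) n 0 0 1 (2 + (n + 2 * (x * n + n)) * stride n k) inp'
      (out' ++ (List.range n).flatMap (g x)))
    (Runs.rep (fun j => frame n k (x + 1) j 0 0 1 (2 + (n + 2 * (x * n + j)) * stride n k)
      ((List.range' j (n - j)).map (adj x) ++ inp')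
      (out' ++ (List.range j).flatMap (g x)))
      (by simp [List.range_eq_range']) (by simp) hnN fun y hy => ?_)
    ⟨by simp [block, eval, Nat.succ_mul], by simp [block, Bounded]; omega⟩)
  change y < n at hy
  have hxy : x * n + y < n * n := by nlinarith
  rw [range'_sub_succ hy, List.map_cons, List.cons_append]
  refine Runs.cons (s' := frame n k (x + 1) (y + 1) 0 0 1 _ _ _) ⟨by simp [eval]; rfl, trivial⟩
    (Runs.cons (s' := frame n k (x + 1) (y + 1) 0 (if adj x y then 0 else 1) 1
      (2 + (n + 2 * (x * n + y)) * stride n k) ((List.range' (y + 1) (n - (y + 1))).map (adj x) ++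
        inp') (out' ++ (List.range y).flatMap (g x)))
      (runs_readBit rfl (fun h => ⟨by simp [eval, h], trivial⟩)
        fun h => ⟨by simp [eval, h], trivial⟩)
    (Runs.cons (runs_testColumn hN adj hx hy (by simp only [numColumns]; omega) false)
    (Runs.cons (runs_testColumn hN adj hx hy (by simp only [numColumns]; omega) true)
    ⟨?_, ?_⟩)))
  · simp only [block, List.foldr, eval, eval_clear, frame_set_w, List.range_succ,
      List.flatMap_append, List.append_assoc, hg, List.flatMap_singleton]
    ring_nf
  · simp [block, Bounded]
    split_ifs <;> omega

end CliqueStrip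

/-! ### Multiplication of counters -/

namespace CounterProg

variable {K : Type} [DecidableEq K] {N : ℕ}

/-- Add the product of two counters to another one. -/
def mulAddTo (d m r : K) : CounterProg K := rep m (addTo d r)

theorem runs_mulAddTo {d m r : K} (hd : d ≠ r) (s : CounterState K) (hm : s.reg m ≤ N)
    (hr : s.reg r ≤ N) :
    (mulAddTo d m r).Runs N s (s.set d (s.reg d + s.reg m * s.reg r)) :=
  Runs.rep (fun j => s.set d (s.reg d + j * s.reg r)) (by simp [CounterState.set_self]) rfl hm
    fun j _ => ⟨by simp [hd.symm, CounterState.set_set, Nat.succ_mul, Nat.add_assoc],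
      by simpa [hd.symm]⟩

theorem eval_mulAddTo {d m r : K} (hd : d ≠ r) (s : CounterState K) :
    (mulAddTo d m r).eval s = s.set d (s.reg d + s.reg m * s.reg r) :=
  (runs_mulAddTo hd s (le_max_left _ _) (le_max_right _ _)).eval_eq

theorem bounded_mulAddTo {d m r : K} (hd : d ≠ r) (s : CounterState K) :
    (mulAddTo d m r).Bounded N s ↔ s.reg m ≤ N ∧ (0 < s.reg m → s.reg r ≤ N) := by
  refine ⟨fun h => ⟨h.1, fun hm => (bounded_addTo _ _ _).1 (h.2 0 hm)⟩, fun h => ⟨h.1, ?_⟩⟩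
  exact fun j hj => (runs_mulAddTo hd s h.1 (h.2 (by omega))).bounded.2 j hj

end CounterProg

/-! ### Parameters, header, last column and the whole program -/

namespace CliqueStrip

open CounterProg

variable {N n k : ℕ} {inp out : List Bool}

/-- Read the sizes and compute the parameters of the strip network. -/
def paramProg : CounterProg Counter :=
  block [readNum .n, readNum .k, readNum .t, clear .t, inc .one, addTo .L .n, inc .L,
    addTo .A .L, addTo .A .L, mulAddTo .kL .k .L, addTo .S .k, addTo .S .kL, inc .S,
    mulAddTo .C .n .n, mulAddTo .C .n .n, addTo .C .n, inc .B, inc .B]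

theorem runs_paramProg (hN : counterBound n k ≤ N) {z : ℕ} (hz : z ≤ N) :
    paramProg.Runs N ⟨fun _ => 0, unaryCode n ++ unaryCode k ++ unaryCode z ++ inp, out⟩
      (frame n k 0 0 0 0 0 2 inp out) := by
  simp only [counterBound] at hN
  have h1 : k + (k * (n + 1) + 1) ≤ (numColumns n + 1) * stride n k :=
    Nat.le_mul_of_pos_left _ (Nat.succ_pos _)
  rw [List.append_assoc, List.append_assoc]
  -- The class size is read into `t` only to move past it in the input, and is then cleared.
  refine Runs.cons (runs_readNum _ _ n _ rfl (by omega)) (Runs.cons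
    (runs_readNum _ _ k _ rfl (by omega)) (Runs.cons (runs_readNum _ _ z _ rfl hz) ⟨?_, ?_⟩))
  · refine CounterState.ext (funext fun r => ?_) ?_ ?_
    · cases r <;> simp [block, eval, eval_mulAddTo, frame, stride, numColumns] <;> ring
    · simp [block, eval, eval_mulAddTo]
    · simp [block, eval, eval_mulAddTo]
  · simp [block, Bounded, eval, eval_mulAddTo, bounded_mulAddTo, hz]
    simp only [stride] at hN h1
    omega

/-- Write the sizes of the strip network, its source and its sink, and the target value. -/
def headerProg : CounterProg Counter :=
  block [mulAddTo .t .C .S, emit [.one, .one, .S, .t], clear .t,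
    mulAddTo .t .C .kL, mulAddTo .t .C .kL, mulAddTo .t .C .kL, addTo .t .C, addTo .t .C,
    emit [.t, .k, .kL, .kL], clear .t, emit [], emit [.one],
    mulAddTo .t .k .A, mulAddTo .t .n .L, mulAddTo .t .n .n, emit [.t], clear .t]

theorem runs_headerProg (hN : counterBound n k ≤ N) :
    headerProg.Runs N (frame n k 0 0 0 0 0 2 inp out) (frame n k 0 0 0 0 0 2 inp (out ++
      (unaryCode (2 + (numColumns n + 1) * stride n k) ++
      unaryCode (k + numColumns n * (2 + k * (n + 1) * 3) + k * (n + 1) * 2) ++ unaryCode 0 ++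
      unaryCode 1 ++ unaryCode (k * (2 * n + 2) + n * (n + 1) + n * n)))) := by
  have hr : Ready N (frame n k 0 0 0 0 0 2 inp out) :=
    ready_frame hN (by omega) (by omega) (by omega) (by omega) (by omega) (Nat.zero_le _) (by simp)
  simp only [counterBound] at hN
  -- Products are accumulated summand by summand in `t`; expanded in the same way, the intermediate
  -- values become accessible to `omega`.
  have e1 : (numColumns n + 1) * stride n k = numColumns n * stride n k + stride n k :=
    Nat.succ_mul _ _
  have e2 : numColumns n * (2 + k * (n + 1) * 3) = numColumns n * (k * (n + 1)) +
      numColumns n * (k * (n + 1)) + numColumns n * (k * (n + 1)) + numColumns n +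
      numColumns n := by ring
  refine ⟨CounterState.ext (funext fun r => ?_) ?_ ?_, ?_⟩
  · cases r <;> simp [headerProg, block, eval, eval_mulAddTo]
  · simp [headerProg, block, eval, eval_mulAddTo]
  · simp only [e1, e2]
    simp [headerProg, block, eval, eval_mulAddTo]
    refine congrArg₂ _ (congrArg _ (by omega)) (congrArg₂ _ (congrArg _ (by omega)) rfl)
  · simp only [headerProg, block, Bounded, List.foldr, bounded_clear, bounded_addTo, bounded_emit,
      bounded_mulAddTo, ne_eq, reduceCtorEq, not_false_eq_true, eval_clear, eval_addTo,
      eval_mulAddTo, eval_emit]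
    simp
    have hS : stride n k ≤ N := hr.le .S
    have hkL : k * (n + 1) ≤ N := hr.le .kL
    rw [e1, e2] at hN
    omega

/-- Write the arcs from the source to the rows. -/
def startProg : CounterProg Counter :=
  block [rep .k (block [emit [], emit [.B, .i], emit [.A], inc .i]), clear .i]

theorem runs_startProg (hN : counterBound n k ≤ N) :
    startProg.Runs N (frame n k 0 0 0 0 0 2 inp out) (frame n k 0 0 0 0 0 2 inp (out ++
      (List.range k).flatMap fun i => arcCode 0 (2 + i) (2 * n + 2))) := by
  simp only [counterBound] at hN
  refine Runs.cons (Runs.rep (fun j => (frame n k 0 0 0 0 0 2 inp (out ++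
      (List.range j).flatMap fun i => arcCode 0 (2 + i) (2 * n + 2))).set .i j) ?_ rfl ?_ ?_)
    ⟨CounterState.ext (funext fun r => ?_) ?_ ?_, ?_⟩
  · refine CounterState.ext (funext fun r => ?_) rfl (by simp)
    cases r <;> simp [frame]
  · simp; omega
  · intro i hi
    simp at hi
    refine ⟨CounterState.ext (funext fun r => ?_) ?_ ?_, ?_⟩
    · cases r <;> simp [block, eval]
    · simp [block, eval]
    · simp [block, eval, List.range_succ, arcCode]
    · simp [block, Bounded]; omega
  · cases r <;> simp [block, frame, eval]
  · simp [block, eval]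
  · simp [block, eval]
  · simp [block, Bounded]; omega

/-- Write the last column. -/
def lastProg : CounterProg Counter := block [grid (lastColumnBody lastPre), clear .p]

theorem runs_lastProg (hN : counterBound n k ≤ N) :
    lastProg.Runs N (frame n k 0 0 0 0 0 (2 + numColumns n * stride n k) inp out)
      (frame n k 0 0 0 0 0 (2 + numColumns n * stride n k) inp (out ++
        (finalColumn n).lastCode k (n + 1) (2 + numColumns n * stride n k))) := by
  have hr : Ready N (frame n k 0 0 0 0 0 (2 + numColumns n * stride n k) inp out) :=
    ready_frame hN (by omega) (by omega) (by omega) (by omega) (by omega) le_rfl rfl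
  simp only [counterBound] at hN
  refine Runs.cons (runs_lastColumn hr (computes_lastPre (M := n + 1) hr (by omega) le_rfl)
    (col := finalColumn n) (fun i _ l _ => ?_) fun i _ l _ => ?_)
    ⟨CounterState.ext (funext fun r => ?_) ?_ ?_, ?_⟩
  · simp [finalColumn]
  · simp [finalColumn]
  · cases r <;> simp [block, frame, eval]
  · simp [block, eval]
  · simp [block, eval]
  · simp [block, Bounded]; omega

/-- Clear the counters. -/
def resetProg : CounterProg Counter :=
  block [clear .n, clear .k, clear .L, clear .S, clear .C, clear .A, clear .kL, clear .one,
    clear .B]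

theorem runs_resetProg (hN : counterBound n k ≤ N) :
    resetProg.Runs N (frame n k 0 0 0 0 0 (2 + numColumns n * stride n k) inp out)
      ⟨fun _ => 0, inp, out⟩ := by
  have hr : Ready N (frame n k 0 0 0 0 0 (2 + numColumns n * stride n k) inp out) :=
    ready_frame hN (by omega) (by omega) (by omega) (by omega) (by omega) le_rfl rfl
  refine ⟨CounterState.ext (funext fun r => ?_) ?_ ?_, ?_⟩
  · cases r <;> simp [resetProg, block, frame, eval]
  · simp [resetProg, block, eval]
  · simp [resetProg, block, eval]
  · simp only [resetProg, block, Bounded, List.foldr, bounded_clear, eval_clear]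
    have := hr.le
    simp only [CounterState.set_reg, ne_eq, reduceCtorEq, not_false_eq_true,
      Function.update_of_ne, this, and_self]

/-- The program of the reduction. -/
def program : CounterProg Counter :=
  block [paramProg, headerProg, startProg, selectProg, testProg, lastProg, resetProg]

/-- The selection columns contribute `2 * (x + 1)` for `x < n`, in total `n * (n + 1)`. Each of the
`n * n` tests contributes `1`, its restoring column nothing. -/
theorem sum_vcap (part : ℕ → ℕ) (adj : ℕ → ℕ → Bool) :
    ∑ c ∈ Finset.range (n + 2 * (n * n)),
      (if (column n part adj c).restore then 0 else (column n part adj c).vcap) =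
      n * (n + 1) + n * n := by
  rw [Finset.sum_range_add]
  congr 1
  · rw [Finset.sum_congr rfl (g := fun c => 2 * (c + 1)) fun c hc => by
      rw [column_select n part adj (Finset.mem_range.1 hc)]; rfl]
    clear part adj
    induction n with
    | zero => simp
    | succ n ih => rw [Finset.sum_range_succ, ih]; ring
  · have key : ∀ m, ∑ c ∈ Finset.range (2 * m), (if c % 2 = 1 then 0 else 1) = m := by
      intro m
      induction m with
      | zero => simp
      | succ m ih =>
        rw [Nat.mul_succ, Finset.sum_range_succ, Finset.sum_range_succ, ih, if_neg (by omega),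
          if_pos (by omega)]
    refine Eq.trans ?_ (key (n * n))
    refine Finset.sum_congr rfl fun c hc => ?_
    have hc := Finset.mem_range.1 hc
    have e : column n part adj (n + c) = testColumn n adj (c / 2 / n) (c / 2 % n) (c % 2 == 1) := by
      rw [column, if_neg (by omega), if_pos (by omega), Nat.add_sub_cancel_left]
    rw [e]
    simp [testColumn]

theorem flatMap_columns {α : Type*} (f : ℕ → List α) :
    (List.range (n + 2 * (n * n))).flatMap f = (List.range n).flatMap f ++
      (List.range n).flatMap fun x => (List.range n).flatMap fun y =>
        f (n + 2 * (x * n + y)) ++ f (n + 2 * (x * n + y) + 1) := by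
  rw [List.range_add, List.flatMap_append, List.flatMap_map, Nat.mul_comm 2,
    List.flatMap_range_mul, List.flatMap_range_mul]
  simp [List.range_succ, Nat.mul_comm 2, Nat.add_assoc]

theorem runs_program {part : ℕ → ℕ} {adj : ℕ → ℕ → Bool} (hk : 0 < k)
    (hpart : ∀ x < n, part x < k) (hN : counterBound n k ≤ N) {z : ℕ} (hz : z ≤ N) :
    program.Runs N ⟨fun _ => 0, unaryCode n ++ unaryCode k ++ unaryCode z ++
      ((List.range n).flatMap (fun x => unaryCode (part x)) ++
        ((List.range n).flatMap (fun x => (List.range n).map (adj x)) ++ [])), []⟩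
      ⟨fun _ => 0, [], (data n part adj k hk).toInstance.encode⟩ := by
  refine Runs.congr (Runs.cons (runs_paramProg hN hz) (Runs.cons (runs_headerProg hN) (Runs.cons
    (runs_startProg hN) (Runs.cons (runs_selectProg hN hpart) (Runs.cons (runs_testProg hN adj)
    (Runs.cons (runs_lastProg hN) (Runs.cons (runs_resetProg hN) (Runs.nil _)))))))) rfl ?_
  congr 1
  rw [StripData.encode_toInstance]
  have h1 : (data n part adj k hk).target = k * (2 * n + 2) + n * (n + 1) + n * n := by
    rw [Nat.add_assoc, ← sum_vcap part adj]
    rfl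
  have h2 : (List.range n).flatMap (fun c => (selectColumn n part c).code k (n + 1)
        (2 + c * stride n k) (stride n k)) =
      (List.range n).flatMap (fun c => (column n part adj c).code k (n + 1)
        (2 + c * stride n k) (stride n k)) :=
    List.flatMap_congr_mem fun c hc => by rw [column_select n part adj (List.mem_range.1 hc)]
  have h3 : ((List.range n).flatMap fun x => (List.range n).flatMap fun y =>
        (testColumn n adj x y false).code k (n + 1)
          (2 + (n + 2 * (x * n + y)) * stride n k) (stride n k) ++
        (testColumn n adj x y true).code k (n + 1)
          (2 + (n + 2 * (x * n + y) + 1) * stride n k) (stride n k)) =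
      (List.range n).flatMap fun x => (List.range n).flatMap fun y =>
        (column n part adj (n + 2 * (x * n + y))).code k (n + 1)
          (2 + (n + 2 * (x * n + y)) * stride n k) (stride n k) ++
        (column n part adj (n + 2 * (x * n + y) + 1)).code k (n + 1)
          (2 + (n + 2 * (x * n + y) + 1) * stride n k) (stride n k) :=
    List.flatMap_congr_mem fun x hx => List.flatMap_congr_mem fun y hy => by
      rw [column_test n part adj (List.mem_range.1 hx) (List.mem_range.1 hy),
        column_restore n part adj (List.mem_range.1 hx) (List.mem_range.1 hy)]
  rw [h1, h2, h3, ← column_final n part adj]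
  simp only [List.nil_append, List.append_assoc]
  rw [← List.append_assoc ((List.range n).flatMap _) ((List.range n).flatMap _),
    ← flatMap_columns fun c => (column n part adj c).code k (n + 1) (2 + c * stride n k)
      (stride n k)]
  rfl

end CliqueStrip

/-! ### The reduction and its properties -/

namespace CliqueStrip

open CounterProg

/-- The class of a vertex given by its number. -/
def partNat (I : MulticoloredClique) (x : ℕ) : ℕ :=
  if h : x < I.n then I.part ⟨x, h⟩ else 0

open Classical in
/-- The adjacency of vertices given by their numbers. -/
noncomputable def adjNat (I : MulticoloredClique) (x y : ℕ) : Bool :=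
  decide (∃ (hx : x < I.n) (hy : y < I.n), I.graph.Adj ⟨x, hx⟩ ⟨y, hy⟩)

@[simp] theorem partNat_val (I : MulticoloredClique) (x : Fin I.n) :
    partNat I x = I.part x := dif_pos x.2

@[simp] theorem adjNat_val (I : MulticoloredClique) (x y : Fin I.n) :
    adjNat I x y = true ↔ I.graph.Adj x y := by
  simp [adjNat]

/-- The strip network of an instance. -/
noncomputable def dataOf (I : MulticoloredClique) : StripData :=
  data I.n (partNat I) (adjNat I) I.k I.k_pos

theorem encode_eq (I : MulticoloredClique) : I.encode =
    unaryCode I.n ++ unaryCode I.k ++ unaryCode I.N ++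
      ((List.range I.n).flatMap (fun x => unaryCode (partNat I x)) ++
        ((List.range I.n).flatMap (fun x => (List.range I.n).map (adjNat I x)) ++ [])) := by
  classical
  rw [MulticoloredClique.encode, List.append_assoc (_ ++ _ ++ _), List.append_nil]
  congr 2
  · rw [← List.flatMap_finRange_val]
    simp
  · rw [← List.flatMap_finRange_val]
    refine List.flatMap_congr_mem fun u _ => ?_
    rw [← List.map_coe_finRange_eq_range, List.map_map]
    refine List.map_congr_left fun v _ => ?_
    rw [Bool.eq_iff_iff]
    simp

theorem counterBound_le {n k m : ℕ} (hn : n ≤ m) (hk : k ≤ m) :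
    counterBound n k ≤ counterBound m m := by
  unfold counterBound numColumns stride
  gcongr

open Polynomial in
theorem exists_eval_eq_counterBound : ∃ P : Polynomial ℕ, ∀ m, P.eval m = counterBound m m :=
  ⟨2 * (2 + ((X + 2 * (X * X)) + 1) * (X + (X * (X + 1) + 1))) +
    (X + (X + 2 * (X * X)) * (2 + X * (X + 1) * 3) + X * (X + 1) * 2) +
    (X * (2 * X + 2) + X * (X + 1) + X * X) + 2 * (2 * X + 2) + 2 * X + (X + 2 * (X * X)) + 4,
    fun m => by simp [counterBound, numColumns, stride]⟩

theorem nonempty_computableInPolyTime_toInstance :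
    Nonempty (Turing.TM2ComputableInPolyTime MulticoloredClique.encode AllOrNothingFlow.encode
      fun I => (dataOf I).toInstance) := by
  obtain ⟨P, hP⟩ := exists_eval_eq_counterBound
  refine nonempty_computableInPolyTime_of_runs program P fun I => ?_
  -- As numbers are written in unary, the length of the input bounds `n`, `k` and `N`.
  have h : I.encode.length ≥ I.n ∧ I.encode.length ≥ I.k ∧ I.encode.length ≥ I.N := by
    simp [encode_eq, unaryCode]
    omega
  rw [hP]
  have hb : I.N ≤ counterBound I.encode.length I.encode.length := by
    have := h.2.2
    simp only [counterBound]
    omega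
  rw [encode_eq]
  rw [encode_eq] at h hb
  exact runs_program I.k_pos (fun x hx => by simp [partNat, hx])
    (counterBound_le h.1 h.2.1) hb

theorem isYes_iff (I : MulticoloredClique) : I.IsYes ↔ (dataOf I).toInstance.IsYes := by
  classical
  have h : (dataOf I).toInstance.IsYes ↔ ∃ lam v, (dataOf I).IsRouting lam v :=
    Iff.trans (FlowNetwork.hasAllOrNothingFlow_reindex ..)
      (dataOf I).hasAllOrNothingFlow_iff
  rw [h]
  constructor
  · rintro ⟨C, hC, hC1⟩
    choose x hx using fun i => Finset.card_eq_one.1 (hC1 i)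
    have hx' : ∀ i, x i ∈ C ∧ I.part (x i) = i := fun i => by
      have : x i ∈ C.filter fun v => I.part v = i := by rw [hx i]; simp
      simpa using this
    refine exists_routing_of_clique (x := fun i => (x i).val) ?_ (fun i => (x i).2) (fun i => ?_) fun i j hij => ?_
    · intro a b
      simp only [adjNat, decide_eq_decide]
      constructor <;> rintro ⟨h1, h2, h3⟩ <;> exact ⟨h2, h1, h3.symm⟩
    · simp [(hx' i).2]
    · simp only [adjNat_val]
      refine hC (hx' i).1 (hx' j).1 fun h => hij ?_
      rw [← (hx' i).2, h, (hx' j).2]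
  · rintro ⟨lam, v, hr⟩
    obtain ⟨x, hx, hadj⟩ := exists_clique_of_routing hr
    let y : Fin I.k → Fin I.n := fun i => ⟨x i, (hx i).1⟩
    have hy : ∀ i, I.part (y i) = i := fun i => Fin.ext <| by
      rw [← partNat_val]; exact (hx i).2
    refine ⟨Finset.univ.image y, ?_, fun i => ?_⟩
    · intro a ha b hb hab
      simp only [Finset.coe_image, Finset.coe_univ, Set.image_univ, Set.mem_range] at ha hb
      obtain ⟨i, rfl⟩ := ha
      obtain ⟨j, rfl⟩ := hb
      rw [← adjNat_val]
      exact hadj i j fun h => hab (by rw [h])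
    · rw [Finset.card_eq_one]
      refine ⟨y i, ?_⟩
      ext a
      simp only [Finset.mem_filter, Finset.mem_image, Finset.mem_univ, true_and,
        Finset.mem_singleton]
      constructor
      · rintro ⟨⟨j, rfl⟩, h⟩
        rw [hy] at h
        rw [h]
      · rintro rfl
        exact ⟨⟨i, rfl⟩, hy i⟩

end CliqueStrip

theorem StripData.pathwidth_toInstance_le (S : StripData) :
    pathwidth S.toInstance.network.underlying ≤ 5 * S.k :=
  (FlowNetwork.pathwidth_reindex_le _ _ _ S.decomposition).trans S.width_decomposition_le

theorem StripData.cap_le (S : StripData) (e : StripArc S.C S.k S.L) : S.cap e ≤ 2 * S.base := by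
  cases e with
  | start => simp only [cap]; omega
  | top c | bot c | vert c p => have := S.vcap_lt c; simp only [cap]; omega
  | enter c p => exact (S.cin_lt _ _ _ p.modNat.2).le
  | leave c p => exact (S.cout_lt _ _ _ p.modNat.2).le

theorem lemma1 :
    ∃ red : MulticoloredClique → AllOrNothingFlow,
      Nonempty (Turing.TM2ComputableInPolyTime
        MulticoloredClique.encode AllOrNothingFlow.encode red) ∧
      (∀ I : MulticoloredClique, I.IsYes ↔ (red I).IsYes) ∧
      (∀ I : MulticoloredClique, (red I).network.IsPlanar) ∧
      (∃ C : ℕ, ∀ I : MulticoloredClique,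
        pathwidth (red I).network.underlying ≤ C * I.k) ∧
      (∃ p : Polynomial ℕ, ∀ (I : MulticoloredClique) (e : Fin (red I).m),
        (red I).network.cap e ≤ p.eval I.n) := by
  refine ⟨fun I => (CliqueStrip.dataOf I).toInstance,
    CliqueStrip.nonempty_computableInPolyTime_toInstance, CliqueStrip.isYes_iff,
    fun I => FlowNetwork.IsPlanar.reindex (StripData.isPlanar_network _) _ _,
    ⟨5, fun I => StripData.pathwidth_toInstance_le _⟩,
    -- Capacities are at most `2 * base`, with `base = 2 * n + 2`.
    2 * (2 * Polynomial.X + 2), fun I e => ?_⟩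
  refine (StripData.cap_le _ _).trans ?_
  simp [CliqueStrip.dataOf, CliqueStrip.data]
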